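/- Let $i\mathsf{RCA}_0^\omega$ be the intuitionistic theory in all finite types (type $0$ for natural numbers, $1=0\to0$) with constants $0$, successor, the combinators $\Pi,\Sigma$ and the recursor $R_0$ of type level $0$, whose axioms are: the equality axioms at type $0$, the extensionality axioms $\forall z\,\forall x\,\forall y\,(x=y\to z(x)=z(y))$ in all finite types (equality at higher types being defined pointwise), the successor axioms, the defining equations of $\Pi,\Sigma,R_0$, quantifier-free induction, and the quantifier-free choice scheme $\mathsf{QF}\text{-}\mathsf{AC}^{1,0}$: $\forall x^1\exists y^0A(x,y)\to\exists Y^{1\to0}\forall x^1A(x,Y(x))$ with $A$ quantifier-free. A problem $\mathsf P$ is a formula $\forall x(p_1(x)\to\exists y\,p_2(x,y))$; its parallelization $\widehat{\mathsf P}$ has as inputs the sequences of inputs of $\mathsf P$ and as solutions the sequences of corresponding solutions. For problems $\mathsf P$ and $\mathsf Q:\forall u(q_1(u)\to\exists v\,q_2(u,v))$, let $\mathsf Q\le_W\mathsf P$ be the formula $$\exists\Phi\,\exists\Psi\,\forall u\,\forall y\,\bigl(q_1(u)\to(p_1(\Phi(u))\land(p_2(\Phi(u),y)\to q_2(u,\Psi(u,y))))\bigr),$$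 and let $\mathsf Q\le_{W}^{*}\mathsf P$ be the same formula with $\Psi(y)$ in place of $\Psi(u,y)$, where $\Phi,\Psi$ range over functionals of the appropriate finite types. $\mathsf{LPO}$ is the total problem whose inputs are the functions $p:\mathbb N\to\mathbb N$ and whose solutions are the numbers $n$ such that $n=0$ implies $p(t)>0$ for all $t$, and $n>0$ implies $p(n-1)=0$ and $p(t)>0$ for all $t<n-1$. A graph $G$ on the vertex set $\mathbb N$ is given by a function $e:\mathbb N\to\mathbb N$, where for $a<b$ the pair $(a,b)$ is an edge iff $e\neq0$ at the code of $(a,b)$ under a fixed primitive recursive bijection between increasing pairs and $\mathbb N$; $G_m$ is the subgraph of $G$ induced on $\{0,\dots,m\}$. A $k$-coloring assigns numbers less than $k$ to the vertices so that the endpoints of any edge get distinct numbers. $\mathsf{TGC}k$ is the total problem whose inputs are the graphs $G$ and whose solutions are the functions $f:\mathbb N\to\mathbb N$ such that $f(0)=0$ implies that $f$ is a $k$-coloring of $G$, and $f(0)>0$ implies that $G_{f(0)}$ has no $k$-coloring. $\mathsf{TGC}^{*}k$ is the same problem with the additional requirement that if $f(0)>0$ then $G_t$ has a $k$-coloring for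 all $t<f(0)$, that is, $G_{f(0)}$ is the first initial subgraph without a $k$-coloring. Theorem. $i\mathsf{RCA}_0^\omega$ proves that for every $k\ge2$, $$\mathsf{LPO}\le_W\mathsf{TGC}k\le_W\widehat{\mathsf{LPO}}\qquad\text{and}\qquad\mathsf{LPO}\le_W^{*}\mathsf{TGC}^{*}k\le_W^{*}\widehat{\mathsf{LPO}}.$$ -/

import Mathlib

namespace IRCA

/-! ### The language: finite types, terms, formulas -/

/-- Finite types: `nat` is the type `0`, `arrow σ τ` is the type `σ → τ`. -/
inductive Ty : Type
  | nat : Ty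
  | arrow : Ty → Ty → Ty

/-- The type `1` of functions from numbers to numbers. -/
abbrev Ty.one : Ty := Ty.arrow Ty.nat Ty.nat

/-- A context lists the types of the variables that may occur free. -/
abbrev Ctx : Type := List Ty

/-- Typed de Bruijn variables: `Var Γ τ` are the variables of type `τ` in the context `Γ`. -/
inductive Var : Ctx → Ty → Type
  | zero {Γ : Ctx} {σ : Ty} : Var (σ :: Γ) σ
  | succ {Γ : Ctx} {σ τ : Ty} : Var Γ τ → Var (σ :: Γ) τ

/-- Terms in all finite types over the constants zero, successor, the combinators `Π` and `Σ`
(here `K` and `S`), and the recursor `R₀` of type level `0`. -/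
inductive Term (Γ : Ctx) : Ty → Type
  | var {τ : Ty} : Var Γ τ → Term Γ τ
  | app {σ τ : Ty} : Term Γ (Ty.arrow σ τ) → Term Γ σ → Term Γ τ
  | zero : Term Γ Ty.nat
  | succ : Term Γ (Ty.arrow Ty.nat Ty.nat)
  | K {σ τ : Ty} : Term Γ (Ty.arrow σ (Ty.arrow τ σ))
  | S {ρ σ τ : Ty} : Term Γ (Ty.arrow (Ty.arrow ρ (Ty.arrow σ τ))
      (Ty.arrow (Ty.arrow ρ σ) (Ty.arrow ρ τ)))
  | R : Term Γ (Ty.arrow Ty.nat (Ty.arrow Ty.nat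
      (Ty.arrow (Ty.arrow Ty.nat (Ty.arrow Ty.nat Ty.nat)) Ty.nat)))

/-- Formulas of intuitionistic predicate logic in all finite types. The only atomic formulas are
`⊥` and equations between terms of type `0`. -/
inductive Formula : Ctx → Type
  | eq {Γ : Ctx} : Term Γ Ty.nat → Term Γ Ty.nat → Formula Γ
  | bot {Γ : Ctx} : Formula Γ
  | and {Γ : Ctx} : Formula Γ → Formula Γ → Formula Γ
  | or {Γ : Ctx} : Formula Γ → Formula Γ → Formula Γ
  | imp {Γ : Ctx} : Formula Γ → Formula Γ → Formula Γ
  | all {Γ : Ctx} (σ : Ty) : Formula (σ :: Γ) → Formula Γ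
  | ex {Γ : Ctx} (σ : Ty) : Formula (σ :: Γ) → Formula Γ

/-! ### Substitution -/

/-- Simultaneous substitutions of terms over `Δ` for the variables of `Γ`. -/
abbrev Subst (Γ Δ : Ctx) : Type := ∀ ⦃τ : Ty⦄, Var Γ τ → Term Δ τ

/-- The identity substitution. -/
def Subst.id (Γ : Ctx) : Subst Γ Γ := fun _ v => Term.var v

/-- The substitution that embeds a context into its extension by one variable. -/
def Subst.wk {Γ : Ctx} (σ : Ty) : Subst Γ (σ :: Γ) := fun _ v => Term.var (Var.succ v)

/-- Substitute `t` for the variable `0`, and use `θ` for the others. -/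
def Subst.cons {Γ Δ : Ctx} {σ : Ty} (t : Term Δ σ) (θ : Subst Γ Δ) : Subst (σ :: Γ) Δ
  | _, Var.zero => t
  | _, Var.succ v => θ v

/-- Apply a substitution to a term. -/
def Term.subst {Γ Δ : Ctx} (θ : Subst Γ Δ) : {τ : Ty} → Term Γ τ → Term Δ τ
  | _, Term.var v => θ v
  | _, Term.app f a => Term.app (f.subst θ) (a.subst θ)
  | _, Term.zero => Term.zero
  | _, Term.succ => Term.succ
  | _, Term.K => Term.K
  | _, Term.S => Term.S
  | _, Term.R => Term.R

/-- Regard a term as a term with one more variable. -/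
def Term.wk {Γ : Ctx} {τ : Ty} (σ : Ty) (t : Term Γ τ) : Term (σ :: Γ) τ :=
  t.subst (Subst.wk σ)

/-- Push a substitution under a binder. -/
def Subst.lift {Γ Δ : Ctx} (σ : Ty) (θ : Subst Γ Δ) : Subst (σ :: Γ) (σ :: Δ) :=
  Subst.cons (Term.var Var.zero) (fun _ v => (θ v).wk σ)

/-- Apply a (capture-avoiding) substitution to a formula. -/
def Formula.subst : {Γ Δ : Ctx} → Subst Γ Δ → Formula Γ → Formula Δ
  | _, _, θ, Formula.eq s t => Formula.eq (s.subst θ) (t.subst θ)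
  | _, _, _, Formula.bot => Formula.bot
  | _, _, θ, Formula.and φ ψ => Formula.and (φ.subst θ) (ψ.subst θ)
  | _, _, θ, Formula.or φ ψ => Formula.or (φ.subst θ) (ψ.subst θ)
  | _, _, θ, Formula.imp φ ψ => Formula.imp (φ.subst θ) (ψ.subst θ)
  | _, _, θ, Formula.all σ φ => Formula.all σ (φ.subst (θ.lift σ))
  | _, _, θ, Formula.ex σ φ => Formula.ex σ (φ.subst (θ.lift σ))

/-- Regard a formula as a formula with one more variable. -/
def Formula.wk {Γ : Ctx} (σ : Ty) (φ : Formula Γ) : Formula (σ :: Γ) :=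
  φ.subst (Subst.wk σ)

/-- Instantiate the variable `0` by a term. -/
def Formula.inst {Γ : Ctx} {σ : Ty} (φ : Formula (σ :: Γ)) (t : Term Γ σ) : Formula Γ :=
  φ.subst (Subst.cons t (Subst.id Γ))

/-- Quantifier-free formulas. -/
def Formula.QF : {Γ : Ctx} → Formula Γ → Prop
  | _, Formula.eq _ _ => True
  | _, Formula.bot => True
  | _, Formula.and φ ψ => φ.QF ∧ ψ.QF
  | _, Formula.or φ ψ => φ.QF ∧ ψ.QF
  | _, Formula.imp φ ψ => φ.QF ∧ ψ.QF
  | _, Formula.all _ _ => False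
  | _, Formula.ex _ _ => False

/-- Negation. -/
def Formula.neg {Γ : Ctx} (φ : Formula Γ) : Formula Γ := φ.imp Formula.bot

/-- A trivially true formula, the domain of a total problem. -/
def Formula.top {Γ : Ctx} : Formula Γ := Formula.bot.imp Formula.bot

/-! ### Basic terms -/

/-- The variable bound last. -/
abbrev v0 {Γ : Ctx} {a : Ty} : Term (a :: Γ) a := Term.var Var.zero

/-- The variable bound last but one. -/
abbrev v1 {Γ : Ctx} {a b : Ty} : Term (a :: b :: Γ) b := Term.var (Var.succ Var.zero)

/-- The variable bound last but two. -/
abbrev v2 {Γ : Ctx} {a b c : Ty} : Term (a :: b :: c :: Γ) c :=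
  Term.var (Var.succ (Var.succ Var.zero))

/-- The variable bound last but three. -/
abbrev v3 {Γ : Ctx} {a b c d : Ty} : Term (a :: b :: c :: d :: Γ) d :=
  Term.var (Var.succ (Var.succ (Var.succ Var.zero)))

/-- Abstraction `λ x. t`, defined from the combinators (bracket abstraction). -/
def Term.lam {Γ : Ctx} {σ : Ty} : {τ : Ty} → Term (σ :: Γ) τ → Term Γ (Ty.arrow σ τ)
  | _, Term.var Var.zero => (Term.S.app Term.K).app (Term.K (τ := σ))
  | _, Term.var (Var.succ v) => Term.K.app (Term.var v)
  | _, Term.app f a => (Term.S.app f.lam).app a.lam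
  | _, Term.zero => Term.K.app Term.zero
  | _, Term.succ => Term.K.app Term.succ
  | _, Term.K => Term.K.app Term.K
  | _, Term.S => Term.K.app Term.S
  | _, Term.R => Term.K.app Term.R

/-- The successor of `t`. -/
def Term.suc {Γ : Ctx} (t : Term Γ Ty.nat) : Term Γ Ty.nat := Term.succ.app t

/-- Primitive recursion: the value at `t` of the function `g` with
`g 0 = a` and `g (x + 1) = f (g x) x`. -/
def Term.prec {Γ : Ctx} (t a : Term Γ Ty.nat)
    (f : Term Γ (Ty.arrow Ty.nat (Ty.arrow Ty.nat Ty.nat))) : Term Γ Ty.nat :=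
  ((Term.R.app t).app a).app f

/-- The predecessor of `t` (with `0 - 1 = 0`). -/
def Term.pred {Γ : Ctx} (t : Term Γ Ty.nat) : Term Γ Ty.nat :=
  Term.prec t Term.zero (Term.lam (Term.lam v0))

/-- Addition `s + t`. -/
def Term.add {Γ : Ctx} (s t : Term Γ Ty.nat) : Term Γ Ty.nat :=
  Term.prec t s (Term.lam (Term.lam (Term.suc v1)))

/-- Truncated subtraction `s - t`. -/
def Term.sub {Γ : Ctx} (s t : Term Γ Ty.nat) : Term Γ Ty.nat :=
  Term.prec t s (Term.lam (Term.lam (Term.pred v1)))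

/-- The triangular number `0 + 1 + ⋯ + (t - 1)`. -/
def Term.tri {Γ : Ctx} (t : Term Γ Ty.nat) : Term Γ Ty.nat :=
  Term.prec t Term.zero (Term.lam (Term.lam (Term.add v1 v0)))

/-- The code `b (b - 1) / 2 + a` of the increasing pair `a < b`; this is a primitive recursive
bijection between the increasing pairs and the natural numbers. -/
def Term.pairCode {Γ : Ctx} (a b : Term Γ Ty.nat) : Term Γ Ty.nat := Term.add (Term.tri b) a

/-- `s ≤ t`. -/
def Formula.le {Γ : Ctx} (s t : Term Γ Ty.nat) : Formula Γ := Formula.eq (Term.sub s t) Term.zero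

/-- `s < t`. -/
def Formula.lt {Γ : Ctx} (s t : Term Γ Ty.nat) : Formula Γ := Formula.le (Term.suc s) t

/-! ### The formal system -/

/-- Equality in all finite types: the abbreviation `∀ z₁ … zₙ, s z₁ … zₙ = t z₁ … zₙ`. -/
def eqn : {Γ : Ctx} → (τ : Ty) → Term Γ τ → Term Γ τ → Formula Γ
  | _, Ty.nat, s, t => Formula.eq s t
  | _, Ty.arrow σ τ, s, t =>
      Formula.all σ (eqn τ (Term.app (s.wk σ) v0) (Term.app (t.wk σ) v0))

/-- The non-logical axioms of `iRCA₀^ω`: extensional arithmetic in all finite types with recursion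
of type level `0` and quantifier-free induction, together with quantifier-free choice
`QF-AC^{1,0}`. Free variables (parameters) of arbitrary types are allowed. -/
inductive Axiom : {Γ : Ctx} → Formula Γ → Prop
  | refl {Γ : Ctx} (t : Term Γ Ty.nat) : Axiom (Formula.eq t t)
  | symm {Γ : Ctx} (s t : Term Γ Ty.nat) : Axiom ((Formula.eq s t).imp (Formula.eq t s))
  | trans {Γ : Ctx} (r s t : Term Γ Ty.nat) :
      Axiom ((Formula.eq r s).imp ((Formula.eq s t).imp (Formula.eq r t)))
  | ext {Γ : Ctx} {σ τ : Ty} (z : Term Γ (Ty.arrow σ τ)) (s t : Term Γ σ) :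
      Axiom ((eqn σ s t).imp (eqn τ (z.app s) (z.app t)))
  | succ_ne_zero {Γ : Ctx} (t : Term Γ Ty.nat) : Axiom (Formula.eq t.suc Term.zero).neg
  | succ_inj {Γ : Ctx} (s t : Term Γ Ty.nat) :
      Axiom ((Formula.eq s.suc t.suc).imp (Formula.eq s t))
  | K {Γ : Ctx} {σ τ : Ty} (s : Term Γ σ) (t : Term Γ τ) :
      Axiom (eqn σ ((Term.K.app s).app t) s)
  | S {Γ : Ctx} {ρ σ τ : Ty} (r : Term Γ (Ty.arrow ρ (Ty.arrow σ τ)))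
      (s : Term Γ (Ty.arrow ρ σ)) (t : Term Γ ρ) :
      Axiom (eqn τ (((Term.S.app r).app s).app t) ((r.app t).app (s.app t)))
  | R_zero {Γ : Ctx} (a : Term Γ Ty.nat)
      (f : Term Γ (Ty.arrow Ty.nat (Ty.arrow Ty.nat Ty.nat))) :
      Axiom (Formula.eq (Term.prec Term.zero a f) a)
  | R_succ {Γ : Ctx} (t a : Term Γ Ty.nat)
      (f : Term Γ (Ty.arrow Ty.nat (Ty.arrow Ty.nat Ty.nat))) :
      Axiom (Formula.eq (Term.prec t.suc a f) ((f.app (Term.prec t a f)).app t))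
  | induction {Γ : Ctx} (φ : Formula (Ty.nat :: Γ)) (hφ : φ.QF) :
      Axiom ((φ.inst Term.zero).imp
        ((Formula.all Ty.nat
          (φ.imp (φ.subst (Subst.cons (Term.suc v0) (Subst.wk Ty.nat))))).imp
          (Formula.all Ty.nat φ)))
  /- In `φ`, the variable `0` is the number `y` and the variable `1` is the function `x`:
  `(∀ x ∃ y, φ x y) → ∃ Y ∀ x, φ x (Y x)`. -/
  | choice {Γ : Ctx} (φ : Formula (Ty.nat :: Ty.one :: Γ)) (hφ : φ.QF) :
      Axiom ((Formula.all Ty.one (Formula.ex Ty.nat φ)).imp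
        (Formula.ex (Ty.arrow Ty.one Ty.nat) (Formula.all Ty.one
          (φ.subst (Subst.cons (Term.app v1 v0) (Subst.cons v0
            (fun _ v => Term.var (Var.succ (Var.succ v)))))))))

/-- Derivability in `iRCA₀^ω`: natural deduction for many-sorted intuitionistic predicate logic
with the axioms above. `Proves H φ` says that `φ` follows from the open assumptions `H`. -/
inductive Proves : {Γ : Ctx} → List (Formula Γ) → Formula Γ → Prop
  | ax {Γ : Ctx} {H : List (Formula Γ)} {φ : Formula Γ} : Axiom φ → Proves H φ
  | hyp {Γ : Ctx} {H : List (Formula Γ)} {φ : Formula Γ} : φ ∈ H → Proves H φ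
  | botE {Γ : Ctx} {H : List (Formula Γ)} {φ : Formula Γ} : Proves H Formula.bot → Proves H φ
  | andI {Γ : Ctx} {H : List (Formula Γ)} {φ ψ : Formula Γ} :
      Proves H φ → Proves H ψ → Proves H (φ.and ψ)
  | andE₁ {Γ : Ctx} {H : List (Formula Γ)} {φ ψ : Formula Γ} : Proves H (φ.and ψ) → Proves H φ
  | andE₂ {Γ : Ctx} {H : List (Formula Γ)} {φ ψ : Formula Γ} : Proves H (φ.and ψ) → Proves H ψ
  | orI₁ {Γ : Ctx} {H : List (Formula Γ)} {φ ψ : Formula Γ} : Proves H φ → Proves H (φ.or ψ)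
  | orI₂ {Γ : Ctx} {H : List (Formula Γ)} {φ ψ : Formula Γ} : Proves H ψ → Proves H (φ.or ψ)
  | orE {Γ : Ctx} {H : List (Formula Γ)} {φ ψ χ : Formula Γ} :
      Proves H (φ.or ψ) → Proves (φ :: H) χ → Proves (ψ :: H) χ → Proves H χ
  | impI {Γ : Ctx} {H : List (Formula Γ)} {φ ψ : Formula Γ} :
      Proves (φ :: H) ψ → Proves H (φ.imp ψ)
  | impE {Γ : Ctx} {H : List (Formula Γ)} {φ ψ : Formula Γ} :
      Proves H (φ.imp ψ) → Proves H φ → Proves H ψ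
  | allI {Γ : Ctx} {H : List (Formula Γ)} {σ : Ty} {φ : Formula (σ :: Γ)} :
      Proves (H.map (Formula.wk σ)) φ → Proves H (Formula.all σ φ)
  | allE {Γ : Ctx} {H : List (Formula Γ)} {σ : Ty} {φ : Formula (σ :: Γ)} (t : Term Γ σ) :
      Proves H (Formula.all σ φ) → Proves H (φ.inst t)
  | exI {Γ : Ctx} {H : List (Formula Γ)} {σ : Ty} {φ : Formula (σ :: Γ)} (t : Term Γ σ) :
      Proves H (φ.inst t) → Proves H (Formula.ex σ φ)
  | exE {Γ : Ctx} {H : List (Formula Γ)} {σ : Ty} {φ : Formula (σ :: Γ)} {ψ : Formula Γ} :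
      Proves H (Formula.ex σ φ) → Proves (φ :: H.map (Formula.wk σ)) (ψ.wk σ) → Proves H ψ

/-- A closed formula is provable in `iRCA₀^ω`. -/
def Provable (φ : Formula []) : Prop := Proves [] φ

/-! ### Problems and formalized Weihrauch reducibility -/

/-- A problem `∀ x (dom x → ∃ y, sol x y)`, with parameters in `Γ`. In `dom`, the variable `0` is
the input `x`; in `sol`, the variable `0` is the solution `y` and the variable `1` is `x`. -/
structure Problem (Γ : Ctx) where
  inTy : Ty
  outTy : Ty
  dom : Formula (inTy :: Γ)
  sol : Formula (outTy :: inTy :: Γ)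

/-- `dom x`, for a term `x` in a context that extends `Γ` by means of `θ`. -/
def Problem.domAt {Γ Δ : Ctx} (P : Problem Γ) (θ : Subst Γ Δ) (x : Term Δ P.inTy) : Formula Δ :=
  P.dom.subst (Subst.cons x θ)

/-- `sol x y`, for terms `x` and `y` in a context that extends `Γ` by means of `θ`. -/
def Problem.solAt {Γ Δ : Ctx} (P : Problem Γ) (θ : Subst Γ Δ) (x : Term Δ P.inTy)
    (y : Term Δ P.outTy) : Formula Δ :=
  P.sol.subst (Subst.cons y (Subst.cons x θ))

/-- The parallelization: inputs are sequences of inputs, solutions are sequences of solutions. -/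
def Problem.hat {Γ : Ctx} (P : Problem Γ) : Problem Γ where
  inTy := Ty.arrow Ty.nat P.inTy
  outTy := Ty.arrow Ty.nat P.outTy
  dom := Formula.all Ty.nat
    (P.domAt (fun _ v => Term.var (Var.succ (Var.succ v))) (Term.app v1 v0))
  sol := Formula.all Ty.nat
    (P.solAt (fun _ v => Term.var (Var.succ (Var.succ (Var.succ v))))
      (Term.app v2 v0) (Term.app v1 v0))

/-- The formula `Q ≤_W P`, with a backward functional that may use the original input:
`∃ Φ ∃ Ψ ∀ u ∀ y (dom_Q u → dom_P (Φ u) ∧ (sol_P (Φ u) y → sol_Q u (Ψ u y)))`.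
Below the quantifiers, `v3, v2, v1, v0` are `Φ, Ψ, u, y`. -/
def Problem.leW {Γ : Ctx} (Q P : Problem Γ) : Formula Γ :=
  let θ : Subst Γ (P.outTy :: Q.inTy :: Ty.arrow Q.inTy (Ty.arrow P.outTy Q.outTy) ::
      Ty.arrow Q.inTy P.inTy :: Γ) :=
    fun _ v => Term.var (Var.succ (Var.succ (Var.succ (Var.succ v))))
  Formula.ex (Ty.arrow Q.inTy P.inTy) (Formula.ex (Ty.arrow Q.inTy (Ty.arrow P.outTy Q.outTy))
    (Formula.all Q.inTy (Formula.all P.outTy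
      ((Q.domAt θ v1).imp ((P.domAt θ (Term.app v3 v1)).and
        ((P.solAt θ (Term.app v3 v1) v0).imp
          (Q.solAt θ v1 (Term.app (Term.app v2 v1) v0))))))))

/-- The formula for reducibility with a backward functional that sees only the solution:
`∃ Φ ∃ Ψ ∀ u ∀ y (dom_Q u → dom_P (Φ u) ∧ (sol_P (Φ u) y → sol_Q u (Ψ y)))`.
Below the quantifiers, `v3, v2, v1, v0` are `Φ, Ψ, u, y`. -/
def Problem.leStrong {Γ : Ctx} (Q P : Problem Γ) : Formula Γ :=
  let θ : Subst Γ (P.outTy :: Q.inTy :: Ty.arrow P.outTy Q.outTy ::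
      Ty.arrow Q.inTy P.inTy :: Γ) :=
    fun _ v => Term.var (Var.succ (Var.succ (Var.succ (Var.succ v))))
  Formula.ex (Ty.arrow Q.inTy P.inTy) (Formula.ex (Ty.arrow P.outTy Q.outTy)
    (Formula.all Q.inTy (Formula.all P.outTy
      ((Q.domAt θ v1).imp ((P.domAt θ (Term.app v3 v1)).and
        ((P.solAt θ (Term.app v3 v1) v0).imp
          (Q.solAt θ v1 (Term.app v2 v0))))))))

/-! ### The problems -/

/-- `LPO`, with `p` the variable `1` and the value `n` the variable `0`:
`n = 0` implies `∀ t, p t > 0`, and `n > 0` implies `p (n - 1) = 0 ∧ ∀ t < n - 1, p t > 0`. -/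
def LPO {Γ : Ctx} : Problem Γ where
  inTy := Ty.one
  outTy := Ty.nat
  dom := Formula.top
  sol := Formula.and
    ((Formula.eq v0 Term.zero).imp
      (Formula.all Ty.nat (Formula.lt Term.zero (Term.app v2 v0))))
    ((Formula.lt Term.zero v0).imp
      (Formula.and (Formula.eq (Term.app v1 (Term.pred v0)) Term.zero)
        (Formula.all Ty.nat ((Formula.lt v0 (Term.pred v1)).imp
          (Formula.lt Term.zero (Term.app v2 v0))))))

/-- `(a, b) ∈ G`, for `a < b` and `e` the characteristic function of the edge set of `G`. -/
def edge {Γ : Ctx} (e : Term Γ Ty.one) (a b : Term Γ Ty.nat) : Formula Γ :=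
  (Formula.eq (Term.app e (Term.pairCode a b)) Term.zero).neg

/-- `f` is a `k`-coloring of the graph `G` with edge set `e`. -/
def isColoring {Γ : Ctx} (k : Term Γ Ty.nat) (e f : Term Γ Ty.one) : Formula Γ :=
  Formula.and
    (Formula.all Ty.nat (Formula.lt (Term.app (f.wk _) v0) (k.wk _)))
    (Formula.all Ty.nat (Formula.all Ty.nat
      ((Formula.lt v1 v0).imp ((edge ((e.wk _).wk _) v1 v0).imp
        (Formula.eq (Term.app ((f.wk _).wk _) v1) (Term.app ((f.wk _).wk _) v0)).neg))))

/-- The values of `f` at `0, …, m` are a `k`-coloring of the subgraph `G_m` of `G` with the vertex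
set `{0, …, m}`. -/
def isColoringUpTo {Γ : Ctx} (k : Term Γ Ty.nat) (e : Term Γ Ty.one) (m : Term Γ Ty.nat)
    (f : Term Γ Ty.one) : Formula Γ :=
  Formula.and
    (Formula.all Ty.nat ((Formula.le v0 (m.wk _)).imp
      (Formula.lt (Term.app (f.wk _) v0) (k.wk _))))
    (Formula.all Ty.nat (Formula.all Ty.nat
      ((Formula.lt v1 v0).imp ((Formula.le v0 ((m.wk _).wk _)).imp
        ((edge ((e.wk _).wk _) v1 v0).imp
          (Formula.eq (Term.app ((f.wk _).wk _) v1) (Term.app ((f.wk _).wk _) v0)).neg)))))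

/-- `G_m` has a `k`-coloring. (A function on `{0, …, m}` is given by any extension to all numbers,
the values beyond `m` being irrelevant.) -/
def colorable {Γ : Ctx} (k : Term Γ Ty.nat) (e : Term Γ Ty.one) (m : Term Γ Ty.nat) : Formula Γ :=
  Formula.ex Ty.one (isColoringUpTo (k.wk _) (e.wk _) (m.wk _) v0)

/-- Total `k`-coloring, with `G` the variable `1` and `f` the variable `0`: `f 0 = 0` implies that
`f` is a `k`-coloring of `G`, and `f 0 > 0` implies that `G_{f 0}` has no `k`-coloring. -/
def TGC {Γ : Ctx} (k : Term Γ Ty.nat) : Problem Γ where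
  inTy := Ty.one
  outTy := Ty.one
  dom := Formula.top
  sol := Formula.and
    ((Formula.eq (Term.app v0 Term.zero) Term.zero).imp
      (isColoring ((k.wk _).wk _) v1 v0))
    ((Formula.lt Term.zero (Term.app v0 Term.zero)).imp
      (colorable ((k.wk _).wk _) v1 (Term.app v0 Term.zero)).neg)

/-- Total `k`-coloring where a positive flag `f 0` has to be the first `m` for which `G_m` has no
`k`-coloring. -/
def TGCfirst {Γ : Ctx} (k : Term Γ Ty.nat) : Problem Γ where
  inTy := Ty.one
  outTy := Ty.one
  dom := Formula.top
  sol := Formula.and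
    ((Formula.eq (Term.app v0 Term.zero) Term.zero).imp
      (isColoring ((k.wk _).wk _) v1 v0))
    ((Formula.lt Term.zero (Term.app v0 Term.zero)).imp
      (Formula.and
        (colorable ((k.wk _).wk _) v1 (Term.app v0 Term.zero)).neg
        (Formula.all Ty.nat ((Formula.lt v0 (Term.app v1 Term.zero)).imp
          (colorable (((k.wk _).wk _).wk _) v2 v0)))))

end IRCA

namespace IRCA

/-! ### Substitution -/

/-! The combinatorics is short. Given `p`, join `a < b` when `p` has a zero below `b`. If `p` has no
zero the graph has no edges. If the first zero is `s`, the vertices from `s` on form a clique, so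
`G_{s+k}` has no `k`-coloring, while the truncated difference `x - s` colors every smaller `G_m`.
Hence any flag `m` bounds a zero of `p`, which a search then finds (`Model.isLPO_flag`), and the
first flag is exactly `s + k`, from which the solution is computed without looking at `p`
(`Model.isLPO_flagFirst`).

Conversely, code partial colorings by digits in base `k + 1` (digit `j + 1` for color `j`, digit `0`
for no color), and ask `LPO` for each code `i` whether some `G_m` admits no coloring extending `i`.
If the empty code is obstructed, the answer is the first uncolorable `G_m`. Otherwise the answers
steer a leftmost path through the codes that extend to all `G_m`, as in Kőnig's lemma; a
transposition of colors then gives vertex `0` the color `0` (`Model.exists_extension`,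
`Model.path_spec`, `Model.isCol_path`, `Model.total_spec`). The backward functional uses only the
answers.

The formal derivations are not written out step by step. All functionals are explicit terms, so the
body of each reduction is built from equations by conjunction, implication and universal
quantification, apart from the colorability statements. For such negative formulas classical truth
suffices: if an equation `t = 0` were not derivable, `t` would be a successor in a term model
obtained from a maximal consistent set (`exists_maxCons`, `MaxCons.model`, `Formula.goal_eq_zero`).
Decidability of `t = 0`, proved by quantifier-free induction, makes this return an intuitionistic
derivation. Colorability is existential, but it is provably equivalent to an equation by bounded
search (`Formula.exact_colorable`, `Formula.goal_colorable`).

The term models may be nonstandard, and so may `k`. The pigeonhole principle, codes of sequences and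
bounds for finitely many values are therefore developed inside an arbitrary model, with induction
only for zero sets of its functions. -/

theorem Term.subst_subst {Γ Δ Θ : Ctx} (θ : Subst Γ Δ) (η : Subst Δ Θ) {τ : Ty} (t : Term Γ τ) :
    (t.subst θ).subst η = t.subst (fun _ v => (θ v).subst η) := by
  induction t with
  | app f a hf ha => simp only [Term.subst, hf, ha]
  | _ => rfl

theorem Term.subst_id {Γ : Ctx} {τ : Ty} (t : Term Γ τ) :
    t.subst (fun _ v => Term.var v) = t := by
  induction t with
  | app f a hf ha => simp only [Term.subst, hf, ha]
  | _ => rfl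

theorem Term.subst_subst_id {Γ : Ctx} {τ : Ty} (t : Term Γ τ) : t.subst (Subst.id Γ) = t :=
  t.subst_id

theorem Term.wk_subst_cons {Γ Δ : Ctx} {σ τ : Ty} (t : Term Γ τ) (a : Term Δ σ) (θ : Subst Γ Δ) :
    (t.wk σ).subst (Subst.cons a θ) = t.subst θ := by
  rw [Term.wk, Term.subst_subst]; rfl

theorem Term.wk_subst_lift {Γ Δ : Ctx} {σ τ : Ty} (t : Term Γ τ) (θ : Subst Γ Δ) :
    (t.wk σ).subst (θ.lift σ) = (t.subst θ).wk σ := by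
  rw [Subst.lift, Term.wk_subst_cons, Term.wk, Term.subst_subst]; rfl

theorem Subst.lift_comp {Γ Δ Θ : Ctx} (σ : Ty) (θ : Subst Γ Δ) (η : Subst Δ Θ) :
    (fun _ v => ((θ.lift σ) v).subst (η.lift σ) : Subst (σ :: Γ) (σ :: Θ)) =
      Subst.lift σ (fun _ v => (θ v).subst η) := by
  funext τ v
  cases v with
  | zero => rfl
  | succ v => exact Term.wk_subst_lift (θ v) η

theorem Subst.lift_var {Γ : Ctx} (σ : Ty) :
    Subst.lift σ (fun _ v => Term.var v : Subst Γ Γ) = fun _ v => Term.var v := by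
  funext τ v
  cases v <;> rfl

theorem Formula.subst_subst {Γ Δ Θ : Ctx} (θ : Subst Γ Δ) (η : Subst Δ Θ) (φ : Formula Γ) :
    (φ.subst θ).subst η = φ.subst (fun _ v => (θ v).subst η) := by
  induction φ generalizing Δ Θ with
  | eq s t => simp only [Formula.subst, Term.subst_subst]
  | bot => rfl
  | and _ _ h₁ h₂ => simp only [Formula.subst, h₁, h₂]
  | or _ _ h₁ h₂ => simp only [Formula.subst, h₁, h₂]
  | imp _ _ h₁ h₂ => simp only [Formula.subst, h₁, h₂]
  | all σ _ h => simp only [Formula.subst, h, Subst.lift_comp]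
  | ex σ _ h => simp only [Formula.subst, h, Subst.lift_comp]

theorem Formula.subst_id {Γ : Ctx} (φ : Formula Γ) :
    φ.subst (fun _ v => Term.var v) = φ := by
  induction φ with
  | eq s t => simp only [Formula.subst, Term.subst_id]
  | bot => rfl
  | and _ _ h₁ h₂ => simp only [Formula.subst, h₁, h₂]
  | or _ _ h₁ h₂ => simp only [Formula.subst, h₁, h₂]
  | imp _ _ h₁ h₂ => simp only [Formula.subst, h₁, h₂]
  | all σ _ h => simp only [Formula.subst, Subst.lift_var, h]
  | ex σ _ h => simp only [Formula.subst, Subst.lift_var, h]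

theorem Subst.lift_cons {Γ Δ Θ : Ctx} {σ : Ty} (θ : Subst Γ Δ) (t : Term Θ σ) (η : Subst Δ Θ) :
    (fun _ v => ((θ.lift σ) v).subst (Subst.cons t η) : Subst (σ :: Γ) Θ) =
      Subst.cons t (fun _ v => (θ v).subst η) := by
  funext τ v
  cases v with
  | zero => rfl
  | succ v => exact Term.wk_subst_cons (θ v) t η

theorem Formula.subst_lift_inst {Γ Δ : Ctx} {σ : Ty} (φ : Formula (σ :: Γ)) (θ : Subst Γ Δ)
    (t : Term Δ σ) : (φ.subst (θ.lift σ)).inst t = φ.subst (Subst.cons t θ) := by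
  rw [Formula.inst, Formula.subst_subst, Subst.lift_cons]
  congr 1
  funext τ v
  cases v with
  | zero => rfl
  | succ v => exact Term.subst_id (θ v)

theorem eqn_subst {Γ Δ : Ctx} (θ : Subst Γ Δ) (τ : Ty) (s t : Term Γ τ) :
    (eqn τ s t).subst θ = eqn τ (s.subst θ) (t.subst θ) := by
  induction τ generalizing Γ Δ with
  | nat => rfl
  | arrow σ τ _ ih =>
    simp only [eqn, Formula.subst, ih, Term.subst, Term.wk_subst_lift]; rfl

/-! ### Derived rules -/

theorem Proves.weaken {Γ : Ctx} {H H' : List (Formula Γ)} {φ : Formula Γ} (h : Proves H φ)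
    (hs : ∀ ψ ∈ H, ψ ∈ H') : Proves H' φ := by
  have hc : ∀ {Γ : Ctx} {H H' : List (Formula Γ)} (χ : Formula Γ), (∀ ψ ∈ H, ψ ∈ H') →
      ∀ ψ ∈ χ :: H, ψ ∈ χ :: H' := fun χ hs ψ hψ => by
    rcases List.mem_cons.1 hψ with h | h
    · exact h ▸ List.mem_cons_self
    · exact List.mem_cons_of_mem _ (hs _ h)
  have hm : ∀ {Γ : Ctx} {H H' : List (Formula Γ)} (σ : Ty), (∀ ψ ∈ H, ψ ∈ H') →
      ∀ ψ ∈ H.map (Formula.wk σ), ψ ∈ H'.map (Formula.wk σ) := fun σ hs ψ hψ => by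
    obtain ⟨χ, h, rfl⟩ := List.mem_map.1 hψ
    exact List.mem_map_of_mem (hs _ h)
  induction h with
  | ax a => exact .ax a
  | hyp a => exact .hyp (hs _ a)
  | botE _ ih => exact .botE (ih hs)
  | andI _ _ ih₁ ih₂ => exact .andI (ih₁ hs) (ih₂ hs)
  | andE₁ _ ih => exact .andE₁ (ih hs)
  | andE₂ _ ih => exact .andE₂ (ih hs)
  | orI₁ _ ih => exact .orI₁ (ih hs)
  | orI₂ _ ih => exact .orI₂ (ih hs)
  | orE _ _ _ ih ih₁ ih₂ => exact .orE (ih hs) (ih₁ (hc _ hs)) (ih₂ (hc _ hs))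
  | impI _ ih => exact .impI (ih (hc _ hs))
  | impE _ _ ih₁ ih₂ => exact .impE (ih₁ hs) (ih₂ hs)
  | allI _ ih => exact .allI (ih (hm _ hs))
  | allE t _ ih => exact .allE t (ih hs)
  | exI t _ ih => exact .exI t (ih hs)
  | exE _ _ ih₁ ih₂ => exact .exE (ih₁ hs) (ih₂ (hc _ (hm _ hs)))

theorem Proves.cut {Γ : Ctx} {H : List (Formula Γ)} {φ ψ : Formula Γ} (h₁ : Proves H φ)
    (h₂ : Proves (φ :: H) ψ) : Proves H ψ :=
  .impE (.impI h₂) h₁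

theorem Proves.head {Γ : Ctx} {H : List (Formula Γ)} {φ : Formula Γ} : Proves (φ :: H) φ :=
  .hyp List.mem_cons_self

theorem Proves.cons {Γ : Ctx} {H : List (Formula Γ)} {φ ψ : Formula Γ} (h : Proves H φ) :
    Proves (ψ :: H) φ :=
  h.weaken fun _ => List.mem_cons_of_mem _

theorem Proves.mp {Γ : Ctx} {H : List (Formula Γ)} {φ ψ : Formula Γ} (h₁ : Proves H φ)
    (h₂ : Axiom (φ.imp ψ)) : Proves H ψ :=
  .impE (.ax h₂) h₁

/-! ### Equality in all finite types -/

theorem eqn_inst {Γ : Ctx} {σ τ : Ty} {H : List (Formula Γ)} {s t : Term Γ (Ty.arrow σ τ)}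
    (h : Proves H (eqn _ s t)) (a : Term Γ σ) : Proves H (eqn τ (s.app a) (t.app a)) := by
  have := Proves.allE a h
  rw [Formula.inst, eqn_subst] at this
  simp only [Term.subst, Term.wk_subst_cons] at this
  rwa [Term.subst_subst_id, Term.subst_subst_id] at this

theorem eqn_wk_inst {Γ : Ctx} {σ τ : Ty} {H : List (Formula Γ)} {s t : Term Γ (Ty.arrow σ τ)}
    (h : eqn _ s t ∈ H) :
    Proves (H.map (Formula.wk σ)) (eqn τ ((s.wk σ).app v0) ((t.wk σ).app v0)) := by
  apply eqn_inst
  apply Proves.hyp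
  have := List.mem_map_of_mem (f := Formula.wk σ) h
  rwa [Formula.wk, eqn_subst] at this

theorem Proves.eqn_refl {Γ : Ctx} {τ : Ty} (H : List (Formula Γ)) (t : Term Γ τ) :
    Proves H (eqn τ t t) := by
  induction τ generalizing Γ with
  | nat => exact .ax (.refl t)
  | arrow σ τ _ ih => exact .allI (ih _ _)

theorem Proves.eqn_symm {Γ : Ctx} {τ : Ty} {H : List (Formula Γ)} {s t : Term Γ τ}
    (h : Proves H (eqn τ s t)) : Proves H (eqn τ t s) := by
  -- The equation is made an open assumption: `Proves.allI` weakens the whole list of assumptions,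
  -- and `eqn_wk_inst` instantiates the weakened copy.
  suffices ∀ {Γ : Ctx} {H : List (Formula Γ)} {s t : Term Γ τ}, eqn τ s t ∈ H →
      Proves H (eqn τ t s) from h.cut (this List.mem_cons_self)
  clear h s t
  induction τ with
  | nat => intro _ _ s t h; exact (Proves.hyp h).mp (.symm s t)
  | arrow σ τ _ ih =>
    intro _ _ s t h
    exact .allI ((eqn_wk_inst h).cut (ih List.mem_cons_self))

theorem Proves.eqn_trans {Γ : Ctx} {τ : Ty} {H : List (Formula Γ)} {r s t : Term Γ τ}
    (h₁ : Proves H (eqn τ r s)) (h₂ : Proves H (eqn τ s t)) : Proves H (eqn τ r t) := by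
  suffices ∀ {Γ : Ctx} {H : List (Formula Γ)} {r s t : Term Γ τ}, eqn τ r s ∈ H → eqn τ s t ∈ H →
      Proves H (eqn τ r t) from
    h₁.cut (h₂.cons.cut (this (List.mem_cons_of_mem _ List.mem_cons_self) List.mem_cons_self))
  clear h₁ h₂ r s t
  induction τ with
  | nat => intro _ _ r s t h₁ h₂; exact .impE ((Proves.hyp h₁).mp (.trans r s t)) (.hyp h₂)
  | arrow σ τ _ ih =>
    intro _ _ r s t h₁ h₂
    exact .allI ((eqn_wk_inst h₁).cut ((eqn_wk_inst h₂).cons.cut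
      (ih (List.mem_cons_of_mem _ List.mem_cons_self) List.mem_cons_self)))

/-- Changing the function is an instance of a pointwise equation; changing the argument is the
extensionality axiom. This makes application well defined on classes of provably equal terms. -/
theorem Proves.eqn_app {Γ : Ctx} {σ τ : Ty} {H : List (Formula Γ)} {f g : Term Γ (Ty.arrow σ τ)}
    {a b : Term Γ σ} (h₁ : Proves H (eqn _ f g)) (h₂ : Proves H (eqn _ a b)) :
    Proves H (eqn τ (f.app a) (g.app b)) :=
  (eqn_inst h₁ a).eqn_trans (h₂.mp (.ext g a b))

/-- Bracket abstraction does not commute syntactically with substitution, since a compound term put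
in for a variable would itself be abstracted piece by piece. Hence the substitution is applied after
the abstraction. -/
theorem Proves.beta {Γ Δ : Ctx} {σ τ : Ty} (H : List (Formula Δ)) (t : Term (σ :: Γ) τ)
    (θ : Subst Γ Δ) (a : Term Δ σ) :
    Proves H (eqn τ ((t.lam.subst θ).app a) (t.subst (Subst.cons a θ))) := by
  induction t with
  | var v =>
    cases v with
    | zero => exact (Proves.ax (.S _ _ a)).eqn_trans (.ax (.K a _))
    | succ v => exact .ax (.K _ a)
  | app f b hf hb => exact (Proves.ax (.S _ _ a)).eqn_trans (hf.eqn_app hb)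
  | zero => exact .ax (.K _ a)
  | succ => exact .ax (.K _ a)
  | K => exact .ax (.K _ a)
  | S => exact .ax (.K _ a)
  | R => exact .ax (.K _ a)

theorem Proves.beta₂ {Γ Δ : Ctx} {ρ σ τ : Ty} (H : List (Formula Δ)) (t : Term (σ :: ρ :: Γ) τ)
    (θ : Subst Γ Δ) (a : Term Δ ρ) (b : Term Δ σ) :
    Proves H (eqn τ (((t.lam.lam.subst θ).app a).app b)
      (t.subst (Subst.cons b (Subst.cons a θ)))) :=
  ((Proves.beta H t.lam θ a).eqn_app (.eqn_refl H b)).eqn_trans (.beta H t _ b)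

/-! ### Induction and definition by cases -/

theorem Proves.induct {Γ : Ctx} {H : List (Formula Γ)} {φ : Formula (Ty.nat :: Γ)} (hφ : φ.QF)
    (h₀ : Proves H (φ.inst Term.zero))
    (h₁ : Proves (φ :: H.map (Formula.wk Ty.nat))
      (φ.subst (Subst.cons (Term.suc v0) (Subst.wk Ty.nat)))) (t : Term Γ Ty.nat) :
    Proves H (φ.inst t) :=
  .allE t (.impE (h₀.mp (.induction φ hφ)) (.allI (.impI h₁)))

theorem Proves.pred_suc {Γ : Ctx} (H : List (Formula Γ)) (t : Term Γ Ty.nat) :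
    Proves H (Formula.eq t.suc.pred t) :=
  (Proves.ax (.R_succ t _ _)).eqn_trans (τ := Ty.nat) (.beta₂ H v0 (Subst.id Γ) _ t)

theorem Proves.eq_congr {Γ : Ctx} {τ : Ty} {H : List (Formula Γ)} (f : Term Γ (Ty.arrow Ty.nat τ))
    {s t : Term Γ Ty.nat} (h : Proves H (Formula.eq s t)) : Proves H (eqn τ (f.app s) (f.app t)) :=
  h.mp (.ext (σ := Ty.nat) f s t)

theorem Proves.prec_congr {Γ : Ctx} {H : List (Formula Γ)} {s t : Term Γ Ty.nat}
    (h : Proves H (Formula.eq s t)) (a : Term Γ Ty.nat)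
    (f : Term Γ (Ty.arrow Ty.nat (Ty.arrow Ty.nat Ty.nat))) :
    Proves H (Formula.eq (s.prec a f) (t.prec a f)) :=
  eqn_inst (eqn_inst (h.eq_congr Term.R) a) f

/-- Decides `t = 0` intuitionistically. This is what turns refutability of `t ≠ 0` in models into a
derivation of `t = 0`. -/
theorem Proves.zero_or_suc {Γ : Ctx} (H : List (Formula Γ)) (t : Term Γ Ty.nat) :
    Proves H ((Formula.eq t Term.zero).or (Formula.eq t t.pred.suc)) :=
  Proves.induct (φ := (Formula.eq v0 Term.zero).or (Formula.eq v0 (Term.suc (Term.pred v0))))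
    (by simp [Formula.QF]) (.orI₁ (.ax (.refl _)))
    (.orI₂ (Proves.eqn_symm (τ := Ty.nat) (.eq_congr Term.succ (.pred_suc _ _)))) t

/-- `a` if `t = 0` and `b` otherwise. -/
def Term.ifz {Γ : Ctx} (t a b : Term Γ Ty.nat) : Term Γ Ty.nat :=
  Term.prec t a (Term.K.app (Term.K.app b))

theorem Proves.ifz_zero {Γ : Ctx} {H : List (Formula Γ)} {t : Term Γ Ty.nat}
    (h : Proves H (Formula.eq t Term.zero)) (a b : Term Γ Ty.nat) :
    Proves H (Formula.eq (t.ifz a b) a) :=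
  (h.prec_congr a _).eqn_trans (τ := Ty.nat) (.ax (.R_zero a _))

theorem Proves.ifz_suc {Γ : Ctx} {H : List (Formula Γ)} {s t : Term Γ Ty.nat}
    (h : Proves H (Formula.eq t s.suc)) (a b : Term Γ Ty.nat) :
    Proves H (Formula.eq (t.ifz a b) b) :=
  (h.prec_congr a _).eqn_trans (τ := Ty.nat) ((Proves.ax (.R_succ s a _)).eqn_trans (τ := Ty.nat)
    ((eqn_inst (.ax (.K (Term.K.app b) _)) s).eqn_trans (τ := Ty.nat) (.ax (.K b s))))

/-! ### Induction through an explicit breaking point -/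

/-- The step of the search for a number at which induction for the equation `f x = 0` breaks. -/
def breakStep {Γ : Ctx} (f : Term Γ Ty.one) : Term Γ (Ty.arrow Ty.nat (Ty.arrow Ty.nat Ty.nat)) :=
  Term.lam (Term.lam
    (Term.ifz (((f.wk _).wk _).app (Term.suc v1)) (Term.suc v1) v1))

/-- A number at which induction for the equation `f x = 0` breaks if it fails at `n`. -/
def breakAt {Γ Δ : Ctx} (θ : Subst Γ Δ) (f : Term Γ Ty.one) (n : Term Δ Ty.nat) : Term Δ Ty.nat :=
  Term.prec n Term.zero ((breakStep f).subst θ)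

theorem Proves.breakAt_suc {Γ Δ : Ctx} (H : List (Formula Δ)) (θ : Subst Γ Δ) (f : Term Γ Ty.one)
    (n : Term Δ Ty.nat) :
    Proves H (Formula.eq (breakAt θ f n.suc)
      (Term.ifz ((f.subst θ).app (breakAt θ f n).suc) (breakAt θ f n).suc (breakAt θ f n))) := by
  have h := Proves.beta₂ H
    (Term.ifz (((f.wk _).wk _).app (Term.suc v1)) (Term.suc v1) v1) θ (breakAt θ f n) n
  simp only [Term.ifz, Term.prec, Term.suc, Term.subst, Term.wk_subst_cons] at h
  exact (Proves.ax (.R_succ n _ _)).eqn_trans (τ := Ty.nat) h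

/-- If `f (w + 1) = 0`, the search moves on to `w + 1`, and `w = n` gives `w' = n + 1`. Otherwise it
stays at `w`, and the implication is vacuous because `f (w' + 1)` is a successor. -/
theorem Proves.breakAt_step {Γ : Ctx} (H : List (Formula Γ)) {f : Term Γ Ty.one}
    {w w' n : Term Γ Ty.nat}
    (hs : ∀ K, Proves K (Formula.eq w' (Term.ifz (f.app w.suc) w.suc w))) :
    Proves (((Formula.eq (f.app w) Term.zero).and
        ((Formula.eq (f.app w.suc) Term.zero).imp (Formula.eq w n))) :: H)
      ((Formula.eq (f.app w') Term.zero).and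
        ((Formula.eq (f.app w'.suc) Term.zero).imp (Formula.eq w' n.suc))) := by
  refine .orE (.zero_or_suc _ (f.app w.suc)) ?_ ?_
  · have e : ∀ K, Proves (Formula.eq (f.app w.suc) Term.zero :: K) (Formula.eq w' w.suc) :=
      fun K => (hs _).eqn_trans (τ := Ty.nat) (.ifz_zero .head _ _)
    refine .andI (((e _).eq_congr f).eqn_trans (τ := Ty.nat) .head) (.impI ?_)
    refine (e _).cons.eqn_trans (τ := Ty.nat) (.eq_congr Term.succ ?_)
    exact .impE (.andE₂ (.cons (.cons .head))) (.cons .head)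
  · have e : ∀ K, Proves (Formula.eq (f.app w.suc) (f.app w.suc).pred.suc :: K)
        (Formula.eq w' w) :=
      fun K => (hs _).eqn_trans (τ := Ty.nat) (.ifz_suc .head _ _)
    refine .andI (((e _).eq_congr f).eqn_trans (τ := Ty.nat) (.andE₁ (.cons .head))) (.impI ?_)
    have e' := fun K => Proves.eq_congr (τ := Ty.nat) f (.eq_congr Term.succ (e K))
    exact .botE (.impE (.ax (.succ_ne_zero _)) (.eqn_trans (τ := Ty.nat)
      (.eqn_symm (τ := Ty.nat) (.cons .head)) (.eqn_trans (τ := Ty.nat)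
        (.eqn_symm (τ := Ty.nat) (e' _).cons) .head)))

/-- The induction step, read in the term model, quantifies over classes of terms and is not the
membership of a formula. This lemma reduces it to a single instance: if the step holds at the
breaking point, that point is `n`, and so `f n = 0`. -/
theorem Proves.breakAt {Γ : Ctx} {H : List (Formula Γ)} (f : Term Γ Ty.one)
    (h₀ : Proves H (Formula.eq (f.app Term.zero) Term.zero)) (n : Term Γ Ty.nat) :
    Proves H (((Formula.eq (f.app (IRCA.breakAt (Subst.id Γ) f n)) Term.zero)).and
      ((Formula.eq (f.app (IRCA.breakAt (Subst.id Γ) f n).suc) Term.zero).imp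
        (Formula.eq (IRCA.breakAt (Subst.id Γ) f n) n))) := by
  have key := Proves.induct (H := H) (φ :=
    ((Formula.eq ((f.wk Ty.nat).app (IRCA.breakAt (Subst.wk _) f v0)) Term.zero)).and
      ((Formula.eq ((f.wk _).app (IRCA.breakAt (Subst.wk _) f v0).suc) Term.zero).imp
        (Formula.eq (IRCA.breakAt (Subst.wk _) f v0) v0))) (by simp [Formula.QF]) ?_ ?_ n
  · simpa only [Formula.inst, Formula.subst, Term.subst, Term.wk_subst_cons, IRCA.breakAt,
      Term.prec, Term.suc, Term.subst_subst_id, Term.subst_subst, Subst.wk, Subst.cons]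
      using key
  · simp only [Formula.inst, Formula.subst, Term.subst, Term.wk_subst_cons, IRCA.breakAt,
      Term.prec, Term.suc, Term.subst_subst_id, Term.subst_subst, Subst.wk, Subst.cons]
    have hz : Proves H (Formula.eq (IRCA.breakAt (Subst.id Γ) f Term.zero) Term.zero) :=
      .ax (.R_zero _ _)
    simp only [IRCA.breakAt, Term.prec, Term.subst_subst_id] at hz
    exact .andI (Proves.eqn_trans (τ := Ty.nat) (hz.eq_congr f) h₀) (.impI hz.cons)
  · generalize H.map (Formula.wk Ty.nat) = H'
    simp only [Formula.subst, Term.subst, Term.wk_subst_cons, IRCA.breakAt,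
      Term.prec, Term.suc, Term.subst_subst, Subst.wk, Subst.cons]
    exact breakAt_step H' fun K => Proves.breakAt_suc K (Subst.wk Ty.nat) f v0

theorem Term.subst_add {Γ Δ : Ctx} (θ : Subst Γ Δ) (s t : Term Γ Ty.nat) :
    (s.add t).subst θ = (s.subst θ).add (t.subst θ) := rfl

theorem Term.subst_sub {Γ Δ : Ctx} (θ : Subst Γ Δ) (s t : Term Γ Ty.nat) :
    (s.sub t).subst θ = (s.subst θ).sub (t.subst θ) := rfl

theorem Term.subst_suc {Γ Δ : Ctx} (θ : Subst Γ Δ) (s : Term Γ Ty.nat) :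
    s.suc.subst θ = (s.subst θ).suc := rfl

/-! ### Addition and subtraction -/

theorem Proves.eq_trans {Γ : Ctx} {H : List (Formula Γ)} {r s t : Term Γ Ty.nat}
    (h₁ : Proves H (Formula.eq r s)) (h₂ : Proves H (Formula.eq s t)) :
    Proves H (Formula.eq r t) :=
  h₁.eqn_trans (τ := Ty.nat) h₂

theorem Proves.eq_symm {Γ : Ctx} {H : List (Formula Γ)} {s t : Term Γ Ty.nat}
    (h : Proves H (Formula.eq s t)) : Proves H (Formula.eq t s) :=
  h.eqn_symm (τ := Ty.nat)

theorem Proves.suc_congr {Γ : Ctx} {H : List (Formula Γ)} {s t : Term Γ Ty.nat}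
    (h : Proves H (Formula.eq s t)) : Proves H (Formula.eq s.suc t.suc) :=
  h.eq_congr Term.succ

theorem Proves.pred_congr {Γ : Ctx} {H : List (Formula Γ)} {s t : Term Γ Ty.nat}
    (h : Proves H (Formula.eq s t)) : Proves H (Formula.eq s.pred t.pred) :=
  h.prec_congr _ _

theorem Proves.pred_zero {Γ : Ctx} (H : List (Formula Γ)) :
    Proves H (Formula.eq Term.zero.pred Term.zero) :=
  .ax (.R_zero _ _)

theorem Proves.add_zero {Γ : Ctx} (H : List (Formula Γ)) (s : Term Γ Ty.nat) :
    Proves H (Formula.eq (s.add Term.zero) s) :=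
  .ax (.R_zero _ _)

theorem Proves.add_suc {Γ : Ctx} (H : List (Formula Γ)) (s t : Term Γ Ty.nat) :
    Proves H (Formula.eq (s.add t.suc) (s.add t).suc) :=
  (Proves.ax (.R_succ t s _)).eq_trans (.beta₂ H (Term.suc v1) (Subst.id Γ) _ t)

theorem Proves.sub_zero {Γ : Ctx} (H : List (Formula Γ)) (s : Term Γ Ty.nat) :
    Proves H (Formula.eq (s.sub Term.zero) s) :=
  .ax (.R_zero _ _)

theorem Proves.sub_suc {Γ : Ctx} (H : List (Formula Γ)) (s t : Term Γ Ty.nat) :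
    Proves H (Formula.eq (s.sub t.suc) (s.sub t).pred) :=
  (Proves.ax (.R_succ t s _)).eq_trans (.beta₂ H (Term.pred v1) (Subst.id Γ) _ t)

theorem Proves.zero_add {Γ : Ctx} (H : List (Formula Γ)) (t : Term Γ Ty.nat) :
    Proves H (Formula.eq (Term.zero.add t) t) :=
  Proves.induct (φ := Formula.eq (Term.zero.add v0) v0) (by simp [Formula.QF]) (.add_zero _ _)
    ((Proves.add_suc _ _ _).eq_trans (.suc_congr .head)) t

theorem Proves.suc_add {Γ : Ctx} (H : List (Formula Γ)) (s t : Term Γ Ty.nat) :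
    Proves H (Formula.eq (s.suc.add t) (s.add t).suc) := by
  have := Proves.induct (H := H)
    (φ := Formula.eq ((s.wk _).suc.add v0) ((s.wk _).add v0).suc) trivial ?_ ?_ t
  · simpa only [Formula.inst, Formula.subst, Term.subst_add, Term.subst_suc, Term.wk_subst_cons,
      Term.subst_subst_id, Term.subst, Subst.cons] using this
  · simp only [Formula.inst, Formula.subst, Term.subst_add, Term.subst_suc, Term.wk_subst_cons,
      Term.subst_subst_id, Term.subst, Subst.cons]
    exact (Proves.add_zero _ _).eq_trans (Proves.suc_congr (.add_zero _ _)).eq_symm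
  · simp only [Formula.subst, Term.subst_add, Term.subst_suc, Term.wk_subst_cons,
      Term.subst, Subst.cons]
    exact (Proves.add_suc _ _ _).eq_trans
      ((Proves.suc_congr .head).eq_trans (Proves.suc_congr (.add_suc _ _ _)).eq_symm)

theorem Proves.suc_sub_suc {Γ : Ctx} (H : List (Formula Γ)) (s t : Term Γ Ty.nat) :
    Proves H (Formula.eq (s.suc.sub t.suc) (s.sub t)) := by
  have := Proves.induct (H := H)
    (φ := Formula.eq ((s.wk _).suc.sub (Term.suc v0)) ((s.wk _).sub v0)) trivial ?_ ?_ t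
  · simpa only [Formula.inst, Formula.subst, Term.subst_sub, Term.subst_suc, Term.wk_subst_cons,
      Term.subst_subst_id, Term.subst, Subst.cons] using this
  · simp only [Formula.inst, Formula.subst, Term.subst_sub, Term.subst_suc, Term.wk_subst_cons,
      Term.subst_subst_id, Term.subst, Subst.cons]
    exact (Proves.sub_suc _ _ _).eq_trans ((Proves.pred_congr (.sub_zero _ _)).eq_trans
      ((Proves.pred_suc _ _).eq_trans (Proves.sub_zero _ _).eq_symm))
  · simp only [Formula.subst, Term.subst_sub, Term.subst_suc, Term.wk_subst_cons,
      Term.subst, Subst.cons]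
    exact (Proves.sub_suc _ _ _).eq_trans
      ((Proves.pred_congr .head).eq_trans (Proves.sub_suc _ _ _).eq_symm)

theorem Proves.sub_eq_zero_or {Γ : Ctx} (H : List (Formula Γ)) (s t : Term Γ Ty.nat) :
    Proves H ((Formula.eq (s.sub t) Term.zero).or (Formula.eq (t.add (s.sub t)) s)) := by
  have := Proves.induct (H := H) (φ := (Formula.eq ((s.wk _).sub v0) Term.zero).or
    (Formula.eq (Term.add v0 ((s.wk _).sub v0)) (s.wk _))) (by simp [Formula.QF]) ?_ ?_ t
  · simpa only [Formula.inst, Formula.subst, Term.subst_add, Term.subst_sub, Term.wk_subst_cons,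
      Term.subst_subst_id, Term.subst, Subst.cons] using this
  · simp only [Formula.inst, Formula.subst, Term.subst_add, Term.subst_sub, Term.wk_subst_cons,
      Term.subst_subst_id, Term.subst, Subst.cons]
    exact .orI₂ ((Proves.zero_add _ _).eq_trans (.sub_zero _ _))
  · simp only [Formula.subst, Term.subst_add, Term.subst_sub, Term.wk_subst_cons,
      Term.subst, Subst.cons]
    generalize H.map (Formula.wk Ty.nat) = H'
    change Proves (((Formula.eq ((s.wk _).sub v0) Term.zero).or
      (Formula.eq (Term.add v0 ((s.wk _).sub v0)) (s.wk _))) :: H')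
      ((Formula.eq ((s.wk _).sub (Term.suc v0)) Term.zero).or
      (Formula.eq (Term.add (Term.suc v0) ((s.wk _).sub (Term.suc v0))) (s.wk _)))
    -- If `s - t` is zero it stays zero. Otherwise it is a successor, and its unit moves to the
    -- other summand: `(t + 1) + (s - (t + 1)) = t + (s - t)`.
    refine .orE (.zero_or_suc _ ((s.wk _).sub v0)) (.orI₁ ?_) (.orE (.cons .head) (.orI₁ ?_)
      (.orI₂ ?_))
    · exact (Proves.sub_suc _ _ _).eq_trans ((Proves.pred_congr .head).eq_trans (.pred_zero _))
    · exact (Proves.sub_suc _ _ _).eq_trans ((Proves.pred_congr .head).eq_trans (.pred_zero _))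
    · refine (Proves.suc_add _ _ _).eq_trans ?_
      refine Proves.eq_trans ?_ .head
      refine (Proves.add_suc _ _ _).eq_symm.eq_trans (.prec_congr ?_ _ _)
      exact (Proves.suc_congr (.sub_suc _ _ _)).eq_trans (Proves.eq_symm (.cons .head))


/-! ### Classical models -/

/-- A typed applicative structure with numbers, the combinators and the recursor, not necessarily
extensional. -/
structure Model where
  C : Ty → Type
  app : ∀ {σ τ : Ty}, C (Ty.arrow σ τ) → C σ → C τ
  zero : C Ty.nat
  succ : C (Ty.arrow Ty.nat Ty.nat)
  K : ∀ {σ τ : Ty}, C (Ty.arrow σ (Ty.arrow τ σ))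
  S : ∀ {ρ σ τ : Ty}, C (Ty.arrow (Ty.arrow ρ (Ty.arrow σ τ))
    (Ty.arrow (Ty.arrow ρ σ) (Ty.arrow ρ τ)))
  R : C (Ty.arrow Ty.nat (Ty.arrow Ty.nat
    (Ty.arrow (Ty.arrow Ty.nat (Ty.arrow Ty.nat Ty.nat)) Ty.nat)))
  K_app : ∀ {σ τ : Ty} (x : C σ) (y : C τ), app (app K x) y = x
  S_app : ∀ {ρ σ τ : Ty} (x : C (Ty.arrow ρ (Ty.arrow σ τ))) (y : C (Ty.arrow ρ σ)) (z : C ρ),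
    app (app (app S x) y) z = app (app x z) (app y z)
  R_zero : ∀ a f, app (app (app R zero) a) f = a
  R_succ : ∀ n a f, app (app (app R (app succ n)) a) f = app (app f (app (app (app R n) a) f)) n

/-- Assignments of elements of a model to the variables. -/
abbrev Env (M : Model) (Γ : Ctx) : Type := ∀ ⦃τ : Ty⦄, Var Γ τ → M.C τ

/-- Extend an assignment by a value for the variable `0`. -/
def Env.cons {M : Model} {Γ : Ctx} {σ : Ty} (x : M.C σ) (ρ : Env M Γ) : Env M (σ :: Γ)
  | _, Var.zero => x
  | _, Var.succ v => ρ v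

/-- The value of a term. -/
def Term.eval {M : Model} {Γ : Ctx} (ρ : Env M Γ) : {τ : Ty} → Term Γ τ → M.C τ
  | _, Term.var v => ρ v
  | _, Term.app f a => M.app (f.eval ρ) (a.eval ρ)
  | _, Term.zero => M.zero
  | _, Term.succ => M.succ
  | _, Term.K => M.K
  | _, Term.S => M.S
  | _, Term.R => M.R

/-- The empty assignment. -/
def Env.nil {M : Model} : Env M [] := fun _ v => nomatch v

/-- Primitive recursion in a model, with a step function given by a closed term. -/
def Model.prec (M : Model) (t a : M.C Ty.nat)
    (f : Term [] (Ty.arrow Ty.nat (Ty.arrow Ty.nat Ty.nat))) : M.C Ty.nat :=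
  M.app (M.app (M.app M.R t) a) (f.eval Env.nil)

/-- The predecessor in a model. -/
def Model.pred (M : Model) (x : M.C Ty.nat) : M.C Ty.nat :=
  M.prec x M.zero (Term.lam (Term.lam v0))

/-- Addition in a model. -/
def Model.add (M : Model) (x y : M.C Ty.nat) : M.C Ty.nat :=
  M.prec y x (Term.lam (Term.lam (Term.suc v1)))

/-- Truncated subtraction in a model. -/
def Model.sub (M : Model) (x y : M.C Ty.nat) : M.C Ty.nat :=
  M.prec y x (Term.lam (Term.lam (Term.pred v1)))

/-- A classical model of the quantifier-free part of the theory, in which induction holds for the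
zeros of the functions in the model. -/
class Model.Arith (M : Model) : Prop where
  succ_ne_zero : ∀ n, M.app M.succ n ≠ M.zero
  succ_inj : ∀ m n, M.app M.succ m = M.app M.succ n → m = n
  zero_or_succ : ∀ n, n = M.zero ∨ ∃ m, n = M.app M.succ m
  succ_sub_succ : ∀ m n, M.sub (M.app M.succ m) (M.app M.succ n) = M.sub m n
  sub_eq_zero_or : ∀ m n, M.sub m n = M.zero ∨ M.add n (M.sub m n) = m
  ind : ∀ f, M.app f M.zero = M.zero →
    (∀ n, M.app f n = M.zero → M.app f (M.app M.succ n) = M.zero) → ∀ n, M.app f n = M.zero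

/-- Truth of a formula. -/
def Formula.sat {M : Model} : {Γ : Ctx} → Env M Γ → Formula Γ → Prop
  | _, ρ, Formula.eq s t => s.eval ρ = t.eval ρ
  | _, _, Formula.bot => False
  | _, ρ, Formula.and φ ψ => φ.sat ρ ∧ ψ.sat ρ
  | _, ρ, Formula.or φ ψ => φ.sat ρ ∨ ψ.sat ρ
  | _, ρ, Formula.imp φ ψ => φ.sat ρ → ψ.sat ρ
  | _, ρ, Formula.all σ φ => ∀ x : M.C σ, φ.sat (Env.cons x ρ)
  | _, ρ, Formula.ex σ φ => ∃ x : M.C σ, φ.sat (Env.cons x ρ)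

theorem Term.eval_subst {M : Model} {Γ Δ : Ctx} (θ : Subst Γ Δ) (ρ : Env M Δ) {τ : Ty}
    (t : Term Γ τ) : (t.subst θ).eval ρ = t.eval (fun _ v => (θ v).eval ρ) := by
  induction t with
  | app f a hf ha => simp only [Term.subst, Term.eval, hf, ha]
  | _ => rfl

theorem Term.eval_wk {M : Model} {Γ : Ctx} {σ τ : Ty} (x : M.C σ) (ρ : Env M Γ) (t : Term Γ τ) :
    (t.wk σ).eval (Env.cons x ρ) = t.eval ρ :=
  Term.eval_subst _ _ t

theorem Env.cons_lift {M : Model} {Γ Δ : Ctx} {σ : Ty} (θ : Subst Γ Δ) (x : M.C σ) (ρ : Env M Δ) :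
    (fun _ v => ((θ.lift σ) v).eval (Env.cons x ρ) : Env M (σ :: Γ)) =
      Env.cons x (fun _ v => (θ v).eval ρ) := by
  funext τ v
  cases v with
  | zero => rfl
  | succ v => exact Term.eval_wk x ρ (θ v)

theorem Env.eval_cons {M : Model} {Γ Δ : Ctx} {σ : Ty} (θ : Subst Γ Δ) (t : Term Δ σ)
    (ρ : Env M Δ) : (fun _ v => (Subst.cons t θ v).eval ρ : Env M (σ :: Γ)) =
      Env.cons (t.eval ρ) (fun _ v => (θ v).eval ρ) := by
  funext τ v
  cases v <;> rfl

theorem Formula.sat_subst {M : Model} {Γ Δ : Ctx} (θ : Subst Γ Δ) (ρ : Env M Δ) (φ : Formula Γ) :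
    (φ.subst θ).sat ρ ↔ φ.sat (fun _ v => (θ v).eval ρ) := by
  induction φ generalizing Δ with
  | eq s t => simp only [Formula.subst, Formula.sat, Term.eval_subst]
  | bot => rfl
  | and _ _ h₁ h₂ => simp only [Formula.subst, Formula.sat, h₁, h₂]
  | or _ _ h₁ h₂ => simp only [Formula.subst, Formula.sat, h₁, h₂]
  | imp _ _ h₁ h₂ => simp only [Formula.subst, Formula.sat, h₁, h₂]
  | all σ _ h => simp only [Formula.subst, Formula.sat, h, Env.cons_lift]
  | ex σ _ h => simp only [Formula.subst, Formula.sat, h, Env.cons_lift]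

theorem Formula.sat_wk {M : Model} {Γ : Ctx} {σ : Ty} (x : M.C σ) (ρ : Env M Γ) (φ : Formula Γ) :
    (φ.wk σ).sat (Env.cons x ρ) ↔ φ.sat ρ :=
  Formula.sat_subst _ _ φ

/-! ### Maximal consistent sets -/

/-- A set of formulas that is consistent, complete and closed under derivability. -/
structure MaxCons {Γ : Ctx} (W : Set (Formula Γ)) : Prop where
  closed : ∀ (L : List (Formula Γ)) (φ : Formula Γ), (∀ ψ ∈ L, ψ ∈ W) → Proves L φ → φ ∈ W
  consistent : Formula.bot ∉ W
  complete : ∀ φ : Formula Γ, φ ∉ W → φ.neg ∈ W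

/-- Lindenbaum's lemma by Zorn: a derivation uses finitely many assumptions, and these lie in one
member of a chain. No witnesses for existential formulas are added, which is why `Formula.Hyp` asks
for one direction only. -/
theorem exists_maxCons {Γ : Ctx} {H : List (Formula Γ)} (h : ¬ Proves H Formula.bot) :
    ∃ W : Set (Formula Γ), MaxCons W ∧ ∀ ψ ∈ H, ψ ∈ W := by
  let Con : Set (Set (Formula Γ)) :=
    {W | ∀ L : List (Formula Γ), (∀ ψ ∈ L, ψ ∈ W) → ¬ Proves L Formula.bot}
  have hch : ∀ c ⊆ Con, IsChain (· ⊆ ·) c → c.Nonempty → ∃ ub ∈ Con, ∀ s ∈ c, s ⊆ ub := by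
    intro c hc hchain hne
    refine ⟨⋃₀ c, fun L hL => ?_, fun s hs => Set.subset_sUnion_of_mem hs⟩
    have : ∃ s ∈ c, ∀ ψ ∈ L, ψ ∈ s := by
      clear h
      induction L with
      | nil => exact ⟨hne.some, hne.some_mem, by simp⟩
      | cons φ L ih =>
        obtain ⟨s, hs, h₁⟩ := ih fun ψ hψ => hL ψ (List.mem_cons_of_mem _ hψ)
        obtain ⟨t, ht, h₂⟩ := hL φ List.mem_cons_self
        rcases hchain.total hs ht with hst | hst
        · exact ⟨t, ht, List.forall_mem_cons.2 ⟨h₂, fun ψ hψ => hst (h₁ ψ hψ)⟩⟩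
        · exact ⟨s, hs, List.forall_mem_cons.2 ⟨hst h₂, h₁⟩⟩
    obtain ⟨s, hs, h'⟩ := this
    exact hc hs L h'
  obtain ⟨W, hHW, hW⟩ := zorn_subset_nonempty Con hch {ψ | ψ ∈ H}
    fun L hL hb => h (hb.weaken hL)
  -- A finite list from `insert φ W` is covered by `φ` and a list from `W`, so inconsistency of the
  -- enlarged set is a refutation of `φ` from `W`.
  have hsplit : ∀ (φ : Formula Γ) (L : List (Formula Γ)), (∀ ψ ∈ L, ψ ∈ insert φ W) →
      ∃ L' : List (Formula Γ), (∀ ψ ∈ L', ψ ∈ W) ∧ ∀ ψ ∈ L, ψ ∈ φ :: L' := by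
    intro φ L
    induction L with
    | nil => exact fun _ => ⟨[], by simp, by simp⟩
    | cons χ L ih =>
      intro hL
      obtain ⟨L', h₁, h₂⟩ := ih fun ψ hψ => hL ψ (List.mem_cons_of_mem _ hψ)
      rcases hL χ List.mem_cons_self with rfl | hχ
      · exact ⟨L', h₁, List.forall_mem_cons.2 ⟨List.mem_cons_self, h₂⟩⟩
      · refine ⟨χ :: L', List.forall_mem_cons.2 ⟨hχ, h₁⟩, List.forall_mem_cons.2 ⟨by simp, ?_⟩⟩
        intro ψ hψ
        rcases List.mem_cons.1 (h₂ ψ hψ) with h | h <;> simp [h]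
  have hout : ∀ φ : Formula Γ, φ ∉ W →
      ∃ L : List (Formula Γ), (∀ ψ ∈ L, ψ ∈ W) ∧ Proves (φ :: L) Formula.bot := by
    intro φ hφ
    by_contra hcon
    push Not at hcon
    refine hφ (hW.le_of_ge (y := insert φ W) (fun L hL hb => ?_) (Set.subset_insert _ _)
      (Set.mem_insert _ _))
    obtain ⟨L', h₁, h₂⟩ := hsplit φ L hL
    exact hcon L' h₁ (hb.weaken h₂)
  have hcl : ∀ (L : List (Formula Γ)) (φ : Formula Γ), (∀ ψ ∈ L, ψ ∈ W) → Proves L φ → φ ∈ W := by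
    intro L φ hL hp
    by_contra hφ
    obtain ⟨L', hL', hb⟩ := hout φ hφ
    refine hW.prop (L ++ L') (fun ψ hψ => (List.mem_append.1 hψ).elim (hL ψ) (hL' ψ)) ?_
    refine Proves.cut (hp.weaken fun ψ hψ => List.mem_append_left _ hψ) (hb.weaken fun ψ hψ => ?_)
    rcases List.mem_cons.1 hψ with h | h <;> simp [h]
  refine ⟨W, ⟨hcl, fun hb => hW.prop [Formula.bot] (by simpa using hb) .head, fun φ hφ => ?_⟩,
    fun ψ hψ => hHW hψ⟩
  obtain ⟨L, hL, hb⟩ := hout φ hφ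
  exact hcl L _ hL (.impI hb)

namespace MaxCons

variable {Γ : Ctx} {W : Set (Formula Γ)}

theorem mem (hW : MaxCons W) {φ : Formula Γ} (h : Proves [] φ) : φ ∈ W :=
  hW.closed [] φ (by simp) h

theorem mem₁ (hW : MaxCons W) {φ ψ : Formula Γ} (h₁ : φ ∈ W) (h : Proves [φ] ψ) : ψ ∈ W :=
  hW.closed [φ] ψ (by simpa using h₁) h

theorem mem₂ (hW : MaxCons W) {φ ψ χ : Formula Γ} (h₁ : φ ∈ W) (h₂ : ψ ∈ W)
    (h : Proves [φ, ψ] χ) : χ ∈ W :=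
  hW.closed [φ, ψ] χ (by simpa using ⟨h₁, h₂⟩) h

theorem mp (hW : MaxCons W) {φ ψ : Formula Γ} (h₁ : φ.imp ψ ∈ W) (h₂ : φ ∈ W) : ψ ∈ W :=
  hW.mem₂ h₁ h₂ (.impE .head (.cons .head))

theorem false_of_neg (hW : MaxCons W) {φ : Formula Γ} (h₁ : φ.neg ∈ W) (h₂ : φ ∈ W) : False :=
  hW.consistent (hW.mp h₁ h₂)

theorem and_iff (hW : MaxCons W) {φ ψ : Formula Γ} : φ.and ψ ∈ W ↔ φ ∈ W ∧ ψ ∈ W :=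
  ⟨fun h => ⟨hW.mem₁ h (.andE₁ .head), hW.mem₁ h (.andE₂ .head)⟩,
    fun h => hW.mem₂ h.1 h.2 (.andI .head (.cons .head))⟩

theorem or_iff (hW : MaxCons W) {φ ψ : Formula Γ} : φ.or ψ ∈ W ↔ φ ∈ W ∨ ψ ∈ W := by
  refine ⟨fun h => ?_, fun h => h.elim (fun h => hW.mem₁ h (.orI₁ .head))
    fun h => hW.mem₁ h (.orI₂ .head)⟩
  by_contra hcon
  push Not at hcon
  exact hW.consistent (hW.closed [φ.or ψ, φ.neg, ψ.neg] _
    (by simpa using ⟨h, hW.complete _ hcon.1, hW.complete _ hcon.2⟩)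
    (.orE .head (.impE (.cons (.cons .head)) .head) (.impE (.cons (.cons (.cons .head))) .head)))

theorem imp_iff (hW : MaxCons W) {φ ψ : Formula Γ} : φ.imp ψ ∈ W ↔ (φ ∈ W → ψ ∈ W) := by
  refine ⟨fun h => hW.mp h, fun h => ?_⟩
  by_cases hφ : φ ∈ W
  · exact hW.mem₁ (h hφ) (.impI (.cons .head))
  · exact hW.mem₁ (hW.complete _ hφ) (.impI (.botE (.impE (.cons .head) .head)))

/-- Provable equality of terms. -/
def setoid (hW : MaxCons W) (σ : Ty) : Setoid (Term Γ σ) where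
  r s t := eqn σ s t ∈ W
  iseqv := ⟨fun t => hW.mem (.eqn_refl _ t), fun h => hW.mem₁ h (.eqn_symm .head),
    fun h₁ h₂ => hW.mem₂ h₁ h₂ (.eqn_trans .head (.cons .head))⟩

/-- The class of a term modulo provable equality. -/
def cls (hW : MaxCons W) {σ : Ty} (t : Term Γ σ) : Quotient (hW.setoid σ) :=
  Quotient.mk _ t

theorem cls_eq (hW : MaxCons W) {σ : Ty} {s t : Term Γ σ} :
    hW.cls s = hW.cls t ↔ eqn σ s t ∈ W :=
  Quotient.eq

/-- Application of classes of terms. -/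
def appMk (hW : MaxCons W) {σ τ : Ty} : Quotient (hW.setoid (Ty.arrow σ τ)) →
    Quotient (hW.setoid σ) → Quotient (hW.setoid τ) :=
  Quotient.map₂ Term.app fun _ _ h₁ _ _ h₂ =>
    hW.mem₂ h₁ h₂ (.eqn_app .head (.cons .head))

/-- The model of the terms modulo provable equality. -/
def model (hW : MaxCons W) : Model where
  C σ := Quotient (hW.setoid σ)
  app := hW.appMk
  zero := hW.cls .zero
  succ := hW.cls .succ
  K := hW.cls .K
  S := hW.cls .S
  R := hW.cls .R
  K_app := by
    rintro σ τ ⟨x⟩ ⟨y⟩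
    exact hW.cls_eq.2 (hW.mem (.ax (.K x y)))
  S_app := by
    rintro ρ σ τ ⟨x⟩ ⟨y⟩ ⟨z⟩
    exact hW.cls_eq.2 (hW.mem (.ax (.S x y z)))
  R_zero := by
    rintro ⟨a⟩ ⟨f⟩
    exact hW.cls_eq.2 (hW.mem (.ax (.R_zero a f)))
  R_succ := by
    rintro ⟨n⟩ ⟨a⟩ ⟨f⟩
    exact hW.cls_eq.2 (hW.mem (.ax (.R_succ n a f)))

instance (hW : MaxCons W) : hW.model.Arith where
  succ_ne_zero := by
    rintro ⟨n⟩ h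
    exact hW.false_of_neg (hW.mem (.ax (.succ_ne_zero n))) (hW.cls_eq.1 h)
  succ_inj := by
    rintro ⟨m⟩ ⟨n⟩ h
    exact hW.cls_eq.2 (hW.mp (hW.mem (.ax (.succ_inj m n))) (hW.cls_eq.1 h))
  zero_or_succ := by
    rintro ⟨n⟩
    rcases hW.or_iff.1 (hW.mem (.zero_or_suc _ n)) with h | h
    · exact .inl (hW.cls_eq.2 h)
    · exact .inr ⟨hW.cls n.pred, hW.cls_eq.2 h⟩
  succ_sub_succ := by
    rintro ⟨m⟩ ⟨n⟩
    exact hW.cls_eq.2 (hW.mem (.suc_sub_suc _ m n))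
  sub_eq_zero_or := by
    rintro ⟨m⟩ ⟨n⟩
    rcases hW.or_iff.1 (hW.mem (.sub_eq_zero_or _ m n)) with h | h
    · exact .inl (hW.cls_eq.2 h)
    · exact .inr (hW.cls_eq.2 h)
  ind := by
    rintro ⟨f⟩ h₀ h₁ ⟨n⟩
    obtain ⟨h₂, h₃⟩ := hW.and_iff.1 (hW.mem₁ (hW.cls_eq.1 h₀) (.breakAt f .head n))
    -- The semantic induction step is needed at this one class only.
    have h₄ := h₁ (hW.cls (breakAt (Subst.id Γ) f n)) (hW.cls_eq.2 h₂)
    have h₅ := hW.mp h₃ (hW.cls_eq.1 h₄)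
    exact hW.cls_eq.2 (hW.mem₂ h₅ h₂ (.eq_trans
      (.eq_symm (.eq_congr f .head)) (.cons .head)))

/-- The assignment of the classes of terms. -/
def env (hW : MaxCons W) {Δ : Ctx} (θ : Subst Δ Γ) : Env hW.model Δ := fun _ v => hW.cls (θ v)

theorem eval_env (hW : MaxCons W) {Δ : Ctx} (θ : Subst Δ Γ) {τ : Ty} (t : Term Δ τ) :
    t.eval (hW.env θ) = hW.cls (t.subst θ) := by
  induction t with
  | app f a hf ha => simp only [Term.eval, hf, ha]; rfl
  | _ => rfl

theorem env_cons (hW : MaxCons W) {Δ : Ctx} {σ : Ty} (θ : Subst Δ Γ) (t : Term Γ σ) :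
    Env.cons (hW.cls t) (hW.env θ) = hW.env (Subst.cons t θ) := by
  funext τ v
  cases v <;> rfl

end MaxCons

/-! ### Completeness for formulas without relevant existential quantifiers -/

/-- Membership of the instances of `φ` in a maximal consistent set is truth in its term model. -/
def Formula.Exact {Γ : Ctx} (φ : Formula Γ) : Prop :=
  ∀ {Δ : Ctx} (θ : Subst Γ Δ) (W : Set (Formula Δ)) (hW : MaxCons W),
    φ.subst θ ∈ W ↔ φ.sat (hW.env θ)

/-- Membership of the instances of `φ` in a maximal consistent set implies truth in its term
model. -/
def Formula.Hyp {Γ : Ctx} (φ : Formula Γ) : Prop :=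
  ∀ {Δ : Ctx} (θ : Subst Γ Δ) (W : Set (Formula Δ)) (hW : MaxCons W),
    φ.subst θ ∈ W → φ.sat (hW.env θ)

/-- The instances of `φ` are derivable from open assumptions of the class `Hyp` if they hold in all
models of these assumptions. -/
def Formula.Goal {Γ : Ctx} (φ : Formula Γ) : Prop :=
  ∀ {Δ : Ctx} (θ : Subst Γ Δ) (H : List (Formula Δ)), (∀ ψ ∈ H, ψ.Hyp) →
    (∀ (M : Model) [M.Arith] (ρ : Env M Δ), (∀ ψ ∈ H, ψ.sat ρ) → φ.sat (fun _ v => (θ v).eval ρ)) →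
    Proves H (φ.subst θ)

namespace Formula

variable {Γ : Ctx}

theorem Exact.hyp {φ : Formula Γ} (h : φ.Exact) : φ.Hyp := fun θ W hW => (h θ W hW).1

theorem exact_eq (s t : Term Γ Ty.nat) : (Formula.eq s t).Exact := fun θ W hW => by
  rw [Formula.sat, hW.eval_env, hW.eval_env]
  exact (hW.cls_eq (σ := Ty.nat)).symm

theorem exact_bot : (Formula.bot : Formula Γ).Exact := fun _ _ hW =>
  ⟨fun h => hW.consistent h, False.elim⟩

theorem Exact.imp {φ ψ : Formula Γ} (h₁ : φ.Exact) (h₂ : ψ.Exact) : (φ.imp ψ).Exact :=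
  fun θ W hW => hW.imp_iff.trans (imp_congr (h₁ θ W hW) (h₂ θ W hW))

theorem Hyp.and {φ ψ : Formula Γ} (h₁ : φ.Hyp) (h₂ : ψ.Hyp) : (φ.and ψ).Hyp :=
  fun θ W hW h => ⟨h₁ θ W hW (hW.and_iff.1 h).1, h₂ θ W hW (hW.and_iff.1 h).2⟩

theorem Exact.imp_hyp {φ ψ : Formula Γ} (h₁ : φ.Exact) (h₂ : ψ.Hyp) : (φ.imp ψ).Hyp :=
  fun θ W hW h hφ => h₂ θ W hW (hW.mp h ((h₁ θ W hW).2 hφ))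

/-- Every element of the term model is the class of a term, so instantiation suffices. The converse
would need Henkin witnesses and is not claimed. -/
theorem Hyp.all {σ : Ty} {φ : Formula (σ :: Γ)} (h : φ.Hyp) : (Formula.all σ φ).Hyp := by
  rintro Δ θ W hW hφ ⟨t⟩
  have h₁ : φ.subst (Subst.cons t θ) ∈ W := by
    rw [← Formula.subst_lift_inst]
    exact hW.mem₁ hφ (.allE t .head)
  have h₂ := h _ W hW h₁
  rwa [← hW.env_cons] at h₂

theorem Hyp.subst {φ : Formula Γ} (h : φ.Hyp) {Δ : Ctx} (θ : Subst Γ Δ) : (φ.subst θ).Hyp := by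
  intro Θ η W hW hφ
  rw [Formula.subst_subst] at hφ
  rw [Formula.sat_subst]
  simp only [hW.eval_env]
  exact h _ W hW hφ

/-- If `⊥` were not derivable, a maximal consistent set around `H` would have a term model in which
`H` is true, because its members are in `Hyp`. -/
theorem proves_bot {H : List (Formula Γ)} (hH : ∀ ψ ∈ H, ψ.Hyp)
    (h : ∀ (W : Set (Formula Γ)) (hW : MaxCons W), (∀ ψ ∈ H, ψ ∈ W) →
      (∀ ψ ∈ H, ψ.sat (hW.env (Subst.id Γ))) → False) : Proves H Formula.bot := by
  by_contra hb
  obtain ⟨W, hW, hHW⟩ := exists_maxCons hb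
  refine h W hW hHW fun ψ hψ => hH ψ hψ _ W hW ?_
  have := hHW ψ hψ
  rwa [← ψ.subst_id] at this

theorem goal_bot : (Formula.bot : Formula Γ).Goal := fun _ _ hH h =>
  proves_bot hH fun _ hW _ hs => h hW.model _ hs

/-- The base case where classical truth becomes an intuitionistic derivation. By
`Proves.zero_or_suc` it is enough to refute that `t` is a successor, and this assumption has no
model together with `H`. -/
theorem goal_eq_zero (t : Term Γ Ty.nat) : (Formula.eq t Term.zero).Goal := by
  intro Δ θ H hH h
  refine .orE (.zero_or_suc _ (t.subst θ)) .head (.botE (proves_bot ?_ ?_))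
  · exact List.forall_mem_cons.2 ⟨Exact.hyp (exact_eq _ _), hH⟩
  · intro W hW hm hs
    have h₁ : t.eval _ = _ := h hW.model _ (List.forall_mem_cons.1 hs).2
    have h₂ := (List.forall_mem_cons.1 hs).1
    rw [← Term.eval_subst] at h₁
    simp only [Formula.sat, h₁] at h₂
    exact Model.Arith.succ_ne_zero (M := hW.model) _ h₂.symm

theorem Goal.and {φ ψ : Formula Γ} (h₁ : φ.Goal) (h₂ : ψ.Goal) : (φ.and ψ).Goal :=
  fun θ H hH h => .andI (h₁ θ H hH fun M _ ρ hρ => (h M ρ hρ).1)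
    (h₂ θ H hH fun M _ ρ hρ => (h M ρ hρ).2)

theorem Hyp.imp_goal {φ ψ : Formula Γ} (h₁ : φ.Hyp) (h₂ : ψ.Goal) : (φ.imp ψ).Goal := by
  intro Δ θ H hH h
  refine .impI (h₂ θ _ (List.forall_mem_cons.2 ⟨h₁.subst θ, hH⟩) fun M _ ρ hρ => ?_)
  obtain ⟨h₃, h₄⟩ := List.forall_mem_cons.1 hρ
  exact h M ρ h₄ ((Formula.sat_subst θ ρ φ).1 h₃)

/-- The eigenvariable stays free in a longer context, so the term models are built over that context
and no witness for a failing instance is ever required. -/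
theorem Goal.all {σ : Ty} {φ : Formula (σ :: Γ)} (h : φ.Goal) : (Formula.all σ φ).Goal := by
  intro Δ θ H hH hs
  refine .allI (h (θ.lift σ) _ ?_ fun M _ ρ hρ => ?_)
  · intro ψ hψ
    obtain ⟨χ, hχ, rfl⟩ := List.mem_map.1 hψ
    exact Hyp.subst (hH χ hχ) _
  · obtain ⟨x, ρ', rfl⟩ : ∃ (x : M.C σ) (ρ' : Env M Δ), ρ = Env.cons x ρ' :=
      ⟨ρ Var.zero, fun _ v => ρ (Var.succ v), by funext τ v; cases v <;> rfl⟩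
    rw [Env.cons_lift]
    refine hs M ρ' (fun ψ hψ => ?_) x
    exact (Formula.sat_wk x ρ' ψ).1 (hρ _ (List.mem_map_of_mem hψ))

theorem Goal.subst {φ : Formula Γ} (h : φ.Goal) {Δ : Ctx} (θ : Subst Γ Δ) :
    (φ.subst θ).Goal := by
  intro Θ η H hH hs
  rw [Formula.subst_subst]
  refine h _ H hH fun M _ ρ hρ => ?_
  have := (Formula.sat_subst _ _ _).1 (hs M ρ hρ)
  simpa only [Term.eval_subst] using this

theorem Goal.proves {φ : Formula Γ} (h : φ.Goal) {H : List (Formula Γ)} (hH : ∀ ψ ∈ H, ψ.Hyp)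
    (hs : ∀ (M : Model) [M.Arith] (ρ : Env M Γ), (∀ ψ ∈ H, ψ.sat ρ) → φ.sat ρ) : Proves H φ := by
  have := h (Subst.id Γ) H hH hs
  rwa [show φ.subst (Subst.id Γ) = φ from φ.subst_id] at this

end Formula

/-! ### Arithmetic in models -/

infixl:90 " ⬝ " => Model.app _

/-- Multiplication, as a closed term. -/
def mulTerm : Term [] (Ty.arrow Ty.nat Ty.one) :=
  Term.lam (Term.lam (Term.prec v0 Term.zero (Term.lam (Term.lam (Term.add v1 v3)))))

namespace Model

/-- The numbers of a model. -/
abbrev N (M : Model) : Type := M.C Ty.nat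

/-- The functions of a model. -/
abbrev F (M : Model) : Type := M.C Ty.one

variable {M : Model}

instance : Zero M.N := ⟨M.zero⟩
instance : One M.N := ⟨M.succ ⬝ M.zero⟩
instance : Add M.N := ⟨M.add⟩
instance : Sub M.N := ⟨M.sub⟩

instance : Mul M.N := ⟨fun x y => mulTerm.eval (M := M) Env.nil ⬝ x ⬝ y⟩

theorem mul_def (x y : M.N) : x * y = mulTerm.eval (M := M) Env.nil ⬝ x ⬝ y := rfl

theorem eval_lam {Γ : Ctx} {σ τ : Ty} (t : Term (σ :: Γ) τ) (ρ : Env M Γ) (x : M.C σ) :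
    t.lam.eval ρ ⬝ x = t.eval (Env.cons x ρ) := by
  induction t with
  | var v =>
    cases v with
    | zero => exact (M.S_app _ _ _).trans (M.K_app _ _)
    | succ v => exact M.K_app _ _
  | app f a hf ha =>
    simp only [Term.lam, Term.eval] at hf ha ⊢
    rw [M.S_app, hf, ha]
  | zero => exact M.K_app _ _
  | succ => exact M.K_app _ _
  | K => exact M.K_app _ _
  | S => exact M.K_app _ _
  | R => exact M.K_app _ _

theorem eval_add {Γ : Ctx} (ρ : Env M Γ) (s t : Term Γ Ty.nat) :
    (s.add t).eval ρ = s.eval ρ + t.eval ρ := rfl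

theorem pred_zero : M.pred 0 = 0 := M.R_zero _ _

theorem pred_succ (x : M.N) : M.pred (M.succ ⬝ x) = x :=
  (M.R_succ _ _ _).trans (by rw [eval_lam, eval_lam]; rfl)

theorem add_zero' (x : M.N) : x + 0 = x := M.R_zero _ _

theorem add_succ (x y : M.N) : x + M.succ ⬝ y = M.succ ⬝ (x + y) :=
  (M.R_succ _ _ _).trans (by rw [eval_lam, eval_lam]; rfl)

theorem add_one_eq (x : M.N) : x + 1 = M.succ ⬝ x :=
  (add_succ x 0).trans (by rw [add_zero'])

theorem sub_zero' (x : M.N) : x - 0 = x := M.R_zero _ _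

theorem sub_succ (x y : M.N) : x - M.succ ⬝ y = M.pred (x - y) :=
  (M.R_succ _ _ _).trans (by rw [eval_lam, eval_lam]; rfl)

/-- Definition by cases in a model. -/
def ifz (t a b : M.N) : M.N := M.R ⬝ t ⬝ a ⬝ (M.K ⬝ (M.K ⬝ b))

theorem ifz_zero (a b : M.N) : ifz 0 a b = a := M.R_zero _ _

theorem ifz_succ (t a b : M.N) : ifz (M.succ ⬝ t) a b = b :=
  (M.R_succ _ _ _).trans (by rw [M.K_app, M.K_app])

theorem mul_zero' (x : M.N) : x * 0 = 0 := by
  rw [mul_def, mulTerm, eval_lam, eval_lam]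
  exact M.R_zero _ _

theorem mul_succ (x y : M.N) : x * (M.succ ⬝ y) = x * y + x := by
  rw [mul_def, mul_def, mulTerm, eval_lam, eval_lam, eval_lam]
  refine (M.R_succ _ _ _).trans ?_
  rw [eval_lam, eval_lam, eval_add]
  rfl

instance : LE M.N := ⟨fun x y => x - y = 0⟩
instance : LT M.N := ⟨fun x y => M.succ ⬝ x - y = 0⟩

theorem le_def (x y : M.N) : x ≤ y ↔ x - y = 0 := Iff.rfl

theorem lt_iff_succ_le (x y : M.N) : x < y ↔ x + 1 ≤ y := by
  rw [add_one_eq]; rfl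

/-! ### Representable functions and predicates -/

/-- The functions given by elements of the model. -/
def Rep {σ : Ty} (g : M.N → M.C σ) : Prop := ∃ f : M.C (Ty.arrow Ty.nat σ), ∀ x, f ⬝ x = g x

theorem Rep.const {σ : Ty} (c : M.C σ) : Rep (fun _ : M.N => c) := ⟨M.K ⬝ c, fun x => M.K_app c x⟩

theorem Rep.id : Rep (fun x : M.N => x) :=
  ⟨M.S ⬝ M.K ⬝ (M.K (τ := Ty.nat)), fun x => by rw [M.S_app, M.K_app]⟩

theorem Rep.app {σ τ : Ty} {f : M.N → M.C (Ty.arrow σ τ)} {g : M.N → M.C σ} (hf : Rep f)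
    (hg : Rep g) : Rep (fun x => f x ⬝ g x) := by
  obtain ⟨F, hF⟩ := hf
  obtain ⟨G, hG⟩ := hg
  exact ⟨M.S ⬝ F ⬝ G, fun x => by rw [M.S_app, hF, hG]⟩

theorem Rep.add {f g : M.N → M.N} (hf : Rep f) (hg : Rep g) : Rep (fun x => f x + g x) :=
  (((Rep.const M.R).app hg).app hf).app (.const _)

theorem Rep.sub {f g : M.N → M.N} (hf : Rep f) (hg : Rep g) : Rep (fun x => f x - g x) :=
  (((Rep.const M.R).app hg).app hf).app (.const _)

theorem Rep.mul {f g : M.N → M.N} (hf : Rep f) (hg : Rep g) : Rep (fun x => f x * g x) :=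
  ((Rep.const _).app hf).app hg

theorem Rep.pred {f : M.N → M.N} (hf : Rep f) : Rep (fun x => M.pred (f x)) :=
  (((Rep.const M.R).app hf).app (.const _)).app (.const _)

theorem Rep.ifz {f g h : M.N → M.N} (hf : Rep f) (hg : Rep g) (hh : Rep h) :
    Rep (fun x => ifz (f x) (g x) (h x)) :=
  (((Rep.const M.R).app hf).app hg).app ((Rep.const M.K).app ((Rep.const M.K).app hh))

/-- The predicates given by zeros of functions of the model. -/
def Dec (P : M.N → Prop) : Prop := ∃ f : M.F, ∀ x, f ⬝ x = 0 ↔ P x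

theorem Rep.dec_eq_zero {f : M.N → M.N} (hf : Rep f) : Dec (fun x => f x = 0) := by
  obtain ⟨F, hF⟩ := hf
  exact ⟨F, fun x => by rw [hF]⟩

theorem Dec.congr {P Q : M.N → Prop} (hP : Dec P) (h : ∀ x, P x ↔ Q x) : Dec Q := by
  obtain ⟨F, hF⟩ := hP
  exact ⟨F, fun x => (hF x).trans (h x)⟩

variable [M.Arith]

theorem succ_ne_zero (x : M.N) : M.succ ⬝ x ≠ 0 := Arith.succ_ne_zero x

theorem zero_or_succ (x : M.N) : x = 0 ∨ ∃ y, x = M.succ ⬝ y := Arith.zero_or_succ x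

theorem succ_sub_succ (x y : M.N) : M.succ ⬝ x - M.succ ⬝ y = x - y := Arith.succ_sub_succ x y

theorem ifz_of_ne {t : M.N} (h : t ≠ 0) (a b : M.N) : ifz t a b = b := by
  rcases zero_or_succ t with rfl | ⟨y, rfl⟩
  · exact absurd rfl h
  · exact ifz_succ _ _ _

theorem Dec.not {P : M.N → Prop} (hP : Dec P) : Dec (fun x => ¬ P x) := by
  obtain ⟨F, hF⟩ := hP
  refine (Rep.dec_eq_zero (f := fun x => Model.ifz (F ⬝ x) (M.succ ⬝ 0) 0)
    (.ifz (.app (.const _) .id) (.const _) (.const _))).congr fun x => ?_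
  rw [← hF]
  by_cases h : F ⬝ x = 0
  · simp only [h, ifz_zero, succ_ne_zero, not_true]
  · simp only [h, ifz_of_ne h, not_false_eq_true]

theorem Dec.and {P Q : M.N → Prop} (hP : Dec P) (hQ : Dec Q) : Dec (fun x => P x ∧ Q x) := by
  obtain ⟨F, hF⟩ := hP
  obtain ⟨G, hG⟩ := hQ
  refine (Rep.dec_eq_zero (f := fun x => Model.ifz (F ⬝ x) (G ⬝ x) (M.succ ⬝ 0))
    (.ifz (.app (.const _) .id) (.app (.const _) .id) (.const _))).congr fun x => ?_
  rw [← hF, ← hG]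
  by_cases h : F ⬝ x = 0
  · simp only [h, ifz_zero, true_and]
  · simp only [h, ifz_of_ne h, succ_ne_zero, false_and]

theorem Dec.or {P Q : M.N → Prop} (hP : Dec P) (hQ : Dec Q) : Dec (fun x => P x ∨ Q x) :=
  (hP.not.and hQ.not).not.congr fun _ => by tauto

theorem Dec.imp {P Q : M.N → Prop} (hP : Dec P) (hQ : Dec Q) : Dec (fun x => P x → Q x) :=
  (hP.not.or hQ).congr fun _ => by tauto

/-- Induction holds only for zero sets of functions of the model; hence each induction below comes
with a `Dec` certificate. -/
theorem Dec.ind_succ {P : M.N → Prop} (hP : Dec P) (h₀ : P 0)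
    (h₁ : ∀ x, P x → P (M.succ ⬝ x)) (x : M.N) : P x := by
  obtain ⟨F, hF⟩ := hP
  exact (hF x).1 (Arith.ind F ((hF 0).2 h₀) (fun n hn => (hF _).2 (h₁ n ((hF n).1 hn))) x)

theorem sub_self' (x : M.N) : x - x = 0 :=
  Dec.ind_succ (P := fun x => x - x = 0) (Rep.dec_eq_zero (.sub .id .id)) (sub_zero' 0)
    (fun x h => by rw [succ_sub_succ, h]) x

theorem succ_sub_self_ne (x : M.N) : M.succ ⬝ x - x ≠ 0 :=
  Dec.ind_succ (P := fun x => ¬ M.succ ⬝ x - x = 0)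
    (Rep.dec_eq_zero (.sub (.app (.const _) .id) .id)).not
    (by rw [sub_zero']; exact succ_ne_zero 0) (fun x h => by rwa [succ_sub_succ]) x

/-- Equality is expressed as `x ≤ y` together with the failure of `x ≤ y - 1` (or `y = 0`), using
only what is known before commutativity of addition. It makes equations decidable, so that the
semiring laws can be proved by induction. -/
theorem eq_iff_sub (x y : M.N) : x - y = 0 ∧ (y = 0 ∨ ¬ x - M.pred y = 0) ↔ x = y := by
  constructor
  · rintro ⟨h₁, h₂⟩
    rcases zero_or_succ y with rfl | ⟨z, rfl⟩
    · rwa [sub_zero'] at h₁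
    · rw [pred_succ] at h₂
      have h₃ := h₂.resolve_left (succ_ne_zero z)
      have h₄ : z + (x - z) = x := (Arith.sub_eq_zero_or x z).resolve_left h₃
      rw [sub_succ] at h₁
      rcases zero_or_succ (x - z) with h | ⟨w, h⟩
      · exact absurd h h₃
      · rw [h, pred_succ] at h₁
        rw [h, h₁, add_succ, add_zero'] at h₄
        exact h₄.symm
  · rintro rfl
    refine ⟨sub_self' x, ?_⟩
    rcases zero_or_succ x with rfl | ⟨z, rfl⟩
    · exact .inl rfl
    · rw [pred_succ]; exact .inr (succ_sub_self_ne z)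

theorem Rep.dec_eq {f g : M.N → M.N} (hf : Rep f) (hg : Rep g) : Dec (fun x => f x = g x) :=
  ((Rep.dec_eq_zero (hf.sub hg)).and ((Rep.dec_eq_zero hg).or
    (Rep.dec_eq_zero (hf.sub hg.pred)).not)).congr fun x => eq_iff_sub (f x) (g x)

theorem Dec.ind {P : M.N → Prop} (hP : Dec P) (h₀ : P 0) (h₁ : ∀ x, P x → P (x + 1)) (x : M.N) :
    P x :=
  hP.ind_succ h₀ (fun x h => by rw [← add_one_eq]; exact h₁ x h) x

/-! ### The ordered semiring of numbers -/

theorem zero_add' (x : M.N) : 0 + x = x :=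
  Dec.ind_succ (P := fun x => 0 + x = x) (Rep.dec_eq (.add (.const _) .id) .id) (add_zero' 0)
    (fun x h => by rw [add_succ, h]) x

theorem succ_add (x y : M.N) : M.succ ⬝ x + y = M.succ ⬝ (x + y) :=
  Dec.ind_succ (P := fun y => M.succ ⬝ x + y = M.succ ⬝ (x + y))
    (Rep.dec_eq (.add (.const _) .id) (.app (.const _) (.add (.const _) .id)))
    (by rw [add_zero', add_zero']) (fun y h => by rw [add_succ, h, add_succ]) y

theorem add_comm' (x y : M.N) : x + y = y + x :=
  Dec.ind_succ (P := fun y => x + y = y + x) (Rep.dec_eq (.add (.const _) .id) (.add .id (.const _)))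
    (by rw [add_zero', zero_add']) (fun y h => by rw [add_succ, h, succ_add]) y

theorem add_assoc' (x y z : M.N) : x + y + z = x + (y + z) :=
  Dec.ind_succ (P := fun z => x + y + z = x + (y + z))
    (Rep.dec_eq (.add (.const _) .id) (.add (.const _) (.add (.const _) .id)))
    (by rw [add_zero', add_zero']) (fun z h => by rw [add_succ, h, add_succ, add_succ]) z


theorem zero_mul' (x : M.N) : 0 * x = 0 :=
  Dec.ind_succ (P := fun x => 0 * x = 0) (Rep.dec_eq (.mul (.const _) .id) (.const _))
    (mul_zero' 0) (fun x h => by rw [mul_succ, h, add_zero']) x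

theorem succ_mul (x y : M.N) : M.succ ⬝ x * y = x * y + y :=
  Dec.ind_succ (P := fun y => M.succ ⬝ x * y = x * y + y)
    (Rep.dec_eq (.mul (.const _) .id) (.add (.mul (.const _) .id) .id))
    (by rw [mul_zero', mul_zero', add_zero'])
    (fun y h => by
      rw [mul_succ, h, mul_succ, add_succ, add_succ, add_assoc', add_comm' y, ← add_assoc']) y

theorem mul_comm' (x y : M.N) : x * y = y * x :=
  Dec.ind_succ (P := fun y => x * y = y * x) (Rep.dec_eq (.mul (.const _) .id) (.mul .id (.const _)))
    (by rw [mul_zero', zero_mul']) (fun y h => by rw [mul_succ, h, succ_mul]) y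

theorem mul_add' (x y z : M.N) : x * (y + z) = x * y + x * z :=
  Dec.ind_succ (P := fun z => x * (y + z) = x * y + x * z)
    (Rep.dec_eq (.mul (.const _) (.add (.const _) .id)) (.add (.const _) (.mul (.const _) .id)))
    (by rw [mul_zero', add_zero', add_zero'])
    (fun z h => by rw [add_succ, mul_succ, h, mul_succ, add_assoc']) z

theorem mul_assoc' (x y z : M.N) : x * y * z = x * (y * z) :=
  Dec.ind_succ (P := fun z => x * y * z = x * (y * z))
    (Rep.dec_eq (.mul (.const _) .id) (.mul (.const _) (.mul (.const _) .id)))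
    (by rw [mul_zero', mul_zero', mul_zero'])
    (fun z h => by rw [mul_succ, h, mul_succ, mul_add']) z

theorem mul_one' (x : M.N) : x * 1 = x :=
  (mul_succ x 0).trans (by rw [mul_zero', zero_add'])

instance : CommSemiring M.N where
  add_assoc := add_assoc'
  zero_add := zero_add'
  add_zero := add_zero'
  add_comm := add_comm'
  nsmul := nsmulRec
  left_distrib := mul_add'
  right_distrib x y z := by rw [mul_comm', mul_add', mul_comm' z, mul_comm' z]
  zero_mul := zero_mul'
  mul_zero := mul_zero'
  mul_assoc := mul_assoc'
  one_mul x := (mul_comm' 1 x).trans (mul_one' x)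
  mul_one := mul_one'
  mul_comm := mul_comm'

/-! ### Cancellation, truncated subtraction and the order -/

theorem add_right_cancel' (x y z : M.N) : x + z = y + z → x = y :=
  Dec.ind_succ (P := fun z => x + z = y + z → x = y)
    ((Rep.dec_eq (.add (.const _) .id) (.add (.const _) .id)).imp
      (Rep.dec_eq (.const _) (.const _)))
    (fun h => by rwa [add_zero', add_zero'] at h)
    (fun z h h' => h (Arith.succ_inj _ _ (by rwa [add_succ, add_succ] at h'))) z

theorem zero_sub' (x : M.N) : 0 - x = 0 :=
  Dec.ind_succ (P := fun x => 0 - x = 0) (Rep.dec_eq (.sub (.const _) .id) (.const _))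
    (sub_zero' 0) (fun x h => by rw [sub_succ, h, pred_zero]) x

theorem add_sub_cancel_left' (x y : M.N) : x + y - x = y :=
  Dec.ind_succ (P := fun x => x + y - x = y)
    (Rep.dec_eq (.sub (.add .id (.const _)) .id) (.const _))
    (by rw [zero_add', sub_zero']) (fun x h => by rw [succ_add, succ_sub_succ, h]) x

theorem sub_add_self (x y : M.N) : x - (x + y) = 0 :=
  Dec.ind_succ (P := fun x => x - (x + y) = 0)
    (Rep.dec_eq (.sub .id (.add .id (.const _))) (.const _))
    (zero_sub' _) (fun x h => by rw [succ_add, succ_sub_succ, h]) x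

theorem add_sub_of_sub_eq_zero (x y : M.N) : y - x = 0 → y + (x - y) = x :=
  Dec.ind_succ (P := fun x => y - x = 0 → y + (x - y) = x)
    ((Rep.dec_eq (.sub (.const _) .id) (.const _)).imp
      (Rep.dec_eq (.add (.const _) (.sub .id (.const _))) .id))
    (fun h => by rw [sub_zero'] at h; rw [h, sub_zero', zero_add'])
    (fun x ih h => by
      rw [sub_succ] at h
      rcases zero_or_succ (y - x) with hz | ⟨z, hz⟩
      · have e := ih hz
        have e' : M.succ ⬝ x = y + M.succ ⬝ (x - y) := by rw [add_succ, e]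
        rw [e', add_sub_cancel_left']
      -- Here `y - x` is a successor with predecessor zero, so `y = x + 1`.
      · rw [hz, pred_succ] at h
        subst h
        have e : x + (y - x) = y := (Arith.sub_eq_zero_or y x).resolve_left
          (show ¬ y - x = 0 by rw [hz]; exact succ_ne_zero 0)
        rw [hz, add_succ, add_zero'] at e
        rw [← e, sub_self', add_zero']) x

theorem le_iff_exists (x y : M.N) : x ≤ y ↔ ∃ z, x + z = y :=
  ⟨fun h => ⟨y - x, add_sub_of_sub_eq_zero y x h⟩, fun ⟨z, h⟩ => h ▸ sub_add_self x z⟩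

theorem add_one_ne_zero' (x : M.N) : x + 1 ≠ 0 := by
  rw [add_one_eq]; exact succ_ne_zero x

theorem zero_or_add_one (x : M.N) : x = 0 ∨ ∃ y, x = y + 1 := by
  simp only [add_one_eq]
  exact zero_or_succ x

theorem eq_zero_of_add_eq_zero (x y : M.N) (h : x + y = 0) : y = 0 := by
  rcases zero_or_add_one y with rfl | ⟨z, rfl⟩
  · rfl
  · rw [← add_assoc] at h
    exact absurd h (add_one_ne_zero' _)

noncomputable instance : LinearOrder M.N where
  le_refl := sub_self'
  le_trans x y z h₁ h₂ := by
    obtain ⟨a, rfl⟩ := (le_iff_exists _ _).1 h₁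
    obtain ⟨b, rfl⟩ := (le_iff_exists _ _).1 h₂
    exact (le_iff_exists _ _).2 ⟨a + b, (add_assoc x a b).symm⟩
  le_antisymm x y h₁ h₂ := by
    obtain ⟨a, rfl⟩ := (le_iff_exists _ _).1 h₁
    obtain ⟨b, h⟩ := (le_iff_exists _ _).1 h₂
    have h' : a + b = 0 := add_right_cancel' _ _ x (by rw [zero_add, add_comm, ← add_assoc, h])
    rw [add_comm] at h'
    rw [eq_zero_of_add_eq_zero _ _ h', add_zero]
  le_total x y := by
    rcases Arith.sub_eq_zero_or x y with h | h
    · exact .inl h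
    · exact .inr ((le_iff_exists _ _).2 ⟨_, h⟩)
  lt_iff_le_not_ge x y := by
    rw [lt_iff_succ_le]
    constructor
    · intro h
      obtain ⟨a, rfl⟩ := (le_iff_exists _ _).1 h
      refine ⟨(le_iff_exists _ _).2 ⟨1 + a, (add_assoc _ _ _).symm⟩, fun h' => ?_⟩
      obtain ⟨b, hb⟩ := (le_iff_exists _ _).1 h'
      refine add_one_ne_zero' (a + b) (add_right_cancel' _ _ x ?_)
      rw [zero_add]
      calc a + b + 1 + x = x + 1 + a + b := by ring
        _ = x := hb
    · rintro ⟨h₁, h₂⟩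
      obtain ⟨a, rfl⟩ := (le_iff_exists _ _).1 h₁
      rcases zero_or_add_one a with rfl | ⟨b, rfl⟩
      · exact absurd (by rw [add_zero]; exact sub_self' x) h₂
      · exact (le_iff_exists _ _).2 ⟨b, by ring⟩
  toDecidableLE := Classical.decRel _

theorem zero_le' (x : M.N) : 0 ≤ x := zero_sub' x

instance : IsStrictOrderedRing M.N where
  add_le_add_left x y h z := by
    obtain ⟨a, rfl⟩ := (le_iff_exists _ _).1 h
    exact (le_iff_exists _ _).2 ⟨a, by ring⟩
  le_of_add_le_add_left x y z h := by
    obtain ⟨a, ha⟩ := (le_iff_exists _ _).1 h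
    exact (le_iff_exists _ _).2 ⟨a, add_right_cancel' _ _ x (by rw [add_comm z, ← ha]; ring)⟩
  zero_le_one := zero_le' 1
  exists_pair_ne := ⟨0, 1, fun h => succ_ne_zero (0 : M.N) h.symm⟩
  mul_lt_mul_of_pos_left x hx y z h := by
    rw [lt_iff_succ_le] at hx h ⊢
    obtain ⟨a, rfl⟩ := (le_iff_exists _ _).1 hx
    obtain ⟨b, rfl⟩ := (le_iff_exists _ _).1 h
    exact (le_iff_exists _ _).2 ⟨a + (0 + 1 + a) * b, by ring⟩
  mul_lt_mul_of_pos_right x hx y z h := by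
    rw [lt_iff_succ_le] at hx h ⊢
    obtain ⟨a, rfl⟩ := (le_iff_exists _ _).1 hx
    obtain ⟨b, rfl⟩ := (le_iff_exists _ _).1 h
    exact (le_iff_exists _ _).2 ⟨a + (0 + 1 + a) * b, by ring⟩

instance : CanonicallyOrderedAdd M.N where
  exists_add_of_le h := by
    obtain ⟨a, h⟩ := (le_iff_exists _ _).1 h
    exact ⟨a, h.symm⟩
  le_self_add x y := (le_iff_exists _ _).2 ⟨y, rfl⟩
  le_add_self x y := (le_iff_exists _ _).2 ⟨y, add_comm _ _⟩

theorem lt_iff_add_one_le (x y : M.N) : x < y ↔ x + 1 ≤ y := lt_iff_succ_le x y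

theorem lt_add_one_iff' (x y : M.N) : x < y + 1 ↔ x ≤ y := by
  rw [lt_iff_add_one_le, add_le_add_iff_right]

theorem zero_lt_add_one (x : M.N) : 0 < x + 1 := (lt_add_one_iff' _ _).2 (zero_le' x)

instance : OrderedSub M.N where
  tsub_le_iff_right x y z := by
    rcases Arith.sub_eq_zero_or x y with h | h
    · have h' : x - y = 0 := h
      exact iff_of_true (h' ▸ zero_le' z) (le_add_left ((le_def x y).2 h'))
    · have h' : y + (x - y) = x := h
      rw [← add_le_add_iff_left y, h', add_comm z]

theorem eq_zero_iff_sub (x y : M.N) : x - y + (y - x) = 0 ↔ x = y := by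
  rw [add_eq_zero, ← le_def, ← le_def]
  exact le_antisymm_iff.symm

end Model

/-! ### Closed terms and evaluation rules -/

/-- The empty substitution. -/
def Subst.nil {Γ : Ctx} : Subst [] Γ := fun _ v => nomatch v

/-- A closed term as a term in any context. -/
def Term.cl {Γ : Ctx} {τ : Ty} (t : Term [] τ) : Term Γ τ := t.subst Subst.nil

theorem Term.subst_cl {Γ Δ : Ctx} {τ : Ty} (θ : Subst Γ Δ) (t : Term [] τ) :
    t.cl.subst θ = t.cl := by
  rw [Term.cl, Term.subst_subst, Term.cl]
  congr 1
  funext τ v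
  exact nomatch v

/-- The value of a closed term. -/
def Model.den (M : Model) {τ : Ty} (t : Term [] τ) : M.C τ := t.eval Env.nil

/-- The variable bound last but four. -/
abbrev v4 {Γ : Ctx} {a b c d e : Ty} : Term (a :: b :: c :: d :: e :: Γ) e :=
  Term.var (Var.succ (Var.succ (Var.succ (Var.succ Var.zero))))

/-- The variable bound last but five. -/
abbrev v5 {Γ : Ctx} {a b c d e f : Ty} : Term (a :: b :: c :: d :: e :: f :: Γ) f :=
  Term.var (Var.succ (Var.succ (Var.succ (Var.succ (Var.succ Var.zero)))))

/-- The variable bound last but six. -/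
abbrev v6 {Γ : Ctx} {a b c d e f g : Ty} : Term (a :: b :: c :: d :: e :: f :: g :: Γ) g :=
  Term.var (Var.succ (Var.succ (Var.succ (Var.succ (Var.succ (Var.succ Var.zero))))))

namespace Model

variable {M : Model}

theorem eval_cl {Γ : Ctx} {τ : Ty} (ρ : Env M Γ) (t : Term [] τ) : t.cl.eval ρ = M.den t := by
  rw [Term.cl, Term.eval_subst, den]
  congr 1
  funext τ v
  exact nomatch v

theorem eval_ifz {Γ : Ctx} (ρ : Env M Γ) (t a b : Term Γ Ty.nat) :
    (t.ifz a b).eval ρ = ifz (t.eval ρ) (a.eval ρ) (b.eval ρ) := rfl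

theorem eval_sub {Γ : Ctx} (ρ : Env M Γ) (s t : Term Γ Ty.nat) :
    (s.sub t).eval ρ = s.eval ρ - t.eval ρ := rfl

theorem eval_suc {Γ : Ctx} (ρ : Env M Γ) (s : Term Γ Ty.nat) :
    s.suc.eval ρ = s.eval ρ + 1 := (add_one_eq _).symm

theorem eval_rec {Γ : Ctx} (ρ : Env M Γ) (t a : Term Γ Ty.nat)
    (f : Term Γ (Ty.arrow Ty.nat (Ty.arrow Ty.nat Ty.nat))) :
    (t.prec a f).eval ρ = M.R ⬝ t.eval ρ ⬝ a.eval ρ ⬝ f.eval ρ := rfl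

theorem R_zero' (a : M.N) (f : M.C (Ty.arrow Ty.nat (Ty.arrow Ty.nat Ty.nat))) :
    M.R ⬝ (0 : M.N) ⬝ a ⬝ f = a := M.R_zero a f

theorem R_add_one (n a : M.N) (f : M.C (Ty.arrow Ty.nat (Ty.arrow Ty.nat Ty.nat))) :
    M.R ⬝ (n + 1) ⬝ a ⬝ f = f ⬝ (M.R ⬝ n ⬝ a ⬝ f) ⬝ n := by
  rw [add_one_eq]; exact M.R_succ n a f

theorem eval_var {Γ : Ctx} {τ : Ty} (ρ : Env M Γ) (v : Var Γ τ) : (Term.var v).eval ρ = ρ v := rfl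

theorem eval_app {Γ : Ctx} {σ τ : Ty} (ρ : Env M Γ) (f : Term Γ (Ty.arrow σ τ)) (a : Term Γ σ) :
    (f.app a).eval ρ = f.eval ρ ⬝ a.eval ρ := rfl

theorem eval_zero {Γ : Ctx} (ρ : Env M Γ) : (Term.zero : Term Γ Ty.nat).eval ρ = 0 := rfl

end Model

theorem Env.cons_zero {M : Model} {Γ : Ctx} {σ : Ty} (x : M.C σ) (ρ : Env M Γ) :
    Env.cons x ρ Var.zero = x := rfl

theorem Env.cons_succ {M : Model} {Γ : Ctx} {σ τ : Ty} (x : M.C σ) (ρ : Env M Γ) (v : Var Γ τ) :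
    Env.cons x ρ (Var.succ v) = ρ v := rfl

attribute [simp] Model.eval_cl Model.eval_ifz Model.eval_sub Model.eval_add Model.eval_suc
  Model.eval_rec Model.eval_var Model.eval_app Model.eval_zero Env.cons_zero Env.cons_succ
  Model.eval_lam Model.R_zero' Model.R_add_one

/-! ### Bounded search -/

/-- The least `z ≤ n` with `h z = 0`, and `n` if there is none. -/
def leastTerm : Term [] (Ty.arrow Ty.one Ty.one) :=
  Term.lam (Term.lam (Term.prec v0 Term.zero
    (Term.lam (Term.lam (Term.ifz (Term.app v3 v1) v1 (Term.suc v1))))))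

/-- The least `z ≤ n` with `h z = 0`, and `n` if there is none. -/
def Term.least {Γ : Ctx} (h : Term Γ Ty.one) (n : Term Γ Ty.nat) : Term Γ Ty.nat :=
  (leastTerm.cl.app h).app n

namespace Model

variable {M : Model}

/-- The least `z ≤ n` with `h z = 0`, and `n` if there is none. -/
def least (h : M.F) (n : M.N) : M.N := M.den leastTerm ⬝ h ⬝ n

@[simp] theorem eval_least {Γ : Ctx} (ρ : Env M Γ) (h : Term Γ Ty.one) (n : Term Γ Ty.nat) :
    (h.least n).eval ρ = least (h.eval ρ) (n.eval ρ) := by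
  simp [Term.least, least]

theorem least_zero (h : M.F) : least h 0 = 0 := by
  simp [least, den, leastTerm]

theorem least_add_one (h : M.F) (n : M.N) :
    least h (n + 1) = ifz (h ⬝ least h n) (least h n) (least h n + 1) := by
  simp only [least, den, leastTerm, eval_lam, eval_rec, eval_var, Env.cons_zero, Env.cons_succ,
    R_add_one, eval_ifz, eval_app, eval_suc]
  rfl

theorem Rep.least {f : M.N → M.F} {g : M.N → M.N} (hf : Rep f) (hg : Rep g) :
    Rep (fun x => least (f x) (g x)) :=
  ((Rep.const _).app hf).app hg

variable [M.Arith]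

theorem Rep.dec_le {f g : M.N → M.N} (hf : Rep f) (hg : Rep g) : Dec (fun x => f x ≤ g x) :=
  (hf.sub hg).dec_eq_zero

theorem Rep.dec_lt {f g : M.N → M.N} (hf : Rep f) (hg : Rep g) : Dec (fun x => f x < g x) :=
  ((hg.dec_le hf).not).congr fun _ => not_le

theorem Rep.app_id (f : M.F) : Rep (fun x => f ⬝ x) := .app (.const f) .id

theorem Rep.least_id (h : M.F) : Rep (fun n => Model.least h n) := .least (.const h) .id

theorem least_le (h : M.F) (n : M.N) : least h n ≤ n := by
  refine Dec.ind (P := fun n => least h n ≤ n) ((Rep.least_id h).dec_le .id) ?_ ?_ n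
  · exact (least_zero h).le
  · intro n hn
    rw [least_add_one]
    by_cases h0 : h ⬝ least h n = 0
    · rw [h0, ifz_zero]; exact hn.trans le_self_add
    · rw [ifz_of_ne h0]; gcongr

theorem least_eq_of_ne (h : M.F) (n : M.N) : h ⬝ least h n ≠ 0 → least h n = n := by
  refine Dec.ind (P := fun n => ¬ h ⬝ least h n = 0 → least h n = n)
    ((Rep.dec_eq_zero (.app (.const h) (.least_id h))).not.imp ((Rep.least_id h).dec_eq .id)) ?_ ?_ n
  · exact fun _ => least_zero h
  · intro n hn
    rw [least_add_one]
    by_cases h0 : h ⬝ least h n = 0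
    · rw [h0, ifz_zero]; exact fun h1 => absurd h0 h1
    · rw [ifz_of_ne h0, hn h0]; exact fun _ => rfl

theorem ne_of_lt_least (h : M.F) (n z : M.N) : z < least h n → h ⬝ z ≠ 0 := by
  refine Dec.ind (P := fun n => z < least h n → ¬ h ⬝ z = 0)
    (((Rep.const z).dec_lt (.least_id h)).imp (Rep.dec_eq_zero (.const _)).not) ?_ ?_ n
  · rw [least_zero]; exact fun h => absurd h (not_lt.2 (zero_le' z))
  · intro n hn
    rw [least_add_one]
    by_cases h0 : h ⬝ least h n = 0
    · rwa [h0, ifz_zero]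
    · rw [ifz_of_ne h0, lt_add_one_iff']
      intro hz
      rcases hz.lt_or_eq with hz | rfl
      · exact hn hz
      · exact h0

/-- If the search ended at a nonzero value, it would have reached `n` itself and passed only nonzero
values, including the one at `z`. -/
theorem least_spec {h : M.F} {n z : M.N} (hz : z ≤ n) (h0 : h ⬝ z = 0) : h ⬝ least h n = 0 := by
  by_contra h1
  have h2 := least_eq_of_ne h n h1
  rcases hz.lt_or_eq with hz | rfl
  · exact ne_of_lt_least h n z (by rwa [h2]) h0
  · rw [h2] at h1; exact h1 h0

theorem least_min {h : M.F} {n z : M.N} (h0 : h ⬝ z = 0) : least h n ≤ z :=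
  not_lt.1 fun hlt => ne_of_lt_least h n z hlt h0

/-- The least number principle for the zeros of a function. -/
theorem exists_least {h : M.F} {n : M.N} (h0 : h ⬝ n = 0) :
    ∃ z ≤ n, h ⬝ z = 0 ∧ ∀ t < z, h ⬝ t ≠ 0 :=
  ⟨least h n, least_le h n, least_spec le_rfl h0, ne_of_lt_least h n⟩

end Model

/-! ### Truth values -/

/-- `0` if `t ≠ 0`. -/
def Term.nez {Γ : Ctx} (t : Term Γ Ty.nat) : Term Γ Ty.nat := t.ifz (Term.suc Term.zero) Term.zero

/-- `0` if `s = 0` and `t = 0`. -/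
def Term.both {Γ : Ctx} (s t : Term Γ Ty.nat) : Term Γ Ty.nat := s.add t

/-- `0` if `s = 0` implies `t = 0`. -/
def Term.impl {Γ : Ctx} (s t : Term Γ Ty.nat) : Term Γ Ty.nat := s.ifz t Term.zero

/-- `0` if `s = t`. -/
def Term.eqz {Γ : Ctx} (s t : Term Γ Ty.nat) : Term Γ Ty.nat := (s.sub t).add (t.sub s)

/-- `0` if `h z = 0` for all `z ≤ n`, where the abstraction of `t` is `h`. -/
def Term.ball {Γ : Ctx} (n : Term Γ Ty.nat) (t : Term (Ty.nat :: Γ) Ty.nat) : Term Γ Ty.nat :=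
  t.lam.app (Term.least t.nez.lam n)

namespace Model

variable {M : Model} [M.Arith] {Γ : Ctx} (ρ : Env M Γ)

theorem one_ne_zero' : (1 : M.N) ≠ 0 := succ_ne_zero 0

theorem ifz_eq_if (t a b : M.N) : ifz t a b = if t = 0 then a else b := by
  split_ifs with h
  · rw [h, ifz_zero]
  · exact ifz_of_ne h a b

@[simp] theorem eval_nez (t : Term Γ Ty.nat) : t.nez.eval ρ = 0 ↔ t.eval ρ ≠ 0 := by
  simp [Term.nez, ifz_eq_if]

@[simp] theorem eval_both (s t : Term Γ Ty.nat) :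
    (s.both t).eval ρ = 0 ↔ s.eval ρ = 0 ∧ t.eval ρ = 0 := by
  simp [Term.both]

@[simp] theorem eval_impl (s t : Term Γ Ty.nat) :
    (s.impl t).eval ρ = 0 ↔ (s.eval ρ = 0 → t.eval ρ = 0) := by
  simp only [Term.impl, eval_ifz, ifz_eq_if, eval_zero]
  split_ifs <;> simp_all

@[simp] theorem eval_eqz (s t : Term Γ Ty.nat) :
    (s.eqz t).eval ρ = 0 ↔ s.eval ρ = t.eval ρ :=
  eq_zero_iff_sub _ _

@[simp] theorem eval_sub_eq_zero (s t : Term Γ Ty.nat) :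
    (s.sub t).eval ρ = 0 ↔ s.eval ρ ≤ t.eval ρ := Iff.rfl

-- A bounded universal statement is tested at a single point: the least counterexample, or the bound
-- if there is none.
@[simp] theorem eval_ball (n : Term Γ Ty.nat) (t : Term (Ty.nat :: Γ) Ty.nat) :
    (n.ball t).eval ρ = 0 ↔ ∀ z ≤ n.eval ρ, t.eval (Env.cons z ρ) = 0 := by
  simp only [Term.ball, eval_app, eval_lam, eval_least]
  refine ⟨fun h z hz => ?_, fun h => h _ (least_le _ _)⟩
  by_contra h0
  have h1 := least_spec (h := t.nez.lam.eval ρ) hz (by rw [eval_lam, eval_nez]; exact h0)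
  rw [eval_lam, eval_nez] at h1
  exact h1 h

end Model

/-! ### Powers, quotients and digits -/

/-- The step of the recursion for powers. -/
def powStep : Term [] (Ty.arrow Ty.nat (Ty.arrow Ty.nat Ty.one)) :=
  Term.lam (Term.lam (Term.lam ((mulTerm.cl.app v1).app v2)))

/-- Powers. -/
def powTerm : Term [] (Ty.arrow Ty.nat Ty.one) :=
  Term.lam (Term.lam (Term.prec v0 (Term.suc Term.zero) (powStep.cl.app v1)))

/-- The quotient of two numbers. -/
def divTerm : Term [] (Ty.arrow Ty.nat Ty.one) :=
  Term.lam (Term.lam (Term.least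
    (Term.lam (Term.sub (Term.suc v2) ((mulTerm.cl.app v1).app (Term.suc v0)))) v1))

/-- The digit of the number `c` in base `b` at the position `x`, for the arguments `b, c, x`. -/
def digTerm : Term [] (Ty.arrow Ty.nat (Ty.arrow Ty.nat Ty.one)) :=
  Term.lam (Term.lam (Term.lam (Term.sub
    ((divTerm.cl.app v1).app ((powTerm.cl.app v2).app v0))
    ((mulTerm.cl.app v2).app ((divTerm.cl.app
      ((divTerm.cl.app v1).app ((powTerm.cl.app v2).app v0))).app v2)))))

namespace Model

variable {M : Model}

/-- Powers in a model. -/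
def pow (b n : M.N) : M.N := M.den powTerm ⬝ b ⬝ n

/-- Quotients in a model. -/
def quo (c d : M.N) : M.N := M.den divTerm ⬝ c ⬝ d

/-- The digit of the number `c` in base `b` at the position `x`. -/
def dig (b c x : M.N) : M.N := M.den digTerm ⬝ b ⬝ c ⬝ x

theorem den_mul (x y : M.N) : M.den mulTerm ⬝ x ⬝ y = x * y := rfl

variable [M.Arith]

theorem pow_eq (b n : M.N) : pow b n = M.R ⬝ n ⬝ 1 ⬝ (M.den powStep ⬝ b) := by
  change powTerm.eval Env.nil ⬝ b ⬝ n = _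
  simp [powTerm]

theorem pow_zero' (b : M.N) : pow b 0 = 1 := by
  simp [pow_eq]

theorem den_powStep (b x y : M.N) : M.den powStep ⬝ b ⬝ x ⬝ y = x * b := by
  change powStep.eval Env.nil ⬝ b ⬝ x ⬝ y = _
  simp [powStep, den_mul]

theorem pow_add_one (b n : M.N) : pow b (n + 1) = pow b n * b := by
  rw [pow_eq, R_add_one, den_powStep, pow_eq]

theorem quo_eq (c d : M.N) : quo c d = least (Term.eval (Γ := [Ty.nat, Ty.nat])
    (Env.cons d (Env.cons c Env.nil))
    (Term.lam (Term.sub (Term.suc v2) ((mulTerm.cl.app v1).app (Term.suc v0))))) c := by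
  change divTerm.eval Env.nil ⬝ c ⬝ d = _
  simp [divTerm]

theorem dig_eq (b c x : M.N) :
    dig b c x = quo c (pow b x) - b * quo (quo c (pow b x)) b := by
  change digTerm.eval Env.nil ⬝ b ⬝ c ⬝ x = _
  simp [digTerm, den_mul, pow, quo]

theorem quo_mul_le (c d : M.N) (hd : 0 < d) :
    d * quo c d ≤ c ∧ c < d * (quo c d + 1) := by
  rw [quo_eq]
  set h := Term.eval (Γ := [Ty.nat, Ty.nat]) (Env.cons d (Env.cons c Env.nil))
    (Term.lam (Term.sub (Term.suc v2) ((mulTerm.cl.app v1).app (Term.suc v0)))) with hh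
  have hz : ∀ q, h ⬝ q = 0 ↔ c < d * (q + 1) := fun q => by
    rw [hh, eval_lam, eval_sub_eq_zero, lt_iff_add_one_le]
    simp [den_mul]
  -- The bound `c` suffices for the search, since `d ≥ 1` gives `c < d * (c + 1)`.
  have hc : h ⬝ c = 0 := by
    rw [hz, lt_iff_add_one_le]
    exact le_mul_of_one_le_left (zero_le' _) (by rwa [lt_iff_add_one_le, zero_add] at hd)
  refine ⟨?_, (hz _).1 (least_spec le_rfl hc)⟩
  rcases zero_or_add_one (least h c) with h0 | ⟨q, hq⟩
  · rw [h0, mul_zero]; exact zero_le' _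
  · rw [hq]
    have := ne_of_lt_least h c q (by rw [hq]; exact (lt_add_one_iff' _ _).2 le_rfl)
    rw [ne_eq, hz] at this
    exact not_lt.1 this

theorem quo_unique {c d q : M.N} (h₁ : d * q ≤ c) (h₂ : c < d * (q + 1)) : quo c d = q := by
  have hd : 0 < d := by
    by_contra h
    rw [le_antisymm (not_lt.1 h) (zero_le' d), zero_mul] at h₂
    exact not_lt.2 (zero_le' c) h₂
  obtain ⟨h₃, h₄⟩ := quo_mul_le c d hd
  apply le_antisymm
  · rw [← lt_add_one_iff']
    exact lt_of_mul_lt_mul_left (h₃.trans_lt h₂) hd.le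
  · rw [← lt_add_one_iff']
    exact lt_of_mul_lt_mul_left (h₁.trans_lt h₄) hd.le

theorem pow_pos' {b : M.N} (hb : 0 < b) (n : M.N) : 0 < pow b n := by
  refine Dec.ind (P := fun n => 0 < pow b n) (Rep.dec_lt (.const _) (.app_id _)) ?_ ?_ n
  · rw [pow_zero']; exact zero_lt_one
  · intro n hn
    rw [pow_add_one]
    exact mul_pos hn hb

theorem pow_add' (b m n : M.N) : pow b (m + n) = pow b m * pow b n := by
  refine Dec.ind (P := fun n => pow b (m + n) = pow b m * pow b n)
    (Rep.dec_eq (.app (.const _) (.add (.const _) .id)) (.mul (.const _) (.app_id _))) ?_ ?_ n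
  · rw [pow_zero', add_zero, mul_one]
  · intro n hn
    rw [← add_assoc, pow_add_one, hn, pow_add_one, mul_assoc]

theorem dig_lt {b : M.N} (hb : 0 < b) (c x : M.N) : dig b c x < b := by
  rw [dig_eq]
  obtain ⟨h₁, h₂⟩ := quo_mul_le (quo c (pow b x)) b hb
  rw [tsub_lt_iff_left h₁]
  rwa [mul_add, mul_one] at h₂

theorem dig_of_lt {b c x : M.N} (hb : 0 < b) (h : c < pow b x) : dig b c x = 0 := by
  have hq : quo c (pow b x) = 0 := quo_unique (by rw [mul_zero]; exact zero_le' _)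
    (by rwa [zero_add, mul_one])
  have hq' : quo 0 b = 0 := quo_unique (by rw [mul_zero]) (by rwa [zero_add, mul_one])
  rw [dig_eq, hq, hq', mul_zero, sub_self']

theorem dig_add_mul_pow_self {b c v x : M.N} (hv : v < b) (h : c < pow b x) :
    dig b (c + v * pow b x) x = v := by
  have hb : 0 < b := (zero_le' v).trans_lt hv
  have hq : quo (c + v * pow b x) (pow b x) = v := quo_unique (by rw [mul_comm]; exact le_add_self)
    (by rw [mul_add, mul_one, mul_comm, add_comm]; gcongr)
  have hq' : quo v b = 0 := quo_unique (by rw [mul_zero]; exact zero_le' _)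
    (by rwa [zero_add, mul_one])
  rw [dig_eq, hq, hq', mul_zero, tsub_zero]

/-- Since `b ^ n` is `b ^ x` times a multiple of `b`, the summand shifts the quotient by `b ^ x` by
a multiple of `b`, which the reduction to a digit removes. -/
theorem dig_add_mul_pow {b c v n x : M.N} (hb : 0 < b) (hx : x < n) :
    dig b (c + v * pow b n) x = dig b c x := by
  obtain ⟨z, rfl⟩ := (le_iff_exists _ _).1 ((lt_iff_add_one_le _ _).1 hx)
  have hp : pow b (x + 1 + z) = pow b x * (b * pow b z) := by
    rw [pow_add', pow_add_one, mul_assoc]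
  obtain ⟨h₁, h₂⟩ := quo_mul_le c (pow b x) (pow_pos' hb x)
  obtain ⟨h₃, h₄⟩ := quo_mul_le (quo c (pow b x)) b hb
  have hq : quo (c + v * pow b (x + 1 + z)) (pow b x) =
      quo c (pow b x) + b * (v * pow b z) := by
    apply quo_unique
    · rw [hp]
      calc _ = pow b x * quo c (pow b x) + v * (pow b x * (b * pow b z)) := by ring
        _ ≤ _ := by gcongr
    · rw [hp]
      calc _ < pow b x * (quo c (pow b x) + 1) + v * (pow b x * (b * pow b z)) := by gcongr
        _ = _ := by ring
  have hq' : quo (quo c (pow b x) + b * (v * pow b z)) b =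
      quo (quo c (pow b x)) b + v * pow b z := by
    apply quo_unique
    · rw [mul_add]; gcongr
    · calc _ < b * (quo (quo c (pow b x)) b + 1) + b * (v * pow b z) := by gcongr
        _ = _ := by ring
  rw [dig_eq, dig_eq, hq, hq', mul_add, add_tsub_add_eq_tsub_right]

end Model

/-- `0` if `h z = 0` for some `z ≤ n`, where the abstraction of `t` is `h`. -/
def Term.bex {Γ : Ctx} (n : Term Γ Ty.nat) (t : Term (Ty.nat :: Γ) Ty.nat) : Term Γ Ty.nat :=
  t.lam.app (Term.least t.lam n)

/-- The digit of `c` in base `b` at the position `x`. -/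
def Term.dig {Γ : Ctx} (b c x : Term Γ Ty.nat) : Term Γ Ty.nat := ((digTerm.cl.app b).app c).app x

/-! ### Codes of finite sequences -/

/-- The step of the recursion for the number with given digits. -/
def codeStep : Term [] (Ty.arrow Ty.nat (Ty.arrow Ty.one (Ty.arrow Ty.nat Ty.one))) :=
  Term.lam (Term.lam (Term.lam (Term.lam
    (Term.add v1 ((mulTerm.cl.app (Term.app v2 v0)).app ((powTerm.cl.app v3).app v0))))))

/-- The step of the recursion for sums. -/
def sumStep : Term [] (Ty.arrow Ty.one (Ty.arrow Ty.nat Ty.one)) :=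
  Term.lam (Term.lam (Term.lam (Term.add v1 (Term.app v2 v0))))

namespace Model

variable {M : Model}

/-- The number with the digits `f 0, …, f (m - 1)` in base `b`. -/
def code (b : M.N) (f : M.F) (m : M.N) : M.N := M.R ⬝ m ⬝ 0 ⬝ (M.den codeStep ⬝ b ⬝ f)

theorem code_zero (b : M.N) (f : M.F) : code b f 0 = 0 := R_zero' _ _

theorem code_add_one (b : M.N) (f : M.F) (m : M.N) :
    code b f (m + 1) = code b f m + (f ⬝ m) * pow b m := by
  have h : ∀ r i, M.den codeStep ⬝ b ⬝ f ⬝ r ⬝ i = r + (f ⬝ i) * pow b i := fun r i => by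
    change codeStep.eval Env.nil ⬝ b ⬝ f ⬝ r ⬝ i = _
    simp [codeStep, den_mul, pow]
  rw [code, R_add_one, h]; rfl

@[simp] theorem eval_dig {Γ : Ctx} (ρ : Env M Γ) (b c x : Term Γ Ty.nat) :
    (Term.dig b c x).eval ρ = dig (b.eval ρ) (c.eval ρ) (x.eval ρ) := by
  simp [Term.dig, dig]

theorem Rep.code_id (b : M.N) (f : M.F) : Rep (fun m => code b f m) :=
  (((Rep.const M.R).app .id).app (.const _)).app (.const _)

theorem Rep.pow_id (b : M.N) : Rep (fun m => pow b m) := .app (.const _) .id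

theorem Rep.dig {f g h : M.N → M.N} (hf : Rep f) (hg : Rep g) (hh : Rep h) :
    Rep (fun x => dig (f x) (g x) (h x)) :=
  (((Rep.const _).app hf).app hg).app hh

variable [M.Arith]

@[simp] theorem eval_bex {Γ : Ctx} (ρ : Env M Γ) (n : Term Γ Ty.nat)
    (t : Term (Ty.nat :: Γ) Ty.nat) :
    (n.bex t).eval ρ = 0 ↔ ∃ z ≤ n.eval ρ, t.eval (Env.cons z ρ) = 0 := by
  simp only [Term.bex, eval_app, eval_lam, eval_least]
  refine ⟨fun h => ⟨_, least_le _ _, h⟩, fun ⟨z, hz, h⟩ => ?_⟩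
  have h1 := least_spec (h := t.lam.eval ρ) hz (by rwa [eval_lam])
  rwa [eval_lam] at h1

theorem add_mul_pow_lt {b c v n : M.N} (hv : v < b) (hc : c < pow b n) :
    c + v * pow b n < pow b (n + 1) := by
  rw [pow_add_one]
  rw [lt_iff_add_one_le] at hv
  calc c + v * pow b n < pow b n + v * pow b n := by gcongr
    _ = pow b n * (v + 1) := by ring
    _ ≤ pow b n * b := by gcongr

theorem code_lt {b : M.N} {f : M.F} {m : M.N} (hf : ∀ x < m, f ⬝ x < b) (n : M.N) :
    n ≤ m → code b f n < pow b n := by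
  refine Dec.ind (P := fun n => n ≤ m → code b f n < pow b n)
    ((Rep.dec_le .id (.const _)).imp (Rep.dec_lt (.code_id _ _) (.pow_id _))) ?_ ?_ n
  · rw [code_zero, pow_zero']; exact fun _ => zero_lt_one
  · intro n ih hn
    rw [code_add_one]
    exact add_mul_pow_lt (hf n ((lt_iff_add_one_le _ _).2 hn)) (ih (le_self_add.trans hn))

/-- Bounded values on an initial segment are recovered from one number, so the existence of a
coloring of `G_m` becomes a bounded search. -/
theorem dig_code {b : M.N} {f : M.F} {m : M.N} (hf : ∀ x < m, f ⬝ x < b) {x : M.N} (hx : x < m) :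
    dig b (code b f m) x = f ⬝ x := by
  have hb : 0 < b := (zero_le' _).trans_lt (hf x hx)
  refine Dec.ind (P := fun n => n ≤ m → x < n → dig b (code b f n) x = f ⬝ x)
    ((Rep.dec_le .id (.const _)).imp ((Rep.dec_lt (.const _) .id).imp
      (Rep.dec_eq (.dig (.const _) (.code_id _ _) (.const _)) (.const _)))) ?_ ?_ m le_rfl hx
  · exact fun _ h => absurd h (not_lt.2 (zero_le' _))
  · intro n ih hn hxn
    have hn' : n < m := (lt_iff_add_one_le _ _).2 hn
    rw [code_add_one]
    rcases ((lt_add_one_iff' _ _).1 hxn).lt_or_eq with h | rfl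
    · rw [dig_add_mul_pow hb h, ih hn'.le h]
    · exact dig_add_mul_pow_self (hf x hx) (code_lt hf x hn'.le)

/-- The sum of the values, defined by recursion, is a bound. It serves where `n` may be nonstandard
and the maximum of an external finite set is not available. -/
theorem exists_bound (g : M.F) (n : M.N) : ∃ B, ∀ j < n, g ⬝ j ≤ B := by
  have h : ∀ r i, M.den sumStep ⬝ g ⬝ r ⬝ i = r + g ⬝ i := fun r i => by
    change sumStep.eval Env.nil ⬝ g ⬝ r ⬝ i = _
    simp [sumStep]
  refine ⟨M.R ⬝ n ⬝ 0 ⬝ (M.den sumStep ⬝ g), fun j => ?_⟩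
  refine Dec.ind (P := fun n => j < n → g ⬝ j ≤ M.R ⬝ n ⬝ 0 ⬝ (M.den sumStep ⬝ g))
    ((Rep.dec_lt (.const _) .id).imp (Rep.dec_le (.const _)
      ((((Rep.const M.R).app .id).app (.const _)).app (.const _)))) ?_ ?_ n
  · exact fun h => absurd h (not_lt.2 (zero_le' _))
  · intro n ih hj
    rw [R_add_one, h]
    rcases ((lt_add_one_iff' _ _).1 hj).lt_or_eq with h | rfl
    · exact (ih h).trans le_self_add
    · exact le_add_self

end Model

/-! ### Colorings of initial subgraphs -/

/-- For the arguments `b, e, i, m, c`: `0` if the digits of `c` in base `b` are positive, extend the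
positive digits of `i`, and are distinct for the endpoints of edges, up to the position `m`. -/
def goodTerm : Term [] (Ty.arrow Ty.nat (Ty.arrow Ty.one (Ty.arrow Ty.nat
    (Ty.arrow Ty.nat Ty.one)))) :=
  Term.lam (Term.lam (Term.lam (Term.lam (Term.lam (Term.ball v1 (Term.both
    (Term.nez (Term.dig v5 v1 v0))
    (Term.both
      (Term.impl (Term.nez (Term.dig v5 v3 v0)) (Term.eqz (Term.dig v5 v1 v0) (Term.dig v5 v3 v0)))
      (Term.ball v2 (Term.impl (Term.sub (Term.suc v0) v1)
        (Term.impl (Term.nez (Term.app v5 (Term.pairCode v0 v1)))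
          (Term.nez (Term.eqz (Term.dig v6 v2 v0) (Term.dig v6 v2 v1)))))))))))))

/-- For the arguments `b, e, i, m`: `0` if the partial coloring given by the positive digits of `i`
in base `b` extends to a coloring of `G_m` with the colors `1, …, b - 1`. -/
def extTerm : Term [] (Ty.arrow Ty.nat (Ty.arrow Ty.one (Ty.arrow Ty.nat Ty.one))) :=
  Term.lam (Term.lam (Term.lam (Term.lam (Term.bex ((powTerm.cl.app v3).app (Term.suc v0))
    (((((goodTerm.cl.app v4).app v3).app v2).app v1).app v0)))))

namespace Model

variable {M : Model}

/-- Triangular numbers in a model. -/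
def tri (M : Model) (x : M.N) : M.N := M.prec x 0 (Term.lam (Term.lam (Term.add v1 v0)))

theorem eval_pairCode {Γ : Ctx} (ρ : Env M Γ) (a b : Term Γ Ty.nat) :
    (Term.pairCode a b).eval ρ = M.tri (b.eval ρ) + a.eval ρ := rfl

theorem tri_add_one (x : M.N) : M.tri (x + 1) = M.tri x + x := by
  simp only [tri, prec, R_add_one, eval_lam, eval_add, eval_var, Env.cons_zero, Env.cons_succ]

/-- Adjacency of `a < b` in the graph with the edge set `e`. -/
def Edge (e : M.F) (a b : M.N) : Prop := e ⬝ (M.tri b + a) ≠ 0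

/-- The partial coloring given by the positive digits of `i` in base `b` extends to a coloring of
`G_m` with the colors `1, …, b - 1`. -/
def Ext (b : M.N) (e : M.F) (i m : M.N) : Prop :=
  ∃ f : M.F, (∀ x ≤ m, f ⬝ x ≠ 0 ∧ f ⬝ x < b ∧ (dig b i x ≠ 0 → f ⬝ x = dig b i x)) ∧
    ∀ x y, x < y → y ≤ m → Edge e x y → f ⬝ x ≠ f ⬝ y

/-- `G_m` has a `k`-coloring. -/
def Col (k : M.N) (e : M.F) (m : M.N) : Prop :=
  ∃ f : M.F, (∀ x ≤ m, f ⬝ x < k) ∧ ∀ x y, x < y → y ≤ m → Edge e x y → f ⬝ x ≠ f ⬝ y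

variable [M.Arith]

theorem den_goodTerm (b : M.N) (e : M.F) (i m c : M.N) :
    M.den goodTerm ⬝ b ⬝ e ⬝ i ⬝ m ⬝ c = 0 ↔ ∀ x ≤ m, dig b c x ≠ 0 ∧
      (dig b i x ≠ 0 → dig b c x = dig b i x) ∧
      ∀ y ≤ m, y < x → Edge e y x → dig b c y ≠ dig b c x := by
  change goodTerm.eval Env.nil ⬝ b ⬝ e ⬝ i ⬝ m ⬝ c = 0 ↔ _
  simp [goodTerm, eval_pairCode, lt_iff_add_one_le, Edge, ← le_def]

/-- A good code is itself read as a function through its digits; conversely, the `m + 1` relevant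
values of a coloring have a code below `b ^ (m + 1)`, the bound of the search. -/
theorem den_extTerm {b : M.N} (hb : 0 < b) (e : M.F) (i m : M.N) :
    M.den extTerm ⬝ b ⬝ e ⬝ i ⬝ m = 0 ↔ Ext b e i m := by
  have h : M.den extTerm ⬝ b ⬝ e ⬝ i ⬝ m = 0 ↔
      ∃ c ≤ pow b (m + 1), M.den goodTerm ⬝ b ⬝ e ⬝ i ⬝ m ⬝ c = 0 := by
    change extTerm.eval Env.nil ⬝ b ⬝ e ⬝ i ⬝ m = 0 ↔ _
    simp [extTerm, pow]
  rw [h]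
  simp only [den_goodTerm]
  constructor
  · rintro ⟨c, -, hc⟩
    exact ⟨M.den digTerm ⬝ b ⬝ c, fun x hx => ⟨(hc x hx).1, dig_lt hb c x, (hc x hx).2.1⟩,
      fun x y hxy hy he => (hc y hy).2.2 x (hxy.le.trans hy) hxy he⟩
  · rintro ⟨f, hf, hf'⟩
    have hlt : ∀ x < m + 1, f ⬝ x < b := fun x hx => (hf x ((lt_add_one_iff' _ _).1 hx)).2.1
    have hd : ∀ x ≤ m, dig b (code b f (m + 1)) x = f ⬝ x := fun x hx =>
      dig_code hlt ((lt_add_one_iff' _ _).2 hx)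
    refine ⟨code b f (m + 1), (code_lt hlt _ le_rfl).le, fun x hx => ?_⟩
    rw [hd x hx]
    refine ⟨(hf x hx).1, (hf x hx).2.2, fun y hy hyx he => ?_⟩
    rw [hd y hy]
    exact hf' y x hyx hx he

theorem dig_zero {b : M.N} (hb : 0 < b) (x : M.N) : dig b 0 x = 0 := dig_of_lt hb (pow_pos' hb x)

/-- The code `0` has only zero digits and prescribes nothing; positive digits and colors differ by a
shift by one. -/
theorem ext_zero_iff (k : M.N) (e : M.F) (m : M.N) : Ext (k + 1) e 0 m ↔ Col k e m := by
  constructor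
  · rintro ⟨f, hf, hf'⟩
    obtain ⟨g, hg⟩ := Rep.pred (Rep.app_id f)
    have hp : ∀ x ≤ m, f ⬝ x = g ⬝ x + 1 := fun x hx => by
      obtain ⟨y, hy⟩ := (zero_or_add_one (f ⬝ x)).resolve_left (hf x hx).1
      rw [hg x]
      change _ = M.pred (f ⬝ x) + 1
      rw [hy, add_one_eq, pred_succ, add_one_eq]
    refine ⟨g, fun x hx => ?_, fun x y hxy hy he h => hf' x y hxy hy he ?_⟩
    · have := (hf x hx).2.1
      rwa [hp x hx, add_lt_add_iff_right] at this
    · rw [hp x (hxy.le.trans hy), hp y hy, h]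
  · rintro ⟨f, hf, hf'⟩
    obtain ⟨g, hg⟩ := Rep.add (Rep.app_id f) (.const 1)
    refine ⟨g, fun x hx => ?_, fun x y hxy hy he h => hf' x y hxy hy he ?_⟩
    · rw [hg]
      refine ⟨add_one_ne_zero' _, add_lt_add_left (hf x hx) 1, fun h => absurd (dig_zero ?_ x) h⟩
      exact zero_lt_add_one k
    · rw [hg, hg] at h
      exact add_right_cancel h

/-! ### Cliques -/

/-- The pigeonhole principle for `k + 1` pairwise adjacent vertices, by induction on the possibly
nonstandard `k`. The induction is admissible because `extTerm` decides colorability uniformly in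
`k`. -/
theorem not_col_complete {e : M.F} (he : ∀ n, e ⬝ n ≠ 0) (k : M.N) : ¬ Col k e k := by
  refine Dec.ind (P := fun k => ¬ Col k e k) ?_ ?_ ?_ k
  · refine (Dec.not (Rep.dec_eq_zero (f := fun k => M.den extTerm ⬝ (k + 1) ⬝ e ⬝ 0 ⬝ k)
      ((((Rep.const _).app (.add .id (.const _))).app (.const _)).app (.const _) |>.app .id))).congr
      fun k => ?_
    rw [den_extTerm (zero_lt_add_one k), ext_zero_iff]
  · rintro ⟨f, hf, -⟩
    exact not_lt.2 (zero_le' _) (hf 0 le_rfl)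
  · rintro k ih ⟨f, hf, hf'⟩
    -- A vertex of color `k` receives the color of the last vertex `k + 1`, which no other vertex
    -- has. This frees the color `k` on the remaining vertices.
    obtain ⟨g, hg⟩ := Rep.ifz (.add (.sub (.app_id f) (.const k)) (.sub (.const k) (.app_id f)))
      (.const (f ⬝ (k + 1))) (.app_id f)
    simp only [ifz_eq_if, eq_zero_iff_sub] at hg
    have hne : ∀ x ≤ k, f ⬝ x ≠ f ⬝ (k + 1) := fun x hx =>
      hf' x _ ((lt_add_one_iff' _ _).2 hx) le_rfl (he _)
    have hle : ∀ x ≤ k + 1, f ⬝ x ≠ k → f ⬝ x < k := fun x hx h =>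
      lt_of_le_of_ne ((lt_add_one_iff' _ _).1 (hf x hx)) h
    refine ih ⟨g, fun x hx => ?_, fun x y hxy hy _ => ?_⟩
    · rw [hg]
      split_ifs with h
      · exact hle _ le_rfl fun h' => hne x hx (by rw [h, h'])
      · exact hle x (hx.trans le_self_add) h
    · have hxy' := hf' x y hxy (hy.trans le_self_add) (he _)
      rw [hg, hg]
      split_ifs with h₁ h₂ h₂
      · exact absurd (h₁.trans h₂.symm) hxy'
      · exact (hne y hy).symm
      · exact hne x (hxy.le.trans hy)
      · exact hxy'

theorem no_clique_coloring {k s : M.N} {e f : M.F} (hf : ∀ x ≤ s + k, f ⬝ x < k)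
    (hf' : ∀ x y, x < y → y ≤ s + k → Edge e x y → f ⬝ x ≠ f ⬝ y)
    (hs : ∀ x y, s ≤ x → x < y → Edge e x y) : False := by
  obtain ⟨g, hg⟩ := Rep.app (.const f) (.add (.const s) .id)
  -- The clique, shifted to start at `0`, is compared with the complete graph given by the constant
  -- `1`.
  refine not_col_complete (e := M.K ⬝ (1 : M.N)) (fun n => by rw [M.K_app]; exact one_ne_zero') k
    ⟨g, fun x hx => ?_, fun x y hxy hy _ => ?_⟩
  · rw [hg]; exact hf _ (by gcongr)
  · rw [hg, hg]
    exact hf' _ _ (by gcongr) (by gcongr) (hs _ _ le_self_add (by gcongr))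

end Model

/-! ### The functionals of the reductions -/

/-- For a function `p`, the graph where `a < b` are adjacent iff `p` has a zero below `b`. -/
def graphTerm : Term [] (Ty.arrow Ty.one Ty.one) :=
  Term.lam (Term.lam (Term.nez (Term.bex v0
    (Term.both (Term.app v2 v0) (Term.sub (Term.tri (Term.suc v0)) v1)))))

/-- The solution `n` of `LPO` for `p`, from a total coloring `f` of the graph of `p`. -/
def flagTerm : Term [] (Ty.arrow Ty.one (Ty.arrow Ty.one Ty.nat)) :=
  Term.lam (Term.lam (Term.ifz (Term.app v0 Term.zero) Term.zero
    (Term.suc (Term.least v1 (Term.app v0 Term.zero)))))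

/-- For `k` and a total `k`-coloring `f` with the first flag of the graph of some `p`, the solution
of `LPO` for `p`. -/
def flagTermFirst : Term [] (Ty.arrow Ty.nat (Ty.arrow Ty.one Ty.nat)) :=
  Term.lam (Term.lam (Term.ifz (Term.app v0 Term.zero) Term.zero
    (Term.sub (Term.suc (Term.app v0 Term.zero)) v1)))

/-- For `k` and a graph `e`, the sequence of functions of which the one with the index `i` has a
zero at `m` iff the partial coloring `i` does not extend to `G_m`. -/
def obstructionTerm : Term [] (Ty.arrow Ty.nat (Ty.arrow Ty.one (Ty.arrow Ty.nat Ty.one))) :=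
  Term.lam (Term.lam (Term.lam (Term.lam
    (Term.nez ((((extTerm.cl.app (Term.suc v3)).app v2).app v1).app v0)))))

/-- For the arguments `k, y, s, n`: the least color `j` such that `y` vanishes at the extension of
the partial coloring `s` by the color `j` of the vertex `n`. -/
def colorTerm : Term [] (Ty.arrow Ty.nat (Ty.arrow Ty.one (Ty.arrow Ty.nat Ty.one))) :=
  Term.lam (Term.lam (Term.lam (Term.lam (Term.least (Term.lam (Term.app v3 (Term.add v2
    ((mulTerm.cl.app (Term.suc v0)).app ((powTerm.cl.app (Term.suc v4)).app v1))))) v3))))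

/-- The step of the recursion for the leftmost path of extendible partial colorings. -/
def pathStep : Term [] (Ty.arrow Ty.nat (Ty.arrow Ty.one (Ty.arrow Ty.nat Ty.one))) :=
  Term.lam (Term.lam (Term.lam (Term.lam (Term.add v1
    ((mulTerm.cl.app (Term.suc ((((colorTerm.cl.app v3).app v2).app v1).app v0))).app
      ((powTerm.cl.app (Term.suc v3)).app v0))))))

/-- The coloring of the vertices along the leftmost path. -/
def pathColorTerm : Term [] (Ty.arrow Ty.nat (Ty.arrow Ty.one Ty.one)) :=
  Term.lam (Term.lam (Term.lam ((((colorTerm.cl.app v2).app v1).app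
    (Term.prec v0 Term.zero ((pathStep.cl.app v2).app v1))).app v0)))

/-- The total coloring from a solution `y` of the parallelization of `LPO`. The color of the vertex
`0` is exchanged with `0`. -/
def totalTerm : Term [] (Ty.arrow Ty.nat (Ty.arrow Ty.one Ty.one)) :=
  Term.lam (Term.lam (Term.lam (Term.ifz (Term.app v1 Term.zero)
    (Term.ifz (Term.eqz (((pathColorTerm.cl.app v2).app v1).app v0)
        (((pathColorTerm.cl.app v2).app v1).app Term.zero)) Term.zero
      (Term.ifz (((pathColorTerm.cl.app v2).app v1).app v0)
        (((pathColorTerm.cl.app v2).app v1).app Term.zero)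
        (((pathColorTerm.cl.app v2).app v1).app v0)))
    (Term.pred (Term.app v1 Term.zero)))))

namespace Model

variable {M : Model}

/-- The number `n` is the solution of `LPO` for `p`. -/
def IsLPO (p : M.F) (n : M.N) : Prop :=
  (n = 0 → ∀ t, 0 < p ⬝ t) ∧ (0 < n → p ⬝ M.pred n = 0 ∧ ∀ t < M.pred n, 0 < p ⬝ t)

/-- The function `f` is a `k`-coloring of the graph with the edge set `e`. -/
def IsCol (k : M.N) (e f : M.F) : Prop :=
  (∀ x, f ⬝ x < k) ∧ ∀ x y, x < y → Edge e x y → f ⬝ x ≠ f ⬝ y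

variable [M.Arith]

theorem pos_iff_ne (x : M.N) : 0 < x ↔ x ≠ 0 := pos_iff_ne_zero

/-! ### `LPO` from total colorings -/

theorem eval_tri {Γ : Ctx} (ρ : Env M Γ) (t : Term Γ Ty.nat) :
    t.tri.eval ρ = M.tri (t.eval ρ) := rfl

theorem tri_le_tri_add (x z : M.N) : M.tri x ≤ M.tri (x + z) := by
  refine Dec.ind (P := fun z => M.tri x ≤ M.tri (x + z))
    (Rep.dec_le (.const _) ((((Rep.const M.R).app (.add (.const _) .id)).app (.const _)).app
      (.const _))) ?_ ?_ z
  · rw [add_zero]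
  · intro z hz
    rw [← add_assoc, tri_add_one]
    exact hz.trans le_self_add

theorem tri_mono {x y : M.N} (h : x ≤ y) : M.tri x ≤ M.tri y := by
  obtain ⟨z, rfl⟩ := (le_iff_exists _ _).1 h
  exact tri_le_tri_add x z

/-- For `a < b` the code of the pair lies between `tri b` and `tri (b + 1) - 1`, so comparing it
with `tri (s + 1)` decides `s < b` without decoding the pair. The search bound loses nothing,
because `s ≤ tri (s + 1)`. -/
theorem edge_graph (p : M.F) {a b : M.N} (hab : a < b) :
    Edge (M.den graphTerm ⬝ p) a b ↔ ∃ s < b, p ⬝ s = 0 := by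
  have h : Edge (M.den graphTerm ⬝ p) a b ↔
      ∃ s ≤ M.tri b + a, p ⬝ s = 0 ∧ M.tri (s + 1) ≤ M.tri b + a := by
    have h' : ∀ n, M.den graphTerm ⬝ p ⬝ n = 0 ↔
        ¬ ∃ s ≤ n, p ⬝ s = 0 ∧ M.tri (s + 1) ≤ n := fun n => by
      change graphTerm.eval Env.nil ⬝ p ⬝ n = 0 ↔ _
      simp [graphTerm, eval_tri, ← le_def]
    rw [Edge, ne_eq, h', not_not]
  rw [h]
  constructor
  · rintro ⟨s, -, hs, hle⟩
    refine ⟨s, ?_, hs⟩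
    by_contra hsb
    have h₁ : M.tri (b + 1) ≤ M.tri (s + 1) := tri_mono (by gcongr; exact not_lt.1 hsb)
    rw [tri_add_one b] at h₁
    exact not_lt.2 (h₁.trans hle) (by gcongr)
  · rintro ⟨s, hsb, hs⟩
    have h₁ : M.tri (s + 1) ≤ M.tri b + a :=
      (tri_mono ((lt_iff_add_one_le _ _).1 hsb)).trans le_self_add
    refine ⟨s, le_trans ?_ h₁, hs, h₁⟩
    rw [tri_add_one]
    exact le_add_self

/-- The vertices `s, …, s + k` form a clique: the larger of any two lies above the zero `s`. -/
theorem no_coloring_of_zero {k s : M.N} {p f : M.F} (hs : p ⬝ s = 0)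
    (hf : ∀ x ≤ s + k, f ⬝ x < k) (hf' : ∀ x y, x < y → y ≤ s + k →
      Edge (M.den graphTerm ⬝ p) x y → f ⬝ x ≠ f ⬝ y) : False :=
  no_clique_coloring hf hf' fun x y hsx hxy => (edge_graph p hxy).2 ⟨s, hsx.trans_lt hxy, hs⟩

theorem IsCol.pos_of_graph {k : M.N} {p f : M.F} (h : IsCol k (M.den graphTerm ⬝ p) f) (t : M.N) :
    0 < p ⬝ t := by
  rw [pos_iff_ne]
  exact fun ht => no_coloring_of_zero ht (fun x _ => h.1 x) fun _ _ hxy _ => h.2 _ _ hxy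

/-- Without a zero of `p` up to `m` the graph `G_m` has no edges, and a constant coloring works. -/
theorem exists_zero_of_not_col {k m : M.N} {p : M.F} (hk : 0 < k)
    (h : ¬ Col k (M.den graphTerm ⬝ p) m) : ∃ s ≤ m, p ⬝ s = 0 := by
  by_contra hcon
  push Not at hcon
  refine h ⟨M.K ⬝ (0 : M.N), fun x _ => by rwa [M.K_app], fun x y hxy hy he => ?_⟩
  obtain ⟨s, hs, h0⟩ := (edge_graph p hxy).1 he
  exact absurd h0 (hcon s (hs.le.trans hy))

theorem den_flagTerm (p f : M.F) :
    M.den flagTerm ⬝ p ⬝ f = if f ⬝ 0 = 0 then 0 else least p (f ⬝ 0) + 1 := by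
  change flagTerm.eval Env.nil ⬝ p ⬝ f = _
  simp [flagTerm, ifz_eq_if]

theorem den_flagTermFirst (k : M.N) (f : M.F) :
    M.den flagTermFirst ⬝ k ⬝ f = if f ⬝ 0 = 0 then 0 else f ⬝ 0 + 1 - k := by
  change flagTermFirst.eval Env.nil ⬝ k ⬝ f = _
  simp [flagTermFirst, ifz_eq_if]

theorem isLPO_zero {p : M.F} (h : ∀ t, 0 < p ⬝ t) : IsLPO p 0 :=
  ⟨fun _ => h, fun h => absurd h (lt_irrefl _)⟩

theorem pred_add_one (x : M.N) : M.pred (x + 1) = x := by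
  rw [add_one_eq, pred_succ]

theorem isLPO_add_one {p : M.F} {s : M.N} (h₀ : p ⬝ s = 0) (h : ∀ t < s, p ⬝ t ≠ 0) :
    IsLPO p (s + 1) := by
  refine ⟨fun h => absurd h (add_one_ne_zero' s), fun _ => ?_⟩
  rw [pred_add_one]
  exact ⟨h₀, fun t ht => (pos_iff_ne _).2 (h t ht)⟩

theorem isLPO_flag {k : M.N} {p f : M.F} (hk : 0 < k)
    (h₀ : f ⬝ 0 = 0 → IsCol k (M.den graphTerm ⬝ p) f)
    (h₁ : 0 < f ⬝ 0 → ¬ Col k (M.den graphTerm ⬝ p) (f ⬝ 0)) :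
    IsLPO p (M.den flagTerm ⬝ p ⬝ f) := by
  rw [den_flagTerm]
  split_ifs with h
  · exact isLPO_zero (h₀ h).pos_of_graph
  · obtain ⟨s, hs, hz⟩ := exists_zero_of_not_col hk (h₁ ((pos_iff_ne _).2 h))
    exact isLPO_add_one (least_spec hs hz) (ne_of_lt_least p _)

theorem isLPO_flagFirst {k : M.N} {p f : M.F} (hk : 0 < k)
    (h₀ : f ⬝ 0 = 0 → IsCol k (M.den graphTerm ⬝ p) f)
    (h₁ : 0 < f ⬝ 0 → ¬ Col k (M.den graphTerm ⬝ p) (f ⬝ 0) ∧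
      ∀ t < f ⬝ 0, Col k (M.den graphTerm ⬝ p) t) :
    IsLPO p (M.den flagTermFirst ⬝ k ⬝ f) := by
  rw [den_flagTermFirst]
  split_ifs with h
  · exact isLPO_zero (h₀ h).pos_of_graph
  obtain ⟨h₂, h₃⟩ := h₁ ((pos_iff_ne _).2 h)
  obtain ⟨n, -, hn⟩ := exists_zero_of_not_col hk h₂
  obtain ⟨s, -, hs, hmin⟩ := exists_least hn
  -- Otherwise `G_{s+k}`, which contains a clique of `k + 1` vertices, would be among the colorable
  -- ones.
  have hle : f ⬝ 0 ≤ s + k := by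
    by_contra hlt
    obtain ⟨g, hg, hg'⟩ := h₃ _ (not_le.1 hlt)
    exact no_coloring_of_zero hs hg hg'
  -- Below `s + k` the truncated difference `x - s` is a coloring: it is less than `k`, and the
  -- upper endpoint of an edge lies above the first zero `s`, where the difference is positive and
  -- strictly increasing.
  have hge : ¬ f ⬝ 0 < s + k := by
    intro hlt
    obtain ⟨g, hg⟩ := Rep.sub (M := M) .id (.const s)
    refine h₂ ⟨g, fun x hx => ?_, fun x y hxy hy he h' => ?_⟩
    · rw [hg]
      change x - s < k
      rcases le_total s x with hsx | hsx
      · rw [tsub_lt_iff_left hsx]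
        exact hx.trans_lt hlt
      · rwa [tsub_eq_zero_of_le hsx]
    · obtain ⟨t, hty, ht⟩ := (edge_graph p hxy).1 he
      have hsy : s < y := (not_lt.1 fun h => hmin t h ht).trans_lt hty
      have h'' : x - s = y - s := (hg x).symm.trans (h'.trans (hg y))
      have : x - s < y - s := by
        rcases le_total s x with hsx | hsx
        · exact tsub_lt_tsub_right_of_le hsx hxy
        · rw [tsub_eq_zero_of_le hsx]
          exact tsub_pos_of_lt hsy
      exact this.ne h''
  -- With `f 0 = s + k` the functional returns `s + k + 1 - k = s + 1`, the `LPO` solution for a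
  -- first zero at `s`.
  rw [le_antisymm hle (not_lt.1 hge), add_right_comm, add_tsub_cancel_right]
  exact isLPO_add_one hs hmin

/-! ### Total colorings from the parallelization of `LPO` -/

theorem den_obstructionTerm (k : M.N) (e : M.F) (i m : M.N) :
    M.den obstructionTerm ⬝ k ⬝ e ⬝ i ⬝ m = 0 ↔ ¬ Ext (k + 1) e i m := by
  rw [← den_extTerm (zero_lt_add_one k)]
  change obstructionTerm.eval Env.nil ⬝ k ⬝ e ⬝ i ⬝ m = 0 ↔ _
  simp [obstructionTerm]

/-- The color chosen for the vertex `n` along the leftmost path at the partial coloring `s`. -/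
def color (k : M.N) (y : M.F) (s n : M.N) : M.N := M.den colorTerm ⬝ k ⬝ y ⬝ s ⬝ n

/-- The leftmost path of extendible partial colorings. -/
def path (k : M.N) (y : M.F) (n : M.N) : M.N := M.R ⬝ n ⬝ 0 ⬝ (M.den pathStep ⬝ k ⬝ y)

theorem color_spec {k : M.N} {y : M.F} {s n j : M.N} (hj : j < k)
    (h : y ⬝ (s + (j + 1) * pow (k + 1) n) = 0) :
    color k y s n < k ∧ y ⬝ (s + (color k y s n + 1) * pow (k + 1) n) = 0 := by
  have hc : ∃ g : M.F, (∀ j, g ⬝ j = y ⬝ (s + (j + 1) * pow (k + 1) n)) ∧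
      color k y s n = least g k := by
    refine ⟨_, fun j => ?_, by
      change colorTerm.eval Env.nil ⬝ k ⬝ y ⬝ s ⬝ n = _
      simp only [colorTerm, eval_lam, eval_least, eval_var, Env.cons_zero, Env.cons_succ]
      rfl⟩
    simp [pow, den_mul]
  obtain ⟨g, hg, hc⟩ := hc
  rw [← hg] at h
  rw [hc, ← hg]
  exact ⟨(least_min h).trans_lt hj, least_spec hj.le h⟩

theorem path_zero (k : M.N) (y : M.F) : path k y 0 = 0 := R_zero' _ _

theorem path_add_one (k : M.N) (y : M.F) (n : M.N) :
    path k y (n + 1) = path k y n + (color k y (path k y n) n + 1) * pow (k + 1) n := by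
  have h : ∀ r i, M.den pathStep ⬝ k ⬝ y ⬝ r ⬝ i =
      r + (color k y r i + 1) * pow (k + 1) i := fun r i => by
    change pathStep.eval Env.nil ⬝ k ⬝ y ⬝ r ⬝ i = _
    simp [pathStep, den_mul, pow, color]
  rw [path, R_add_one, h]; rfl

theorem den_pathColorTerm (k : M.N) (y : M.F) (n : M.N) :
    M.den pathColorTerm ⬝ k ⬝ y ⬝ n = color k y (path k y n) n := by
  change pathColorTerm.eval Env.nil ⬝ k ⬝ y ⬝ n = _
  simp [pathColorTerm, color, path]

theorem Rep.path_id (k : M.N) (y : M.F) : Rep (fun n => path k y n) :=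
  (((Rep.const M.R).app .id).app (.const _)).app (.const _)

/-- The step of Kőnig's lemma. If every color of the vertex `n` were obstructed at some stage, a
common bound for these stages would give a graph `G_m` to which `s` still extends; the color that
this extension gives to `n` contradicts its own obstruction. -/
theorem exists_extension {k : M.N} {e y : M.F}
    (hy : ∀ i, IsLPO (M.den obstructionTerm ⬝ k ⬝ e ⬝ i) (y ⬝ i)) {s n : M.N}
    (hs : y ⬝ s = 0) (hlt : s < pow (k + 1) n) :
    ∃ j < k, y ⬝ (s + (j + 1) * pow (k + 1) n) = 0 := by
  by_contra hcon
  push Not at hcon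
  -- The value `g j` is the first stage that obstructs the color `j`: a positive `LPO` solution
  -- minus one.
  obtain ⟨g, hg⟩ := Rep.pred (.app (.const y) (.add (.const s) (.mul (.add .id (.const 1))
    (.const (pow (k + 1) n)))))
  obtain ⟨B, hB⟩ := exists_bound g k
  -- Adding `n` ensures that the vertex `n` belongs to the graph.
  have hext : Ext (k + 1) e s (B + n) := by
    have := (hy s).1 hs (B + n)
    rw [pos_iff_ne, ne_eq, den_obstructionTerm, not_not] at this
    exact this
  obtain ⟨f, hf, hf'⟩ := hext
  obtain ⟨h₁, h₂, -⟩ := hf n le_add_self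
  obtain ⟨j, hj⟩ := (zero_or_add_one (f ⬝ n)).resolve_left h₁
  rw [hj, add_lt_add_iff_right] at h₂
  have h₃ := ((hy _).2 ((pos_iff_ne _).2 (hcon j h₂))).1
  rw [den_obstructionTerm] at h₃
  have hgj : M.pred (y ⬝ (s + (j + 1) * pow (k + 1) n)) ≤ B + n := by
    have := hB j h₂
    rw [hg] at this
    exact le_add_right this
  refine h₃ ⟨f, fun x hx => ?_, fun a b hab hb => hf' a b hab (hb.trans hgj)⟩
  obtain ⟨h₄, h₅, h₆⟩ := hf x (hx.trans hgj)
  have hjk : j + 1 < k + 1 := by rwa [add_lt_add_iff_right]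
  refine ⟨h₄, h₅, fun h₇ => ?_⟩
  rcases lt_trichotomy x n with hxn | rfl | hxn
  · rw [dig_add_mul_pow (zero_lt_add_one k) hxn] at h₇ ⊢
    exact h₆ h₇
  · rw [dig_add_mul_pow_self hjk hlt, hj]
  -- Beyond the position `n` the enlarged code has only zero digits and prescribes no color.
  · refine absurd (dig_of_lt (zero_lt_add_one k) ?_) h₇
    obtain ⟨z, rfl⟩ := (le_iff_exists _ _).1 ((lt_iff_add_one_le _ _).1 hxn)
    refine (add_mul_pow_lt hjk hlt).trans_le ?_
    rw [pow_add' _ (n + 1) z]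
    refine le_mul_of_one_le_right (pow_pos' (zero_lt_add_one k) _).le ?_
    have := pow_pos' (zero_lt_add_one k) z
    rwa [lt_iff_add_one_le, zero_add] at this

/-- The size bound says that the code colors only vertices below `n`; it is carried along because
`exists_extension` needs the digit at `n` to be free. -/
theorem path_spec {k : M.N} {e y : M.F}
    (hy : ∀ i, IsLPO (M.den obstructionTerm ⬝ k ⬝ e ⬝ i) (y ⬝ i)) (h₀ : y ⬝ 0 = 0) (n : M.N) :
    path k y n < pow (k + 1) n ∧ y ⬝ path k y n = 0 := by
  refine Dec.ind (P := fun n => path k y n < pow (k + 1) n ∧ y ⬝ path k y n = 0)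
    ((Rep.dec_lt (.path_id k y) (.pow_id _)).and
      (Rep.dec_eq_zero (.app (.const y) (.path_id k y)))) ?_ ?_ n
  · rw [path_zero]
    exact ⟨pow_pos' (zero_lt_add_one k) 0, h₀⟩
  · rintro n ⟨h₁, h₂⟩
    obtain ⟨j, hj, h⟩ := exists_extension hy h₂ h₁
    obtain ⟨h₃, h₄⟩ := color_spec hj h
    rw [path_add_one]
    exact ⟨add_mul_pow_lt (by rwa [add_lt_add_iff_right]) h₁, h₄⟩

theorem color_path_lt {k : M.N} {e y : M.F}
    (hy : ∀ i, IsLPO (M.den obstructionTerm ⬝ k ⬝ e ⬝ i) (y ⬝ i)) (h₀ : y ⬝ 0 = 0) (n : M.N) :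
    color k y (path k y n) n < k := by
  obtain ⟨h₁, h₂⟩ := path_spec hy h₀ n
  obtain ⟨j, hj, h⟩ := exists_extension hy h₂ h₁
  exact (color_spec hj h).1

theorem dig_path {k : M.N} {e y : M.F}
    (hy : ∀ i, IsLPO (M.den obstructionTerm ⬝ k ⬝ e ⬝ i) (y ⬝ i)) (h₀ : y ⬝ 0 = 0) (x n : M.N) :
    x < n → dig (k + 1) (path k y n) x = color k y (path k y x) x + 1 := by
  refine Dec.ind (P := fun n => x < n →
      dig (k + 1) (path k y n) x = color k y (path k y x) x + 1)
    ((Rep.dec_lt (.const _) .id).imp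
      (Rep.dec_eq (.dig (.const _) (.path_id k y) (.const _)) (.const _))) ?_ ?_ n
  · exact fun h => absurd h (not_lt.2 (zero_le' _))
  · intro n ih hx
    rw [path_add_one]
    rcases ((lt_add_one_iff' _ _).1 hx).lt_or_eq with h | rfl
    · rw [dig_add_mul_pow (zero_lt_add_one k) h, ih h]
    · refine dig_add_mul_pow_self ?_ (path_spec hy h₀ x).1
      rw [add_lt_add_iff_right]
      exact color_path_lt hy h₀ x

theorem isCol_path {k : M.N} {e y : M.F}
    (hy : ∀ i, IsLPO (M.den obstructionTerm ⬝ k ⬝ e ⬝ i) (y ⬝ i)) (h₀ : y ⬝ 0 = 0) :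
    IsCol k e (M.den pathColorTerm ⬝ k ⬝ y) := by
  refine ⟨fun x => by rw [den_pathColorTerm]; exact color_path_lt hy h₀ x, fun a b hab he h => ?_⟩
  -- An edge `a < b` is tested in `G_b`: the path of length `b + 1` extends to a coloring of it,
  -- which must agree with the path at both endpoints.
  have hext := (hy (path k y (b + 1))).1 (path_spec hy h₀ _).2 b
  rw [pos_iff_ne, ne_eq, den_obstructionTerm, not_not] at hext
  obtain ⟨f, hf, hf'⟩ := hext
  have key : ∀ x ≤ b, f ⬝ x = color k y (path k y x) x + 1 := fun x hx => by
    have hd := dig_path hy h₀ x (b + 1) ((lt_add_one_iff' _ _).2 hx)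
    rw [(hf x hx).2.2 (by rw [hd]; exact add_one_ne_zero' _), hd]
  rw [den_pathColorTerm, den_pathColorTerm] at h
  exact hf' a b hab le_rfl he (by rw [key a hab.le, key b le_rfl, h])

theorem den_totalTerm (k : M.N) (y : M.F) (x : M.N) :
    M.den totalTerm ⬝ k ⬝ y ⬝ x = if y ⬝ 0 = 0 then
      if M.den pathColorTerm ⬝ k ⬝ y ⬝ x = M.den pathColorTerm ⬝ k ⬝ y ⬝ 0 then 0
      else if M.den pathColorTerm ⬝ k ⬝ y ⬝ x = 0 then M.den pathColorTerm ⬝ k ⬝ y ⬝ 0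
      else M.den pathColorTerm ⬝ k ⬝ y ⬝ x
    else M.pred (y ⬝ 0) := by
  change totalTerm.eval Env.nil ⬝ k ⬝ y ⬝ x = _
  simp only [totalTerm, eval_lam, eval_ifz, ifz_eq_if, eval_eqz]
  simp
  rfl

/-- Transposing the colors `c 0` and `0` preserves properness and makes the value at vertex `0`
zero, as required when a coloring is reported. -/
theorem swap_spec {k : M.N} {e c f : M.F} (hk : 0 < k) (hc : IsCol k e c)
    (hf : ∀ x, f ⬝ x = if c ⬝ x = c ⬝ 0 then 0 else if c ⬝ x = 0 then c ⬝ 0 else c ⬝ x) :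
    (f ⬝ 0 = 0 → IsCol k e f) ∧
      (0 < f ⬝ 0 → ¬ Col k e (f ⬝ 0) ∧ ∀ t < f ⬝ 0, Col k e t) := by
  have h₀ : f ⬝ 0 = 0 := by rw [hf, if_pos rfl]
  refine ⟨fun _ => ⟨fun x => ?_, fun a b hab he h => ?_⟩, fun hp => absurd h₀ hp.ne'⟩
  · rw [hf]
    split_ifs
    exacts [hk, hc.1 0, hc.1 x]
  · have hne := hc.2 a b hab he
    rw [hf a, hf b] at h
    generalize c ⬝ a = ca at *
    generalize c ⬝ b = cb at *
    generalize c ⬝ 0 = c0 at *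
    clear hf h₀
    split_ifs at h <;> simp_all

/-- Soundness of `totalTerm`. -/
theorem total_spec {k : M.N} {e y : M.F} (hk : 0 < k)
    (hy : ∀ i, IsLPO (M.den obstructionTerm ⬝ k ⬝ e ⬝ i) (y ⬝ i)) :
    (M.den totalTerm ⬝ k ⬝ y ⬝ 0 = 0 → IsCol k e (M.den totalTerm ⬝ k ⬝ y)) ∧
    (0 < M.den totalTerm ⬝ k ⬝ y ⬝ 0 → ¬ Col k e (M.den totalTerm ⬝ k ⬝ y ⬝ 0) ∧
      ∀ t < M.den totalTerm ⬝ k ⬝ y ⬝ 0, Col k e t) := by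
  have hT := den_totalTerm k y
  generalize M.den totalTerm ⬝ k ⬝ y = T at hT ⊢
  by_cases h₀ : y ⬝ 0 = 0
  · simp only [if_pos h₀] at hT
    exact swap_spec hk (isCol_path hy h₀) hT
  -- Here the empty partial coloring is first obstructed at stage `n`, and the output is the
  -- constant function `n`.
  · obtain ⟨n, hn⟩ := (zero_or_add_one (y ⬝ 0)).resolve_left h₀
    have h : ∀ x, T ⬝ x = n := fun x => by
      rw [hT, if_neg h₀, hn, pred_add_one]
    obtain ⟨h₁, h₂⟩ := (hy 0).2 ((pos_iff_ne _).2 h₀)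
    rw [hn, pred_add_one] at h₁ h₂
    rw [den_obstructionTerm, ext_zero_iff] at h₁
    have h₃ : ∀ t < n, Col k e t := fun t ht => by
      have := h₂ t ht
      rwa [pos_iff_ne, ne_eq, den_obstructionTerm, not_not, ext_zero_iff] at this
    simp only [h]
    -- The flag cannot be `0`, because the one-vertex graph `G_0` is colorable when `k > 0`.
    refine ⟨fun hn0 => absurd ?_ h₁, fun _ => ⟨h₁, h₃⟩⟩
    rw [hn0]
    refine ⟨M.K ⬝ (0 : M.N), fun x _ => by rwa [M.K_app], fun a b hab hb _ => ?_⟩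
    exact absurd (hab.trans_le hb) (not_lt.2 (zero_le' a))

end Model

/-! ### Colorability is decidable -/

/-- For the arguments `k, e, m`: a `k`-coloring of `G_m` if there is one. -/
def witnessTerm : Term [] (Ty.arrow Ty.nat (Ty.arrow Ty.one (Ty.arrow Ty.nat Ty.one))) :=
  Term.lam (Term.lam (Term.lam (Term.lam (Term.pred (Term.dig (Term.suc v3)
    (Term.least ((((goodTerm.cl.app (Term.suc v3)).app v2).app Term.zero).app v1)
      ((powTerm.cl.app (Term.suc v3)).app (Term.suc v1))) v0)))))

/-- The quantifier-free statement that `G_m` has a `k`-coloring. -/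
def colorableQF {Γ : Ctx} (k : Term Γ Ty.nat) (e : Term Γ Ty.one) (m : Term Γ Ty.nat) :
    Formula Γ :=
  Formula.eq ((((extTerm.cl.app k.suc).app e).app Term.zero).app m) Term.zero

/-- The `k`-coloring of `G_m` found by bounded search. -/
def witness {Γ : Ctx} (k : Term Γ Ty.nat) (e : Term Γ Ty.one) (m : Term Γ Ty.nat) :
    Term Γ Ty.one :=
  ((witnessTerm.cl.app k).app e).app m

namespace Formula

open Model

variable {M : Model} {Γ Δ : Ctx}

theorem sat_le (ρ : Env M Γ) (s t : Term Γ Ty.nat) :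
    (Formula.le s t).sat ρ ↔ s.eval ρ ≤ t.eval ρ := Iff.rfl

theorem sat_lt (ρ : Env M Γ) (s t : Term Γ Ty.nat) :
    (Formula.lt s t).sat ρ ↔ s.eval ρ < t.eval ρ := Iff.rfl

theorem sat_edge (ρ : Env M Γ) (e : Term Γ Ty.one) (a b : Term Γ Ty.nat) :
    (edge e a b).sat ρ ↔ Edge (e.eval ρ) (a.eval ρ) (b.eval ρ) := Iff.rfl

theorem sat_isColoring (ρ : Env M Γ) (k : Term Γ Ty.nat) (e f : Term Γ Ty.one) :
    (isColoring k e f).sat ρ ↔ IsCol (k.eval ρ) (e.eval ρ) (f.eval ρ) := by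
  simp only [isColoring, Formula.sat, sat_lt, sat_edge, Formula.neg, Term.eval_wk, eval_app,
    eval_var, Env.cons_zero, Env.cons_succ]
  rfl

theorem sat_isColoringUpTo (ρ : Env M Γ) (k : Term Γ Ty.nat) (e : Term Γ Ty.one)
    (m : Term Γ Ty.nat) (f : Term Γ Ty.one) :
    (isColoringUpTo k e m f).sat ρ ↔ (∀ x ≤ m.eval ρ, f.eval ρ ⬝ x < k.eval ρ) ∧
      ∀ x y, x < y → y ≤ m.eval ρ → Edge (e.eval ρ) x y → f.eval ρ ⬝ x ≠ f.eval ρ ⬝ y := by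
  simp only [isColoringUpTo, Formula.sat, sat_lt, sat_le, sat_edge, Formula.neg, Term.eval_wk,
    eval_app, eval_var, Env.cons_zero, Env.cons_succ]

theorem sat_colorable (ρ : Env M Γ) (k : Term Γ Ty.nat) (e : Term Γ Ty.one) (m : Term Γ Ty.nat) :
    (colorable k e m).sat ρ ↔ Col (k.eval ρ) (e.eval ρ) (m.eval ρ) := by
  simp only [colorable, Formula.sat, sat_isColoringUpTo, Term.eval_wk, eval_var, Env.cons_zero]
  rfl

theorem sat_colorableQF [M.Arith] (ρ : Env M Γ) (k : Term Γ Ty.nat) (e : Term Γ Ty.one)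
    (m : Term Γ Ty.nat) :
    (colorableQF k e m).sat ρ ↔ Col (k.eval ρ) (e.eval ρ) (m.eval ρ) := by
  rw [← ext_zero_iff, ← den_extTerm (zero_lt_add_one _)]
  simp only [colorableQF, Formula.sat, eval_app, eval_cl, eval_suc, eval_zero]

/-- The least good code within the bound is decoded digit by digit; its digits up to `m` are
positive, so subtracting one gives colors below `k`. -/
theorem sat_witness [M.Arith] (ρ : Env M Γ) (k : Term Γ Ty.nat) (e : Term Γ Ty.one)
    (m : Term Γ Ty.nat) (h : (colorableQF k e m).sat ρ) :
    (isColoringUpTo k e m (witness k e m)).sat ρ := by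
  rw [sat_isColoringUpTo]
  simp only [colorableQF, Formula.sat, eval_app, eval_cl, eval_suc, eval_zero] at h
  simp only [witness, eval_app, eval_cl]
  generalize k.eval ρ = k, e.eval ρ = e, m.eval ρ = m at h ⊢
  have hc : M.den goodTerm ⬝ (k + 1) ⬝ e ⬝ 0 ⬝ m ⬝
      least (M.den goodTerm ⬝ (k + 1) ⬝ e ⬝ 0 ⬝ m) (pow (k + 1) (m + 1)) = 0 := by
    have h' : ∃ c ≤ pow (k + 1) (m + 1), M.den goodTerm ⬝ (k + 1) ⬝ e ⬝ 0 ⬝ m ⬝ c = 0 := by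
      change extTerm.eval Env.nil ⬝ (k + 1) ⬝ e ⬝ 0 ⬝ m = 0 at h
      simpa [extTerm, pow] using h
    obtain ⟨c, hc, h0⟩ := h'
    exact least_spec hc h0
  have hw : ∀ x, M.den witnessTerm ⬝ k ⬝ e ⬝ m ⬝ x = M.pred (dig (k + 1)
      (least (M.den goodTerm ⬝ (k + 1) ⬝ e ⬝ 0 ⬝ m) (pow (k + 1) (m + 1))) x) := fun x => by
    change witnessTerm.eval Env.nil ⬝ k ⬝ e ⬝ m ⬝ x = _
    have hp : ∀ (ρ : Env M [Ty.nat, Ty.nat, Ty.one, Ty.nat]) t,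
      (Term.pred t).eval ρ = M.pred (t.eval ρ) := fun _ _ => rfl
    simp [witnessTerm, hp, pow]
  generalize least (M.den goodTerm ⬝ (k + 1) ⬝ e ⬝ 0 ⬝ m) (pow (k + 1) (m + 1)) = c at hc hw
  rw [den_goodTerm] at hc
  have hd : ∀ x ≤ m, dig (k + 1) c x = M.den witnessTerm ⬝ k ⬝ e ⬝ m ⬝ x + 1 := fun x hx => by
    obtain ⟨z, hz⟩ := (zero_or_add_one (dig (k + 1) c x)).resolve_left (hc x hx).1
    rw [hw, hz, pred_add_one]
  refine ⟨fun x hx => ?_, fun x y hxy hy he h' => ?_⟩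
  · have := dig_lt (zero_lt_add_one k) c x
    rwa [hd x hx, add_lt_add_iff_right] at this
  · have hx := hxy.le.trans hy
    exact (hc y hy).2.2 x hx hxy he (by rw [hd x hx, hd y hy, h'])

/-! ### Coloring formulas in the classes `Exact`, `Hyp` and `Goal` -/

theorem exact_lt (s t : Term Γ Ty.nat) : (Formula.lt s t).Exact := exact_eq _ _

theorem exact_le (s t : Term Γ Ty.nat) : (Formula.le s t).Exact := exact_eq _ _

theorem exact_edge (e : Term Γ Ty.one) (a b : Term Γ Ty.nat) : (edge e a b).Exact :=
  Exact.imp (exact_eq _ _) exact_bot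

theorem goal_lt (s t : Term Γ Ty.nat) : (Formula.lt s t).Goal := goal_eq_zero _

theorem hyp_isColoringUpTo (k : Term Γ Ty.nat) (e : Term Γ Ty.one) (m : Term Γ Ty.nat)
    (f : Term Γ Ty.one) : (isColoringUpTo k e m f).Hyp :=
  Hyp.and (Hyp.all (Exact.hyp (Exact.imp (exact_le _ _) (exact_lt _ _))))
    (Hyp.all (Hyp.all (Exact.hyp (Exact.imp (exact_lt _ _) (Exact.imp (exact_le _ _)
      (Exact.imp (exact_edge _ _ _) (Exact.imp (exact_eq _ _) exact_bot)))))))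

theorem goal_isColoringUpTo (k : Term Γ Ty.nat) (e : Term Γ Ty.one) (m : Term Γ Ty.nat)
    (f : Term Γ Ty.one) : (isColoringUpTo k e m f).Goal :=
  Goal.and (Goal.all (Hyp.imp_goal (Exact.hyp (exact_le _ _)) (goal_lt _ _)))
    (Goal.all (Goal.all (Hyp.imp_goal (Exact.hyp (exact_lt _ _))
      (Hyp.imp_goal (Exact.hyp (exact_le _ _)) (Hyp.imp_goal (Exact.hyp (exact_edge _ _ _))
        (Hyp.imp_goal (Exact.hyp (exact_eq _ _)) goal_bot))))))

theorem isColoringUpTo_subst (θ : Subst Γ Δ) (k : Term Γ Ty.nat) (e : Term Γ Ty.one)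
    (m : Term Γ Ty.nat) (f : Term Γ Ty.one) : (isColoringUpTo k e m f).subst θ =
      isColoringUpTo (k.subst θ) (e.subst θ) (m.subst θ) (f.subst θ) := by
  simp only [isColoringUpTo, Formula.subst, Formula.le, Formula.lt, edge, Formula.neg,
    Term.subst_sub, Term.subst_suc, Term.subst, Term.wk_subst_lift, Term.pairCode, Term.subst_add]
  rfl

theorem colorable_subst (θ : Subst Γ Δ) (k : Term Γ Ty.nat) (e : Term Γ Ty.one)
    (m : Term Γ Ty.nat) : (colorable k e m).subst θ =
      colorable (k.subst θ) (e.subst θ) (m.subst θ) := by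
  simp only [colorable, Formula.subst, isColoringUpTo_subst, Term.wk_subst_lift]
  rfl

theorem colorableQF_subst (θ : Subst Γ Δ) (k : Term Γ Ty.nat) (e : Term Γ Ty.one)
    (m : Term Γ Ty.nat) : (colorableQF k e m).subst θ =
      colorableQF (k.subst θ) (e.subst θ) (m.subst θ) := by
  simp only [colorableQF, Formula.subst, Term.subst, Term.subst_suc, Term.subst_cl]

theorem exact_colorableQF (k : Term Γ Ty.nat) (e : Term Γ Ty.one) (m : Term Γ Ty.nat) :
    (colorableQF k e m).Exact := exact_eq _ _

theorem goal_colorableQF (k : Term Γ Ty.nat) (e : Term Γ Ty.one) (m : Term Γ Ty.nat) :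
    (colorableQF k e m).Goal := goal_eq_zero _

/-- Existential elimination turns the coloring into a free variable; what remains is an equation
with zero derived from an assumption in `Hyp`, so truth in models suffices. -/
theorem colorable_imp (H : List (Formula Γ)) (k : Term Γ Ty.nat) (e : Term Γ Ty.one)
    (m : Term Γ Ty.nat) : Proves H ((colorable k e m).imp (colorableQF k e m)) := by
  refine .impI (.exE .head ?_)
  refine Proves.weaken (H := [isColoringUpTo (k.wk _) (e.wk _) (m.wk _) v0]) ?_ (by simp)
  refine Goal.proves (Goal.subst (goal_colorableQF k e m) _)
    (List.forall_mem_cons.2 ⟨hyp_isColoringUpTo _ _ _ _, by simp⟩) fun M _ ρ hρ => ?_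
  obtain ⟨x, ρ', rfl⟩ : ∃ (x : M.F) (ρ' : Env M Γ), ρ = Env.cons x ρ' :=
    ⟨ρ Var.zero, fun _ v => ρ (Var.succ v), by funext τ v; cases v <;> rfl⟩
  refine (sat_wk x ρ' (colorableQF k e m)).2 ((sat_colorableQF ρ' k e m).2 ?_)
  have h := hρ _ List.mem_cons_self
  exact (sat_colorable ρ' k e m).1 ⟨x, h⟩

theorem colorableQF_imp (H : List (Formula Γ)) (k : Term Γ Ty.nat) (e : Term Γ Ty.one)
    (m : Term Γ Ty.nat) : Proves H ((colorableQF k e m).imp (colorable k e m)) := by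
  refine .impI (.exI (witness k e m) ?_)
  have h : (isColoringUpTo (k.wk Ty.one) (e.wk _) (m.wk _) v0).inst (witness k e m) =
      isColoringUpTo k e m (witness k e m) := by
    rw [Formula.inst, isColoringUpTo_subst, Term.wk_subst_cons, Term.wk_subst_cons,
      Term.wk_subst_cons, Term.subst_subst_id, Term.subst_subst_id, Term.subst_subst_id]
    rfl
  rw [h]
  refine Proves.weaken (H := [colorableQF k e m]) ?_ (by simp)
  exact Goal.proves (goal_isColoringUpTo _ _ _ _) (List.forall_mem_cons.2
      ⟨Exact.hyp (exact_colorableQF k e m), by simp⟩)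
    fun M _ ρ hρ => sat_witness ρ k e m (hρ _ List.mem_cons_self)

/-- An existential formula would normally need Henkin witnesses. Here the closed term `witnessTerm`
supplies them, through the provable equivalence with an equation. -/
theorem exact_colorable (k : Term Γ Ty.nat) (e : Term Γ Ty.one) (m : Term Γ Ty.nat) :
    (colorable k e m).Exact := by
  intro Δ θ W hW
  have h : (colorable k e m).subst θ ∈ W ↔ (colorableQF k e m).subst θ ∈ W := by
    rw [colorable_subst, colorableQF_subst]
    exact ⟨hW.mp (hW.mem (colorable_imp _ _ _ _)), hW.mp (hW.mem (colorableQF_imp _ _ _ _))⟩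
  exact h.trans ((exact_colorableQF k e m θ W hW).trans
    ((sat_colorableQF _ k e m).trans (sat_colorable _ k e m).symm))

theorem goal_colorable (k : Term Γ Ty.nat) (e : Term Γ Ty.one) (m : Term Γ Ty.nat) :
    (colorable k e m).Goal := by
  intro Δ θ H hH h
  have h' : Proves H ((colorableQF k e m).subst θ) :=
    goal_colorableQF k e m θ H hH fun M _ ρ hρ =>
      (sat_colorableQF _ k e m).2 ((sat_colorable _ k e m).1 (h M ρ hρ))
  rw [colorable_subst]
  rw [colorableQF_subst] at h'
  exact .impE (colorableQF_imp H _ _ _) h'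

theorem hyp_isColoring (k : Term Γ Ty.nat) (e f : Term Γ Ty.one) : (isColoring k e f).Hyp :=
  Hyp.and (Hyp.all (Exact.hyp (exact_lt _ _)))
    (Hyp.all (Hyp.all (Exact.hyp (Exact.imp (exact_lt _ _) (Exact.imp (exact_edge _ _ _)
      (Exact.imp (exact_eq _ _) exact_bot))))))

theorem goal_isColoring (k : Term Γ Ty.nat) (e f : Term Γ Ty.one) : (isColoring k e f).Goal :=
  Goal.and (Goal.all (goal_lt _ _))
    (Goal.all (Goal.all (Hyp.imp_goal (Exact.hyp (exact_lt _ _))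
      (Hyp.imp_goal (Exact.hyp (exact_edge _ _ _))
        (Hyp.imp_goal (Exact.hyp (exact_eq _ _)) goal_bot)))))

theorem hyp_top : (Formula.top : Formula Γ).Hyp := Exact.hyp (Exact.imp exact_bot exact_bot)

theorem goal_top : (Formula.top : Formula Γ).Goal := Hyp.imp_goal (Exact.hyp exact_bot) goal_bot

end Formula

/-! ### The problems -/

namespace Problem

open Model Formula

variable {Γ : Ctx}

theorem hyp_LPO : (LPO (Γ := Γ)).sol.Hyp :=
  Hyp.and (Exact.imp_hyp (exact_eq _ _) (Hyp.all (Exact.hyp (exact_lt _ _))))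
    (Exact.imp_hyp (exact_lt _ _) (Hyp.and (Exact.hyp (exact_eq _ _))
      (Hyp.all (Exact.hyp (Exact.imp (exact_lt _ _) (exact_lt _ _))))))

theorem goal_LPO : (LPO (Γ := Γ)).sol.Goal :=
  Goal.and (Hyp.imp_goal (Exact.hyp (exact_eq _ _)) (Goal.all (goal_lt _ _)))
    (Hyp.imp_goal (Exact.hyp (exact_lt _ _)) (Goal.and (goal_eq_zero _)
      (Goal.all (Hyp.imp_goal (Exact.hyp (exact_lt _ _)) (goal_lt _ _)))))

theorem hyp_TGC (k : Term Γ Ty.nat) : (TGC k).sol.Hyp :=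
  Hyp.and (Exact.imp_hyp (exact_eq _ _) (hyp_isColoring _ _ _))
    (Exact.imp_hyp (exact_lt _ _) (Exact.hyp (Exact.imp (exact_colorable _ _ _) exact_bot)))

theorem goal_TGC (k : Term Γ Ty.nat) : (TGC k).sol.Goal :=
  Goal.and (Hyp.imp_goal (Exact.hyp (exact_eq _ _)) (goal_isColoring _ _ _))
    (Hyp.imp_goal (Exact.hyp (exact_lt _ _))
      (Hyp.imp_goal (Exact.hyp (exact_colorable _ _ _)) goal_bot))

theorem hyp_TGCfirst (k : Term Γ Ty.nat) : (TGCfirst k).sol.Hyp :=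
  Hyp.and (Exact.imp_hyp (exact_eq _ _) (hyp_isColoring _ _ _))
    (Exact.imp_hyp (exact_lt _ _) (Hyp.and (Exact.hyp (Exact.imp (exact_colorable _ _ _) exact_bot))
      (Hyp.all (Exact.hyp (Exact.imp (exact_lt _ _) (exact_colorable _ _ _))))))

theorem goal_TGCfirst (k : Term Γ Ty.nat) : (TGCfirst k).sol.Goal :=
  Goal.and (Hyp.imp_goal (Exact.hyp (exact_eq _ _)) (goal_isColoring _ _ _))
    (Hyp.imp_goal (Exact.hyp (exact_lt _ _))
      (Goal.and (Hyp.imp_goal (Exact.hyp (exact_colorable _ _ _)) goal_bot)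
        (Goal.all (Hyp.imp_goal (Exact.hyp (exact_lt _ _)) (goal_colorable _ _ _)))))

/-! ### From truth in models to derivations of the reductions -/

variable {M : Model} (ρ : Env M Γ)

theorem sat_TGC (k : Term Γ Ty.nat) (e f : M.F) :
    (TGC k).sol.sat (Env.cons f (Env.cons e ρ)) ↔
      (f ⬝ 0 = 0 → IsCol (k.eval ρ) e f) ∧ (0 < f ⬝ 0 → ¬ Col (k.eval ρ) e (f ⬝ 0)) := by
  simp only [TGC, Formula.sat, sat_lt, Formula.neg, sat_isColoring, sat_colorable, Term.eval_wk,
    eval_app, eval_var, eval_zero, Env.cons_zero, Env.cons_succ]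

theorem sat_TGCfirst (k : Term Γ Ty.nat) (e f : M.F) :
    (TGCfirst k).sol.sat (Env.cons f (Env.cons e ρ)) ↔
      (f ⬝ 0 = 0 → IsCol (k.eval ρ) e f) ∧ (0 < f ⬝ 0 → ¬ Col (k.eval ρ) e (f ⬝ 0) ∧
        ∀ t < f ⬝ 0, Col (k.eval ρ) e t) := by
  simp only [TGCfirst, Formula.sat, sat_lt, Formula.neg, sat_isColoring, sat_colorable,
    Term.eval_wk, eval_app, eval_var, eval_zero, Env.cons_zero, Env.cons_succ]

theorem sat_domAt {Δ : Ctx} (P : Problem Γ) (θ : Subst Γ Δ) (x : Term Δ P.inTy) (ρ : Env M Δ) :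
    (P.domAt θ x).sat ρ ↔ P.dom.sat (Env.cons (x.eval ρ) fun _ v => (θ v).eval ρ) := by
  rw [← Env.eval_cons]
  exact Formula.sat_subst _ _ _

theorem sat_solAt {Δ : Ctx} (P : Problem Γ) (θ : Subst Γ Δ) (x : Term Δ P.inTy)
    (y : Term Δ P.outTy) (ρ : Env M Δ) : (P.solAt θ x y).sat ρ ↔
      P.sol.sat (Env.cons (y.eval ρ) (Env.cons (x.eval ρ) fun _ v => (θ v).eval ρ)) := by
  rw [← Env.eval_cons, ← Env.eval_cons]
  exact Formula.sat_subst _ _ _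

theorem sat_hat_LPO (p : M.C (Ty.arrow Ty.nat Ty.one)) (y : M.F)
    (h : (LPO (Γ := Γ)).hat.sol.sat (Env.cons y (Env.cons p ρ))) (i : M.N) :
    IsLPO (p ⬝ i) (y ⬝ i) :=
  (sat_solAt _ _ _ _ _).1 (h i)

/-- Truth of a formula at two successive instantiations. -/
theorem sat_inst_lift {σ τ : Ty} (φ : Formula (τ :: σ :: Γ)) (s : Term Γ σ) (t : Term Γ τ)
    (h : φ.sat (Env.cons (t.eval ρ) (Env.cons (s.eval ρ) ρ))) :
    ((φ.subst ((Subst.cons s (Subst.id Γ)).lift τ)).inst t).sat ρ := by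
  refine (Formula.sat_subst _ _ _).2 ?_
  rw [Env.eval_cons]
  refine (Formula.sat_subst _ _ _).2 ?_
  rw [Env.cons_lift, Env.eval_cons]
  exact h

/-- Once the two functionals are given as terms, the rest of the reduction is in `Goal`, and only
its truth in the models remains to be checked. -/
theorem proves_leW {Q P : Problem Γ} {H : List (Formula Γ)} (hH : ∀ ψ ∈ H, ψ.Hyp)
    (Φ : Term Γ (Ty.arrow Q.inTy P.inTy))
    (Ψ : Term Γ (Ty.arrow Q.inTy (Ty.arrow P.outTy Q.outTy)))
    (hQd : Q.dom.Hyp) (hPd : P.dom.Goal) (hPs : P.sol.Hyp) (hQs : Q.sol.Goal)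
    (h : ∀ (M : Model) [M.Arith] (ρ : Env M Γ), (∀ ψ ∈ H, ψ.sat ρ) → ∀ u y,
      P.dom.sat (Env.cons (Φ.eval ρ ⬝ u) ρ) ∧
      (P.sol.sat (Env.cons y (Env.cons (Φ.eval ρ ⬝ u) ρ)) →
        Q.sol.sat (Env.cons (Ψ.eval ρ ⬝ u ⬝ y) (Env.cons u ρ)))) : Proves H (Q.leW P) := by
  refine .exI Φ (.exI Ψ ?_)
  refine Goal.proves (Goal.subst (Goal.subst (Goal.all (Goal.all (Hyp.imp_goal (Hyp.subst hQd _)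
    (Goal.and (Goal.subst hPd _) (Hyp.imp_goal (Hyp.subst hPs _) (Goal.subst hQs _)))))) _) _) hH
    fun M _ ρ hρ => sat_inst_lift _ _ _ _ fun u y _ => ?_
  obtain ⟨h₁, h₂⟩ := h M ρ hρ u y
  exact ⟨(sat_domAt _ _ _ _).2 h₁, fun h₃ =>
    (sat_solAt _ _ _ _ _).2 (h₂ ((sat_solAt _ _ _ _ _).1 h₃))⟩

theorem proves_leStrong {Q P : Problem Γ} {H : List (Formula Γ)} (hH : ∀ ψ ∈ H, ψ.Hyp)
    (Φ : Term Γ (Ty.arrow Q.inTy P.inTy)) (Ψ : Term Γ (Ty.arrow P.outTy Q.outTy))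
    (hQd : Q.dom.Hyp) (hPd : P.dom.Goal) (hPs : P.sol.Hyp) (hQs : Q.sol.Goal)
    (h : ∀ (M : Model) [M.Arith] (ρ : Env M Γ), (∀ ψ ∈ H, ψ.sat ρ) → ∀ u y,
      P.dom.sat (Env.cons (Φ.eval ρ ⬝ u) ρ) ∧
      (P.sol.sat (Env.cons y (Env.cons (Φ.eval ρ ⬝ u) ρ)) →
        Q.sol.sat (Env.cons (Ψ.eval ρ ⬝ y) (Env.cons u ρ)))) : Proves H (Q.leStrong P) := by
  refine .exI Φ (.exI Ψ ?_)
  refine Goal.proves (Goal.subst (Goal.subst (Goal.all (Goal.all (Hyp.imp_goal (Hyp.subst hQd _)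
    (Goal.and (Goal.subst hPd _) (Hyp.imp_goal (Hyp.subst hPs _) (Goal.subst hQs _)))))) _) _) hH
    fun M _ ρ hρ => sat_inst_lift _ _ _ _ fun u y _ => ?_
  obtain ⟨h₁, h₂⟩ := h M ρ hρ u y
  exact ⟨(sat_domAt _ _ _ _).2 h₁, fun h₃ =>
    (sat_solAt _ _ _ _ _).2 (h₂ ((sat_solAt _ _ _ _ _).1 h₃))⟩

theorem goal_hat_LPO_dom : (LPO (Γ := Γ)).hat.dom.Goal := Goal.all (Goal.subst goal_top _)

theorem sat_hat_LPO_dom (ρ : Env M ((LPO (Γ := Γ)).hat.inTy :: Γ)) :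
    (LPO (Γ := Γ)).hat.dom.sat ρ := fun _ h => h

theorem hyp_hat_LPO : (LPO (Γ := Γ)).hat.sol.Hyp := Hyp.all (Hyp.subst hyp_LPO _)

theorem pos_of_two_le [M.Arith] {ρ : Env M [Ty.nat]}
    (h : ∀ ψ ∈ [Formula.le (Term.suc (Term.suc Term.zero)) v0], ψ.sat ρ) :
    (0 : M.N) < (v0 : Term [Ty.nat] Ty.nat).eval ρ := by
  have h' := (sat_le _ _ _).1 (h _ List.mem_cons_self)
  simp only [eval_suc, eval_zero] at h'
  exact ((zero_lt_add_one _).trans (lt_add_one _)).trans_le h'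

theorem hyp_two_le : ∀ ψ ∈ [Formula.le (Term.suc (Term.suc Term.zero)) (v0 : Term [Ty.nat] _)],
    ψ.Hyp :=
  List.forall_mem_cons.2 ⟨Exact.hyp (exact_le _ _), by simp⟩

theorem LPO_leW_TGC : Proves [Formula.le (Term.suc (Term.suc Term.zero)) v0]
    (LPO.leW (TGC (v0 : Term [Ty.nat] Ty.nat))) := by
  refine proves_leW hyp_two_le graphTerm.cl flagTerm.cl hyp_top goal_top (hyp_TGC _) goal_LPO
    fun M _ ρ hρ (p f : M.F) => ⟨fun h => h, fun h => ?_⟩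
  have h' := (sat_TGC ρ v0 (graphTerm.cl.eval ρ ⬝ p) f).1 h
  have h'' : IsLPO p (flagTerm.cl.eval ρ ⬝ p ⬝ f) := by
    rw [eval_cl] at h' ⊢
    exact isLPO_flag (pos_of_two_le hρ) h'.1 h'.2
  exact h''

theorem TGC_leW_hat_LPO : Proves [Formula.le (Term.suc (Term.suc Term.zero)) v0]
    ((TGC (v0 : Term [Ty.nat] Ty.nat)).leW LPO.hat) := by
  -- The combinator `K` discards the graph: the coloring is computed from the answers alone.
  refine proves_leW hyp_two_le (obstructionTerm.cl.app v0) (Term.K.app (totalTerm.cl.app v0))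
    hyp_top goal_hat_LPO_dom hyp_hat_LPO (goal_TGC _) fun M _ ρ hρ (e y : M.F) =>
      ⟨sat_hat_LPO_dom _, fun h => ?_⟩
  have h₁ := sat_hat_LPO ρ ((obstructionTerm.cl.app v0).eval ρ ⬝ e) y h
  refine (sat_TGC ρ v0 e ((Term.K.app (totalTerm.cl.app v0)).eval ρ ⬝ e ⬝ y)).2 ?_
  simp only [eval_app, eval_cl] at h₁ ⊢
  rw [show (Term.K : Term [Ty.nat] (Ty.arrow (Ty.arrow Ty.one Ty.one)
    (Ty.arrow Ty.one (Ty.arrow Ty.one Ty.one)))).eval ρ = M.K from rfl, M.K_app]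
  have h₂ := total_spec (pos_of_two_le hρ) h₁
  exact ⟨h₂.1, fun h => (h₂.2 h).1⟩

theorem LPO_leStrong_TGCfirst : Proves [Formula.le (Term.suc (Term.suc Term.zero)) v0]
    (LPO.leStrong (TGCfirst (v0 : Term [Ty.nat] Ty.nat))) := by
  refine proves_leStrong hyp_two_le graphTerm.cl (flagTermFirst.cl.app v0) hyp_top goal_top
    (hyp_TGCfirst _) goal_LPO fun M _ ρ hρ (p f : M.F) => ⟨fun h => h, fun h => ?_⟩
  have h' := (sat_TGCfirst ρ v0 (graphTerm.cl.eval ρ ⬝ p) f).1 h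
  have h'' : IsLPO p ((flagTermFirst.cl.app v0).eval ρ ⬝ f) := by
    rw [eval_cl] at h'
    rw [eval_app, eval_cl]
    exact isLPO_flagFirst (pos_of_two_le hρ) h'.1 h'.2
  exact h''

theorem TGCfirst_leStrong_hat_LPO : Proves [Formula.le (Term.suc (Term.suc Term.zero)) v0]
    ((TGCfirst (v0 : Term [Ty.nat] Ty.nat)).leStrong LPO.hat) := by
  refine proves_leStrong hyp_two_le (obstructionTerm.cl.app v0) (totalTerm.cl.app v0)
    hyp_top goal_hat_LPO_dom hyp_hat_LPO (goal_TGCfirst _) fun M _ ρ hρ (e y : M.F) =>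
      ⟨sat_hat_LPO_dom _, fun h => ?_⟩
  have h₁ := sat_hat_LPO ρ ((obstructionTerm.cl.app v0).eval ρ ⬝ e) y h
  refine (sat_TGCfirst ρ v0 e ((totalTerm.cl.app v0).eval ρ ⬝ y)).2 ?_
  simp only [eval_app, eval_cl] at h₁ ⊢
  exact total_spec (pos_of_two_le hρ) h₁

end Problem
end IRCA

theorem mainTheorem6 :
    IRCA.Provable (IRCA.Formula.all IRCA.Ty.nat
      ((IRCA.Formula.le (IRCA.Term.suc (IRCA.Term.suc IRCA.Term.zero)) IRCA.v0).imp
        (IRCA.Formula.and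
          ((IRCA.LPO.leW (IRCA.TGC IRCA.v0)).and
            ((IRCA.TGC IRCA.v0).leW IRCA.LPO.hat))
          ((IRCA.LPO.leStrong (IRCA.TGCfirst IRCA.v0)).and
            ((IRCA.TGCfirst IRCA.v0).leStrong IRCA.LPO.hat))))) :=
  .allI (.impI (.andI (.andI IRCA.Problem.LPO_leW_TGC IRCA.Problem.TGC_leW_hat_LPO)
    (.andI IRCA.Problem.LPO_leStrong_TGCfirst IRCA.Problem.TGCfirst_leStrong_hat_LPO)))
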